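/- Let $C_P,C_F,C_G\in\mathbb R$, $C_L>0$ and $T>0$ satisfy $$\tfrac12 C_F T^2 + C_G T < C_L .$$ There is a constant $C>0$, depending only on $(C_P,C_L,C_F,C_G,T)$ (in particular not on $n$ or $d$), such that the following holds for all $n,d\in\mathbb N$. **Noise.** Let $(\Omega,\mathcal F,\mathbb P)$ be a probability space with a standard Brownian motion $\mathbf W=(W^1,\dots,W^n)$ in $(\mathbb R^d)^n$, a $\sigma$-algebra $\mathcal F_0\subset\mathcal F$ independent of $\mathbf W$, and an $\mathcal F_0$-measurable square-integrable initial state $\boldsymbol\xi=(\xi^1,\dots,\xi^n)$ with independent components (for instance a deterministic one). Let $\mathbb F$ be the augmented filtration generated by $\mathcal F_0$ and $\mathbf W$, and $\mathbb F^i$ the augmented filtration generated by $\xi^i$ and $W^i$. **Data.** Let $F,G:(\mathbb R^d)^n\to\mathbb R$ be bounded from below and $C^2$ with bounded derivatives of orders $1$ and $2$, and suppose $$D^2F\ge -\tfrac{C_F}{n}I,\qquad D^2G\ge-\tfrac{C_G}{n}I .$$ For $i=1,\dots,n$ let $L^i=L^i(x,a):\mathbb R^d\times\mathbb R^d\to\mathbb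 R$ be bounded from below, let $L^i$ and $H^i(x,p)=\sup_{a}(-a\cdot p-L^i(x,a))$ be $C^2$ with bounded derivatives of order $2$, and suppose $D^2L^i(x,a)\ge C_L\begin{pmatrix}0&0\\0&I_{d}\end{pmatrix}$ for all $x,a$. **Control problems.** For a square-integrable progressively measurable $(\mathbb R^d)^n$-valued process $\boldsymbol\beta=(\beta^1,\dots,\beta^n)$ on $[0,T]$ put $X_t^i=\xi^i+\int_0^t\beta^i_s\,ds+W^i_t$ and $$J(\boldsymbol\beta)=\mathbb E\Big[\int_0^T\Big(\frac1n\sum_{i=1}^nL^i(X^i_t,\beta^i_t)+F(\mathbf X_t)\Big)dt+G(\mathbf X_T)\Big].$$ Let $\boldsymbol\alpha$ minimize $J$ over the processes $\boldsymbol\beta$ for which each $\beta^i$ is $\mathbb F^i$-progressively measurable (the distributed problem), and let $\overline{\boldsymbol\alpha}$ minimize $J$ over all $\mathbb F$-progressively measurable $\boldsymbol\beta$ (the full-information problem), both over square-integrable open-loop controls. Let $\mathbf X$ be the state process of $\boldsymbol\alpha$, and suppose that for each $t\in[0,T]$ its law $m_t=\mathcal L(\mathbf X_t)$ satisfies the Poincaré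 inequality with constant $C_P$: $\operatorname{Var}_{m_t}(g)\le C_P\int|Dg|^2\,dm_t$ for all bounded Lipschitz $C^1$ functions $g:(\mathbb R^d)^n\to\mathbb R$. Then $$\mathbb E\int_0^T|\boldsymbol\alpha_t-\overline{\boldsymbol\alpha}_t|^2\,dt\le C\,n^2\sum_{1\le i<j\le n}\big(\|D_{ij}F\|_\infty^2+\|D_{ij}G\|_\infty^2\big),$$ where $D_{ij}F=(\partial_{x^i_k}\partial_{x^j_l}F)_{k,l\le d}$, and $\|D_{ij}F\|_\infty$ is the supremum over $(\mathbb R^d)^n$ of the Frobenius norm of this $d\times d$ block (likewise for $G$). -/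

import Mathlib

open MeasureTheory ProbabilityTheory
open scoped NNReal

noncomputable section

namespace DistributedControl

/-! ### The state space -/

/-- The space `ℝ^d` with its Euclidean norm. -/
abbrev Vec (d : ℕ) : Type := EuclideanSpace ℝ (Fin d)

/-- The space `(ℝ^d)^n` of configurations `x = (x^1, …, x^n)`, with the Euclidean norm
`|x|² = ∑ i, |x^i|²`. -/
abbrev Conf (n d : ℕ) : Type := PiLp 2 (fun _ : Fin n => Vec d)

/-- The unit vector of `(ℝ^d)^n` in the direction of the coordinate `x^i_k`. -/
def unitVec {n d : ℕ} (i : Fin n) (k : Fin d) : Conf n d :=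
  PiLp.single 2 i (EuclideanSpace.single k (1 : ℝ))

/-! ### Second derivatives -/

/-- The Hessian of `u` at `x`, as a bilinear form: `hess u x v w = vᵀ D²u(x) w`. -/
def hess {E : Type*} [NormedAddCommGroup E] [NormedSpace ℝ E] (u : E → ℝ) (x v w : E) : ℝ :=
  fderiv ℝ (fderiv ℝ u) x v w

/-- The `d × d` block `D_{ij} u (x)`, with entries `D_{x^i_k x^j_l} u (x)`. -/
def hessBlock {n d : ℕ} (u : Conf n d → ℝ) (i j : Fin n) (x : Conf n d) :
    Matrix (Fin d) (Fin d) ℝ :=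
  Matrix.of fun k l => hess u x (unitVec i k) (unitVec j l)

/-- The Frobenius norm of a real square matrix. -/
def frobenius {d : ℕ} (A : Matrix (Fin d) (Fin d) ℝ) : ℝ :=
  Real.sqrt (∑ k, ∑ l, A k l ^ 2)

/-- `‖D_{ij} u‖_∞`: the supremum over `(ℝ^d)^n` of the Frobenius norm of the block `D_{ij} u`. -/
def blockSupNorm {n d : ℕ} (u : Conf n d → ℝ) (i j : Fin n) : ℝ :=
  ⨆ x : Conf n d, frobenius (hessBlock u i j x)

/-- `u` is of class `C²` with bounded derivatives of order two. -/
def C2BoundedHess {E : Type*} [NormedAddCommGroup E] [NormedSpace ℝ E] (u : E → ℝ) : Prop :=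
  ContDiff ℝ 2 u ∧ ∃ K : ℝ, ∀ x, ‖fderiv ℝ (fderiv ℝ u) x‖ ≤ K

/-! ### Assumptions on the data -/

/-- Assumptions on a cost function `u` on `(ℝ^d)^n`: it is bounded from below, of class `C²` with
bounded derivatives of orders one and two, and `D²u ≥ -(c/n) I`. -/
structure CostAssumption {n d : ℕ} (u : Conf n d → ℝ) (c : ℝ) : Prop where
  bddBelow : BddBelow (Set.range u)
  c2 : C2BoundedHess u
  bddGrad : ∃ K : ℝ, ∀ x, ‖fderiv ℝ u x‖ ≤ K
  semiconvex : ∀ x y : Conf n d, -(c / n) * ‖y‖ ^ 2 ≤ hess u x y y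

/-- The Hamiltonian `H(x,p) = sup_a (- a · p - L(x,a))` of a Lagrangian `L`. -/
def hamiltonian {d : ℕ} (L : Vec d × Vec d → ℝ) (q : Vec d × Vec d) : ℝ :=
  ⨆ a : Vec d, (-(inner ℝ a q.2) - L (q.1, a))

/-- Assumptions on a Lagrangian `L = L(x,a)`: it is bounded from below, `L` and its Hamiltonian are
of class `C²` with bounded derivatives of order two, and `D²L(x,a) ≥ c diag(0, I)`. -/
structure LagrangianAssumption {d : ℕ} (L : Vec d × Vec d → ℝ) (c : ℝ) : Prop where
  bddBelow : BddBelow (Set.range L)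
  c2 : C2BoundedHess L
  c2_hamiltonian : C2BoundedHess (hamiltonian L)
  convex : ∀ q v : Vec d × Vec d, c * ‖v.2‖ ^ 2 ≤ hess L q v v

/-! ### Poincaré inequality -/

/-- The measure `m` satisfies the Poincaré inequality with constant `c`:
`Var_m(g) ≤ c ∫ |Dg|² dm` for all bounded Lipschitz functions `g`. The test functions are taken
of class `C¹`, so that `Dg` is defined at every point, also where `m` is singular. -/
def Poincare {E : Type*} [NormedAddCommGroup E] [NormedSpace ℝ E] [MeasurableSpace E]
    (m : Measure E) (c : ℝ) : Prop :=
  ∀ g : E → ℝ, ContDiff ℝ 1 g → (∃ K, LipschitzWith K g) → (∃ B : ℝ, ∀ x, |g x| ≤ B) →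
    (∫ x, g x ^ 2 ∂m) - (∫ x, g x ∂m) ^ 2 ≤ c * ∫ x, ‖fderiv ℝ g x‖ ^ 2 ∂m

/-! ### The probabilistic set-up -/

/-- The driving noise and the initial state on the probability space `(Ω, P)`: a standard Brownian
motion `W = (W^1, …, W^n)` with values in `(ℝ^d)^n`, a σ-algebra `𝓕₀` independent of `W`, and
independent square-integrable `𝓕₀`-measurable initial states `ξ^1, …, ξ^n`. -/
structure Noise (n d : ℕ) {Ω : Type*} [mΩ : MeasurableSpace Ω] (P : Measure Ω) where
  /-- the Brownian motion -/
  W : ℝ≥0 → Ω → Conf n d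
  /-- the initial state -/
  ξ : Ω → Conf n d
  measurable_W : ∀ t, Measurable (W t)
  brownian : ∀ (i : Fin n) (k : Fin d), IsBrownianReal (fun t ω => W t ω i k) P
  indep_W : iIndepFun (fun (p : Fin n × Fin d) (ω : Ω) (t : ℝ≥0) => W t ω p.1 p.2) P
  indep_ξ : iIndepFun (fun (i : Fin n) (ω : Ω) => ξ ω i) P
  memLp_ξ : MemLp ξ 2 P
  /-- the initial σ-algebra `𝓕₀` -/
  init : MeasurableSpace Ω
  init_le : init ≤ mΩ
  indep_init : Indep init (⨆ t, MeasurableSpace.comap (W t) inferInstance) P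
  measurable_ξ : Measurable[init] ξ

/-- The σ-algebra generated by the `P`-null sets, used to augment filtrations. -/
abbrev nullSets {Ω : Type*} [MeasurableSpace Ω] (P : Measure Ω) : MeasurableSpace Ω :=
  MeasurableSpace.generateFrom {A | MeasurableSet A ∧ P A = 0}

theorem nullSets_le {Ω : Type*} [mΩ : MeasurableSpace Ω] (P : Measure Ω) : nullSets P ≤ mΩ :=
  MeasurableSpace.generateFrom_le fun _ h => h.1

/-- Lebesgue measure on the time axis `[0, ∞)`. -/
def timeMeasure : Measure ℝ≥0 := Measure.comap ((↑) : ℝ≥0 → ℝ) volume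

namespace Noise

variable {n d : ℕ} {Ω : Type*} [mΩ : MeasurableSpace Ω] {P : Measure Ω}

/-- The augmented filtration generated by `𝓕₀` and `W`. -/
def fullFiltration (N : Noise n d P) : Filtration ℝ≥0 mΩ where
  seq t := N.init ⊔ (⨆ s ≤ t, MeasurableSpace.comap (N.W s) inferInstance) ⊔ nullSets P
  mono' _ _ hst :=
    sup_le_sup_right (sup_le_sup_left (biSup_mono fun _ hr => hr.trans hst) _) _
  le' _ := sup_le (sup_le N.init_le (iSup₂_le fun s _ => (N.measurable_W s).comap_le))
    (nullSets_le P)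

theorem measurable_W_apply (N : Noise n d P) (i : Fin n) (t : ℝ≥0) :
    Measurable fun ω => N.W t ω i :=
  (PiLp.continuous_apply 2 (fun _ : Fin n => Vec d) i).measurable.comp (N.measurable_W t)

theorem measurable_ξ_apply (N : Noise n d P) (i : Fin n) : Measurable fun ω => N.ξ ω i :=
  (PiLp.continuous_apply 2 (fun _ : Fin n => Vec d) i).measurable.comp
    (N.measurable_ξ.mono N.init_le le_rfl)

/-- The augmented filtration generated by `ξ^i` and `W^i`. -/
def agentFiltration (N : Noise n d P) (i : Fin n) : Filtration ℝ≥0 mΩ where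
  seq t := MeasurableSpace.comap (fun ω => N.ξ ω i) inferInstance ⊔
    (⨆ s ≤ t, MeasurableSpace.comap (fun ω => N.W s ω i) inferInstance) ⊔ nullSets P
  mono' _ _ hst :=
    sup_le_sup_right (sup_le_sup_left (biSup_mono fun _ hr => hr.trans hst) _) _
  le' _ := sup_le (sup_le (N.measurable_ξ_apply i).comap_le
    (iSup₂_le fun s _ => (N.measurable_W_apply i s).comap_le)) (nullSets_le P)

/-! ### The control problems -/

/-- The state process `X_t = ξ + ∫_0^t α_s ds + W_t` of an (open-loop) control `α`. -/
def state (N : Noise n d P) (α : ℝ≥0 → Ω → Conf n d) (t : ℝ≥0) (ω : Ω) : Conf n d :=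
  N.ξ ω + (∫ s in Set.Iic t, α s ω ∂timeMeasure) + N.W t ω

/-- The cost `E [∫_0^T ((1/n) ∑ i, L^i(X^i_t, α^i_t) + F(X_t)) dt + G(X_T)]`. -/
def cost (N : Noise n d P) (T : ℝ≥0) (L : Fin n → Vec d × Vec d → ℝ) (F G : Conf n d → ℝ)
    (α : ℝ≥0 → Ω → Conf n d) : ℝ :=
  ∫ ω, ((∫ t in Set.Iic T,
      ((1 / (n : ℝ)) * (∑ i, L i (N.state α t ω i, α t ω i)) + F (N.state α t ω)) ∂timeMeasure)
    + G (N.state α T ω)) ∂P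

/-- `α` is square-integrable on `[0,T] × Ω`. -/
def SquareIntegrable (P : Measure Ω) (T : ℝ≥0) (α : ℝ≥0 → Ω → Conf n d) : Prop :=
  MemLp (fun p : ℝ≥0 × Ω => α p.1 p.2) 2 ((timeMeasure.restrict (Set.Iic T)).prod P)

/-- Open-loop full-information controls: square-integrable processes that are progressively
measurable with respect to the filtration generated by `𝓕₀` and `W`. -/
def IsFullControl (N : Noise n d P) (T : ℝ≥0) (α : ℝ≥0 → Ω → Conf n d) : Prop :=
  IsProgressive N.fullFiltration α ∧ SquareIntegrable P T α

/-- Open-loop distributed controls: square-integrable processes `α = (α^1, …, α^n)` such that `α^i`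
is progressively measurable with respect to the filtration generated by `ξ^i` and `W^i`. -/
def IsDistributedControl (N : Noise n d P) (T : ℝ≥0) (α : ℝ≥0 → Ω → Conf n d) : Prop :=
  (∀ i, IsProgressive (N.agentFiltration i) (fun t ω => α t ω i)) ∧ SquareIntegrable P T α

/-- `α` minimizes the cost among full-information controls. -/
def IsFullOptimal (N : Noise n d P) (T : ℝ≥0) (L : Fin n → Vec d × Vec d → ℝ)
    (F G : Conf n d → ℝ) (α : ℝ≥0 → Ω → Conf n d) : Prop :=
  N.IsFullControl T α ∧ ∀ β, N.IsFullControl T β → N.cost T L F G α ≤ N.cost T L F G β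

/-- `α` minimizes the cost among distributed controls. -/
def IsDistributedOptimal (N : Noise n d P) (T : ℝ≥0) (L : Fin n → Vec d × Vec d → ℝ)
    (F G : Conf n d → ℝ) (α : ℝ≥0 → Ω → Conf n d) : Prop :=
  N.IsDistributedControl T α ∧
    ∀ β, N.IsDistributedControl T β → N.cost T L F G α ≤ N.cost T L F G β

end Noise

end DistributedControl

end

/-!
The argument combines strong convexity of the cost with a Poincaré estimate of its derivative at the
distributed optimum.

Let `α` and `αbar` be the distributed and the full-information optimum, `δ = αbar - α`, let `ℓ` be
the derivative of the cost `J` at `α` (`costDeriv`), and let `Q(φ) = E ∫_0^T |φ_t|² dt` (`energy`).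
The convexity of the Lagrangians in the control beats the possible concavity of `F` and `G` because
of the smallness condition on `T`; with `c = C_L - (C_F T² / 2 + C_G T)`, this gives `J(α) + ℓ(δ) +
c / (2 n) Q(δ) ≤ J(αbar)` (`cost_lower`). As `J(αbar) ≤ J(α)`, it follows that `c / (2 n) Q(δ) ≤
|ℓ(δ)|`, and it remains to bound `ℓ` on full-information controls.

By optimality, `ℓ` vanishes on distributed controls (`costDeriv_eq_zero`). If `φ` is a step process,
let `φ̂` be the distributed control obtained by taking, on each cell, the conditional expectation of
the `i`-th component given the information of agent `i` at the beginning of the cell. Then `ℓ(φ) =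
ℓ(φ - φ̂)`, and each component `i` of `φ - φ̂` is orthogonal even to the information of agent `i`
over all times, since the later increments of the Brownian motion are independent of the present
full information (`condExp_sub_condExp_agentFiltration`, `exists_distributed_of_stepPath`). In such
a direction, the Lagrangian part of `ℓ` vanishes, because the state and the control of agent `i`
under `α` only depend on his own information. In the parts coming from `F` and `G`, each partial
derivative `∂_{x^i_k} F(X_t)` may be replaced by its difference with a function of `X^i_t` alone.
The states of the agents are independent, so averaging over the other components is a good choice,
and the Poincaré inequality bounds the mean square of the difference by the off-diagonal second
derivatives (`exists_coordinate_approx`). This yields `abs_costDeriv_le_of_orthogonal`.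

Step processes are dense in the full-information controls (`exists_stepPath_energy_lt`): a bounded
control is the limit of its averages over the preceding time cell, by Lebesgue differentiation along
the paths. As `ℓ` is continuous, the bound passes to `δ`, and Young's inequality with a parameter of
order `n / c` absorbs the part containing `Q(δ)`.

Working with step processes avoids the projection of general progressive processes on the agents'
filtrations.
-/

noncomputable section

namespace DistributedControl

/-! ### Second-order Taylor bounds -/

section Taylor

variable {E : Type*} [NormedAddCommGroup E] [NormedSpace ℝ E] {u : E → ℝ}

theorem differentiable_fderiv_of_contDiff_two (hu : ContDiff ℝ 2 u) :
    Differentiable ℝ (fderiv ℝ u) :=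
  (hu.fderiv_right (m := 1) (by norm_num)).differentiable (by norm_num)

/-- If the second derivative of `u` in the direction `v` is everywhere at least `c`, then `u` lies
above its first-order expansion, plus `c / 2`. -/
theorem taylor_lower (hu : ContDiff ℝ 2 u) (x v : E) {c : ℝ} (hc : ∀ z, c ≤ hess u z v v) :
    u x + fderiv ℝ u x v + c / 2 ≤ u (x + v) := by
  have hd : Differentiable ℝ u := hu.differentiable (by norm_num)
  have hd' := differentiable_fderiv_of_contDiff_two hu
  have hline : ∀ t : ℝ, HasDerivAt (fun t : ℝ => x + t • v) v t := fun t => by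
    simpa using ((hasDerivAt_id t).smul_const v).const_add x
  have h1 : ∀ t : ℝ, HasDerivAt (fun t : ℝ => u (x + t • v)) (fderiv ℝ u (x + t • v) v) t :=
    fun t => (hd _).hasFDerivAt.comp_hasDerivAt t (hline t)
  have h2 : ∀ t : ℝ, HasDerivAt (fun t : ℝ => fderiv ℝ u (x + t • v) v)
      (hess u (x + t • v) v v) t := fun t => by
    have := (hd' (x + t • v)).hasFDerivAt.comp_hasDerivAt t (hline t)
    exact this.clm_apply (hasDerivAt_const t v) |>.congr_deriv (by simp [hess])
  have h3 : Monotone (fun t : ℝ => fderiv ℝ u (x + t • v) v - c * t) := by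
    refine monotone_of_deriv_nonneg (fun t => ?_) (fun t => ?_)
    · exact ((h2 t).sub ((hasDerivAt_id t).const_mul c)).differentiableAt
    · have hd : HasDerivAt (fun t : ℝ => fderiv ℝ u (x + t • v) v - c * t)
          (hess u (x + t • v) v v - c * 1) t := (h2 t).sub ((hasDerivAt_id t).const_mul c)
      rw [hd.deriv]
      linarith [hc (x + t • v)]
  have h4 : ∀ t : ℝ, HasDerivAt
      (fun t : ℝ => u (x + t • v) - t * fderiv ℝ u x v - c * t ^ 2 / 2)
      (fderiv ℝ u (x + t • v) v - fderiv ℝ u x v - c * t) t := fun t => by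
    have := ((h1 t).sub ((hasDerivAt_id t).mul_const (fderiv ℝ u x v))).sub
      ((((hasDerivAt_id t).pow 2).const_mul c).div_const 2)
    refine this.congr_deriv ?_
    simp only [id, one_mul, Nat.cast_ofNat]; ring
  have h5 : MonotoneOn (fun t : ℝ => u (x + t • v) - t * fderiv ℝ u x v - c * t ^ 2 / 2)
      (Set.Icc 0 1) := by
    refine monotoneOn_of_deriv_nonneg (convex_Icc 0 1)
      (fun t _ => (h4 t).continuousAt.continuousWithinAt)
      (fun t _ => (h4 t).differentiableAt.differentiableWithinAt) (fun t ht => ?_)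
    rw [interior_Icc] at ht
    rw [(h4 t).deriv]
    have := h3 ht.1.le
    simp only [zero_smul, add_zero, mul_zero] at this
    linarith
  have := h5 (Set.left_mem_Icc.2 zero_le_one) (Set.right_mem_Icc.2 zero_le_one) zero_le_one
  simp only [zero_smul, add_zero, one_smul] at this
  linarith

theorem abs_hess_le {K : ℝ} (hK : ∀ x, ‖fderiv ℝ (fderiv ℝ u) x‖ ≤ K) (x v w : E) :
    |hess u x v w| ≤ K * ‖v‖ * ‖w‖ := by
  rw [← Real.norm_eq_abs]
  exact ((fderiv ℝ (fderiv ℝ u) x).le_opNorm₂ v w).trans (by gcongr; exact hK x)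

theorem taylor_upper (hu : ContDiff ℝ 2 u) {K : ℝ} (hK : ∀ x, ‖fderiv ℝ (fderiv ℝ u) x‖ ≤ K)
    (x v : E) : u (x + v) ≤ u x + fderiv ℝ u x v + K * ‖v‖ ^ 2 / 2 := by
  have hneg : ∀ y, fderiv ℝ (-u) y = -fderiv ℝ u y := fun y => fderiv_neg
  have hneg' : fderiv ℝ (-u) = -fderiv ℝ u := funext hneg
  have := taylor_lower hu.neg x v (c := -(K * ‖v‖ ^ 2)) (fun z => by
    have h := abs_hess_le hK z v v
    have e : hess (-u) z v v = -hess u z v v := by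
      simp only [hess, hneg', fderiv_neg]; simp
    change _ ≤ hess (-u) z v v
    rw [e]
    have := (abs_le.1 h).2
    nlinarith)
  rw [show (fun x => -u x) = -u from rfl, hneg'] at this
  simp only [Pi.neg_apply, _root_.neg_apply] at this
  linarith

theorem norm_fderiv_le_of_bounded_hess (hu : ContDiff ℝ 2 u) {K : ℝ}
    (hK : ∀ x, ‖fderiv ℝ (fderiv ℝ u) x‖ ≤ K) (x : E) :
    ‖fderiv ℝ u x‖ ≤ ‖fderiv ℝ u 0‖ + K * ‖x‖ := by
  have := Convex.norm_image_sub_le_of_norm_fderiv_le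
    (fun z _ => differentiable_fderiv_of_contDiff_two hu z) (fun z _ => hK z) convex_univ
    (Set.mem_univ (0 : E)) (Set.mem_univ x)
  have h2 := norm_sub_norm_le (fderiv ℝ u x) (fderiv ℝ u 0)
  rw [sub_zero] at this
  linarith

/-- A function with bounded gradient cannot be uniformly convex, so a lower bound `-c` of its
Hessian has `c ≥ 0`. -/
theorem nonneg_of_bounded_grad [Nontrivial E] (hu : ContDiff ℝ 2 u) {K c : ℝ}
    (hK : ∀ x, ‖fderiv ℝ u x‖ ≤ K) (hc : ∀ x y, -c * ‖y‖ ^ 2 ≤ hess u x y y) :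
    0 ≤ c := by
  by_contra! hneg
  obtain ⟨e, he⟩ := exists_norm_eq E (zero_le_one (α := ℝ))
  have hup : ∀ t : ℝ, 0 ≤ t → u (t • e) ≤ u 0 + K * t := fun t ht => by
    have := Convex.norm_image_sub_le_of_norm_fderiv_le
      (fun z _ => (hu.differentiable (by norm_num)) z) (fun z _ => hK z) convex_univ
      (Set.mem_univ (0 : E)) (Set.mem_univ (t • e))
    rw [sub_zero, norm_smul, he, Real.norm_eq_abs, Real.norm_eq_abs, abs_of_nonneg ht] at this
    have := (abs_le.1 this).2
    linarith
  have hlo : ∀ t : ℝ, 0 ≤ t → u 0 - K * t + -c * t ^ 2 / 2 ≤ u (t • e) := fun t ht => by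
    have h1 := taylor_lower hu 0 (t • e) (hc · (t • e))
    rw [zero_add, norm_smul, he, Real.norm_eq_abs, mul_one, sq_abs] at h1
    have h2 : |fderiv ℝ u 0 (t • e)| ≤ K * t := by
      rw [← Real.norm_eq_abs]
      refine ((fderiv ℝ u 0).le_opNorm _).trans ?_
      rw [norm_smul, he, Real.norm_eq_abs, abs_of_nonneg ht, mul_one]
      exact mul_le_mul_of_nonneg_right (hK 0) ht
    have := (abs_le.1 h2).1
    linarith
  have hK0 : 0 ≤ K := (norm_nonneg _).trans (hK 0)
  -- at this time the quadratic lower bound has overtaken the linear upper bound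
  set t : ℝ := (4 * K + 1) / -c
  have hc' : 0 < -c := by linarith
  have ht : 0 < t := by positivity
  have hct : -c * t = 4 * K + 1 := by exact mul_div_cancel₀ _ hc'.ne'
  have := (hlo t ht.le).trans (hup t ht.le)
  nlinarith

end Taylor

/-! ### Square-integrable arguments -/

section Expansion

variable {S : Type*} [MeasurableSpace S] {μ : Measure S}

/-- The Cauchy-Schwarz inequality. -/
theorem integral_mul_le_sqrt {f g : S → ℝ} (hf : MemLp f 2 μ) (hg : MemLp g 2 μ) :
    |∫ s, f s * g s ∂μ| ≤ Real.sqrt (∫ s, f s ^ 2 ∂μ) * Real.sqrt (∫ s, g s ^ 2 ∂μ) := by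
  have habs := abs_real_inner_le_norm (hf.toLp f) (hg.toLp g)
  have e : ∀ {f g : S → ℝ} (hf : MemLp f 2 μ) (hg : MemLp g 2 μ),
      inner ℝ (hf.toLp f) (hg.toLp g) = ∫ s, f s * g s ∂μ := by
    intro f g hf hg
    rw [L2.inner_def]
    refine integral_congr_ae ?_
    filter_upwards [hf.coeFn_toLp, hg.coeFn_toLp] with s h1 h2
    rw [h1, h2]; simp [mul_comm]
  have n : ∀ {f : S → ℝ} (hf : MemLp f 2 μ), ‖hf.toLp f‖ = Real.sqrt (∫ s, f s ^ 2 ∂μ) := by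
    intro f hf
    rw [norm_eq_sqrt_real_inner, e hf hf]
    simp only [pow_two]
  rwa [e hf hg, n, n] at habs

variable {E : Type*} [NormedAddCommGroup E]

theorem integrable_sq_norm_of_memLp {f : S → E} (hf : MemLp f 2 μ) :
    Integrable (fun s => ‖f s‖ ^ 2) μ :=
  (memLp_two_iff_integrable_sq_norm hf.1).1 hf

theorem integrable_norm_mul_norm {F : Type*} [NormedAddCommGroup F] {f : S → E} {g : S → F}
    (hf : MemLp f 2 μ) (hg : MemLp g 2 μ) : Integrable (fun s => ‖f s‖ * ‖g s‖) μ :=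
  hf.norm.integrable_mul hg.norm

theorem memLp_two_prodMk {F : Type*} [NormedAddCommGroup F] {f : S → E} {g : S → F}
    (hf : MemLp f 2 μ) (hg : MemLp g 2 μ) : MemLp (fun s => (f s, g s)) 2 μ := by
  refine (memLp_two_iff_integrable_sq_norm (hf.1.prodMk hg.1)).2 ?_
  refine ((integrable_sq_norm_of_memLp hf).add (integrable_sq_norm_of_memLp hg)).mono'
    ((hf.1.prodMk hg.1).norm.pow 2) (Filter.Eventually.of_forall fun s => ?_)
  rw [Real.norm_eq_abs, abs_of_nonneg (by positivity), Prod.norm_def]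
  rcases max_cases ‖f s‖ ‖g s‖ with h | h <;> simp only [h.1, Pi.add_apply] <;>
    nlinarith [sq_nonneg ‖f s‖, sq_nonneg ‖g s‖]

variable [NormedSpace ℝ E] {u : E → ℝ}

theorem aestronglyMeasurable_clm_apply {f : S → E →L[ℝ] ℝ} {v : S → E}
    (hf : AEStronglyMeasurable f μ) (hv : AEStronglyMeasurable v μ) :
    AEStronglyMeasurable (fun s => f s (v s)) μ :=
  (isBoundedBilinearMap_apply.continuous (𝕜 := ℝ)).comp_aestronglyMeasurable (hf.prodMk hv)

variable [IsFiniteMeasure μ]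

theorem memLp_fderiv (hu : C2BoundedHess u) {q : S → E} (hq : MemLp q 2 μ) :
    MemLp (fun s => fderiv ℝ u (q s)) 2 μ := by
  obtain ⟨hu, K, hK⟩ := hu
  have hbound := norm_fderiv_le_of_bounded_hess hu hK
  generalize ‖fderiv ℝ u 0‖ = b at hbound
  have hdom : MemLp (fun s => b + |K| * ‖q s‖) 2 μ :=
    (memLp_const b).add (hq.norm.const_mul |K|)
  have hcont : Continuous (fderiv ℝ u) := hu.continuous_fderiv (by norm_num)
  refine hdom.of_le (hcont.comp_aestronglyMeasurable hq.1)
    (Filter.Eventually.of_forall fun s => ?_)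
  refine ((hbound (q s)).trans ?_).trans (le_abs_self _)
  gcongr
  exact le_abs_self K

theorem integrable_fderiv_apply (hu : C2BoundedHess u) {q v : S → E} (hq : MemLp q 2 μ)
    (hv : MemLp v 2 μ) : Integrable (fun s => fderiv ℝ u (q s) (v s)) μ :=
  (integrable_norm_mul_norm (memLp_fderiv hu hq) hv).mono'
    (aestronglyMeasurable_clm_apply (memLp_fderiv hu hq).1 hv.1)
    (Filter.Eventually.of_forall fun _ => ContinuousLinearMap.le_opNorm _ _)

theorem abs_integral_fderiv_apply_le (hu : C2BoundedHess u) {q : S → E} (hq : MemLp q 2 μ) :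
    ∃ M : ℝ, 0 ≤ M ∧ ∀ v : S → E, MemLp v 2 μ →
      |∫ s, fderiv ℝ u (q s) (v s) ∂μ| ≤ M * Real.sqrt (∫ s, ‖v s‖ ^ 2 ∂μ) := by
  refine ⟨_, Real.sqrt_nonneg (∫ s, ‖fderiv ℝ u (q s)‖ ^ 2 ∂μ), fun v hv => ?_⟩
  calc |∫ s, fderiv ℝ u (q s) (v s) ∂μ| ≤ ∫ s, |fderiv ℝ u (q s) (v s)| ∂μ :=
        abs_integral_le_integral_abs
    _ ≤ ∫ s, ‖fderiv ℝ u (q s)‖ * ‖v s‖ ∂μ :=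
        integral_mono (integrable_fderiv_apply hu hq hv).abs
          (integrable_norm_mul_norm (memLp_fderiv hu hq) hv)
          (fun s => (fderiv ℝ u (q s)).le_opNorm (v s))
    _ ≤ _ := (le_abs_self _).trans (integral_mul_le_sqrt (memLp_fderiv hu hq).norm hv.norm)

theorem integrable_comp (hu : C2BoundedHess u) {q : S → E} (hq : MemLp q 2 μ) :
    Integrable (fun s => u (q s)) μ := by
  obtain ⟨hu', K, hK⟩ := hu
  refine Integrable.mono' (g := fun s => |u 0| + ‖fderiv ℝ u 0‖ * ‖q s‖ + K * ‖q s‖ ^ 2 / 2)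
    (((integrable_const _).add ((hq.integrable one_le_two).norm.const_mul _)).add
      (((integrable_sq_norm_of_memLp hq).const_mul K).div_const 2))
    (hu'.continuous.comp_aestronglyMeasurable hq.1) (Filter.Eventually.of_forall fun s => ?_)
  have h1 := taylor_upper hu' hK 0 (q s)
  have h2 := taylor_lower hu' 0 (q s) (c := -(K * ‖q s‖ ^ 2)) (fun z => by
    have := (abs_le.1 (abs_hess_le hK z (q s) (q s))).1
    linarith)
  have h3 := abs_le.1 ((fderiv ℝ u 0).le_opNorm (q s))
  rw [zero_add] at h1 h2
  have h4 := neg_abs_le (u 0)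
  have h5 := le_abs_self (u 0)
  rw [Real.norm_eq_abs, abs_le]
  constructor <;> linarith [h3.1, h3.2]

/-- Integrated second-order expansion from below. -/
theorem integral_taylor_lower (hu : C2BoundedHess u) {q v : S → E} (hq : MemLp q 2 μ)
    (hv : MemLp v 2 μ) {b : E → ℝ} (hb : Integrable (fun s => b (v s)) μ)
    (hc : ∀ z y, b y ≤ hess u z y y) :
    ∫ s, u (q s) ∂μ + ∫ s, fderiv ℝ u (q s) (v s) ∂μ + (∫ s, b (v s) ∂μ) / 2 ≤
      ∫ s, u (q s + v s) ∂μ := by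
  have h1 : Integrable (fun s => u (q s) + fderiv ℝ u (q s) (v s)) μ :=
    (integrable_comp hu hq).add (integrable_fderiv_apply hu hq hv)
  rw [← integral_add (integrable_comp hu hq) (integrable_fderiv_apply hu hq hv),
    ← integral_div, ← integral_add h1 (hb.div_const 2)]
  exact integral_mono (h1.add (hb.div_const 2)) (integrable_comp hu (hq.add hv))
    (fun s => taylor_lower hu.1 (q s) (v s) (hc · (v s)))

theorem integral_taylor_upper (hu : C2BoundedHess u) {K : ℝ}
    (hK : ∀ x, ‖fderiv ℝ (fderiv ℝ u) x‖ ≤ K) {q v : S → E} (hq : MemLp q 2 μ)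
    (hv : MemLp v 2 μ) :
    ∫ s, u (q s + v s) ∂μ ≤
      ∫ s, u (q s) ∂μ + ∫ s, fderiv ℝ u (q s) (v s) ∂μ + K / 2 * ∫ s, ‖v s‖ ^ 2 ∂μ := by
  have hi := (integrable_sq_norm_of_memLp hv).const_mul (K / 2)
  have h1 : Integrable (fun s => u (q s) + fderiv ℝ u (q s) (v s)) μ :=
    (integrable_comp hu hq).add (integrable_fderiv_apply hu hq hv)
  rw [← integral_add (integrable_comp hu hq) (integrable_fderiv_apply hu hq hv),
    ← integral_const_mul, ← integral_add h1 hi]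
  refine integral_mono (integrable_comp hu (hq.add hv)) (h1.add hi) (fun s => ?_)
  have := taylor_upper hu.1 hK (q s) (v s)
  linarith

end Expansion

/-! ### Independence of σ-algebras -/

section PiSystem

variable {Ω : Type*}

theorem generateFrom_inter_eq_sup (m₁ m₂ : MeasurableSpace Ω) :
    MeasurableSpace.generateFrom
      {s | ∃ A, MeasurableSet[m₁] A ∧ ∃ B, MeasurableSet[m₂] B ∧ A ∩ B = s} = m₁ ⊔ m₂ := by
  refine le_antisymm (MeasurableSpace.generateFrom_le ?_) (sup_le ?_ ?_)
  · rintro _ ⟨A, hA, B, hB, rfl⟩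
    exact MeasurableSet.inter (le_sup_left (a := m₁) A hA) (le_sup_right (a := m₁) B hB)
  · intro A hA
    exact MeasurableSpace.measurableSet_generateFrom
      ⟨A, hA, Set.univ, @MeasurableSet.univ _ m₂, Set.inter_univ A⟩
  · intro B hB
    exact MeasurableSpace.measurableSet_generateFrom
      ⟨Set.univ, @MeasurableSet.univ _ m₁, B, hB, Set.univ_inter B⟩

theorem isPiSystem_inter (m₁ m₂ : MeasurableSpace Ω) :
    IsPiSystem {s | ∃ A, MeasurableSet[m₁] A ∧ ∃ B, MeasurableSet[m₂] B ∧ A ∩ B = s} := by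
  rintro _ ⟨A, hA, B, hB, rfl⟩ _ ⟨A', hA', B', hB', rfl⟩ _
  exact ⟨A ∩ A', hA.inter hA', B ∩ B', hB.inter hB', by ext; simp; tauto⟩

theorem exists_eq_iInter_of_mem_piiUnionInter {ι : Type*} {c : ι → MeasurableSpace Ω} {s : Set Ω}
    (hs : s ∈ piiUnionInter (fun i => {s | MeasurableSet[c i] s}) Set.univ) :
    ∃ f : ι → Set Ω, (∀ i, MeasurableSet[c i] (f i)) ∧ s = ⋂ i, f i := by
  classical
  obtain ⟨t, -, f, hf, rfl⟩ := hs
  refine ⟨fun i => if i ∈ t then f i else Set.univ, fun i => ?_, ?_⟩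
  · by_cases hi : i ∈ t
    · simpa [hi] using hf i hi
    · simp [hi]
  · ext ω
    simp only [Set.mem_iInter]
    refine forall_congr' fun i => ?_
    by_cases hi : i ∈ t <;> simp [hi]

end PiSystem

section Indep

variable {Ω : Type*} {m m₀ m₁ m₂ : MeasurableSpace Ω} [mΩ : MeasurableSpace Ω] {P : Measure Ω}

/-- Augmenting a σ-algebra with null sets only adds sets that agree almost everywhere with one of
its own. -/
theorem exists_ae_eq_of_measurableSet_sup_nullSets {A : Set Ω}
    (hA : MeasurableSet[m ⊔ nullSets P] A) : ∃ B, MeasurableSet[m] B ∧ A =ᵐ[P] B := by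
  have h0 : ∀ s, MeasurableSet s ∧ P s = 0 → ∃ B, MeasurableSet[m] B ∧ s =ᵐ[P] B := fun s hs =>
    ⟨∅, @MeasurableSet.empty _ m, ae_eq_empty.2 hs.2⟩
  unfold nullSets at hA
  let m' : MeasurableSpace Ω :=
    { MeasurableSet' := fun A => ∃ B, MeasurableSet[m] B ∧ A =ᵐ[P] B
      measurableSet_empty := ⟨∅, @MeasurableSet.empty _ m, Filter.EventuallyEq.rfl⟩
      measurableSet_compl := fun A ⟨B, hB, h⟩ => ⟨Bᶜ, hB.compl, h.compl⟩
      measurableSet_iUnion := fun f hf => by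
        choose g hg h using hf
        exact ⟨⋃ i, g i, MeasurableSet.iUnion hg, Filter.EventuallyEq.countable_iUnion h⟩ }
  have h1 : m ≤ m' := fun s hs => ⟨s, hs, Filter.EventuallyEq.rfl⟩
  exact sup_le h1 (MeasurableSpace.generateFrom_le h0) A hA

theorem indep_sup_nullSets (h : Indep m₁ m₂ P) :
    Indep (m₁ ⊔ nullSets P) m₂ P := by
  rw [Indep_iff] at h ⊢
  intro A B hA hB
  obtain ⟨A', hA', h1⟩ := exists_ae_eq_of_measurableSet_sup_nullSets hA
  rw [measure_congr (h1.inter (Filter.EventuallyEq.refl _ B)), measure_congr h1, h A' B hA' hB]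

theorem iIndep_sup_nullSets {ι : Type*} {m : ι → MeasurableSpace Ω} (h : iIndep m P) :
    iIndep (fun i => m i ⊔ nullSets P) P := by
  rw [iIndep_iff] at h ⊢
  intro s f hf
  have : ∀ i, ∃ B, (i ∈ s → MeasurableSet[m i] B) ∧ f i =ᵐ[P] B := fun i => by
    by_cases hi : i ∈ s
    · obtain ⟨B, hB, h⟩ := exists_ae_eq_of_measurableSet_sup_nullSets (hf i hi)
      exact ⟨B, fun _ => hB, h⟩
    · exact ⟨f i, fun h => absurd h hi, Filter.EventuallyEq.rfl⟩
  choose g hg hfg using this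
  have e : (⋂ i ∈ s, f i) =ᵐ[P] ⋂ i ∈ s, g i :=
    Filter.EventuallyEq.biInter s.finite_toSet fun i _ => hfg i
  rw [measure_congr e, h s (f := g) (fun i hi => hg i hi)]
  exact Finset.prod_congr rfl fun i _ => (measure_congr (hfg i)).symm

theorem iIndep_sup {ι : Type*} {a b : ι → MeasurableSpace Ω} (ha : ∀ i, a i ≤ mΩ)
    (hb : ∀ i, b i ≤ mΩ) (hia : iIndep a P) (hib : iIndep b P)
    (hab : Indep (⨆ i, a i) (⨆ i, b i) P) : iIndep (fun i => a i ⊔ b i) P := by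
  refine iIndepSets.iIndep (fun i => sup_le (ha i) (hb i)) _
    (fun i => isPiSystem_inter (a i) (b i)) (fun i => (generateFrom_inter_eq_sup _ _).symm) ?_
  rw [iIndepSets_iff]
  intro s f hf
  have : ∀ i, ∃ A B : Set Ω, i ∈ s → MeasurableSet[a i] A ∧ MeasurableSet[b i] B ∧ A ∩ B = f i :=
    fun i => by
      by_cases hi : i ∈ s
      · obtain ⟨A, hA, B, hB, h⟩ := hf i hi
        exact ⟨A, B, fun _ => ⟨hA, hB, h⟩⟩
      · exact ⟨∅, ∅, fun h => absurd h hi⟩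
  choose A B hAB using this
  rw [iIndep_iff] at hia hib
  rw [Indep_iff] at hab
  have e : ⋂ i ∈ s, f i = (⋂ i ∈ s, A i) ∩ ⋂ i ∈ s, B i := by
    ext ω
    simp only [Set.mem_iInter, Set.mem_inter_iff, ← forall₂_and]
    exact forall₂_congr fun i hi => by rw [← (hAB i hi).2.2, Set.mem_inter_iff]
  have hA : MeasurableSet[⨆ i, a i] (⋂ i ∈ s, A i) :=
    Finset.measurableSet_biInter _ fun i hi => le_iSup a i _ (hAB i hi).1
  have hB : MeasurableSet[⨆ i, b i] (⋂ i ∈ s, B i) :=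
    Finset.measurableSet_biInter _ fun i hi => le_iSup b i _ (hAB i hi).2.1
  rw [e, hab _ _ hA hB, hia s fun i hi => (hAB i hi).1, hib s fun i hi => (hAB i hi).2.1,
    ← Finset.prod_mul_distrib]
  refine Finset.prod_congr rfl fun i hi => ?_
  rw [← (hAB i hi).2.2, hab _ _ (le_iSup a i _ (hAB i hi).1) (le_iSup b i _ (hAB i hi).2.1)]

theorem iIndep_mono {ι : Type*} {a b : ι → MeasurableSpace Ω} (hab : ∀ i, a i ≤ b i)
    (hb : iIndep b P) : iIndep a P := by
  rw [iIndep_iff] at hb ⊢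
  exact fun s f hf => hb s fun i hi => hab i _ (hf i hi)

/-- Grouping a doubly indexed independent family by its first index keeps independence. -/
theorem iIndep_iSup_of_iIndep_prod {ι κ : Type*} [Fintype κ] {m : ι × κ → MeasurableSpace Ω}
    (hm : ∀ p, m p ≤ mΩ) (h : iIndep m P) : iIndep (fun i => ⨆ k, m (i, k)) P := by
  refine iIndepSets.iIndep (fun i => iSup_le fun k => hm (i, k)) _
    (fun i => isPiSystem_piiUnionInter (fun k => {s | MeasurableSet[m (i, k)] s})
      (fun k => @MeasurableSpace.isPiSystem_measurableSet _ (m (i, k))) Set.univ)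
    (fun i => ((generateFrom_piiUnionInter_measurableSet (fun k => m (i, k)) Set.univ).trans
      (by simp)).symm) ?_
  rw [iIndepSets_iff]
  intro s f hf
  have : ∀ i, ∃ g : κ → Set Ω, i ∈ s → (∀ k, MeasurableSet[m (i, k)] (g k)) ∧ f i = ⋂ k, g k :=
    fun i => by
      by_cases hi : i ∈ s
      · obtain ⟨g, hg, h⟩ := exists_eq_iInter_of_mem_piiUnionInter (hf i hi)
        exact ⟨g, fun _ => ⟨hg, h⟩⟩
      · exact ⟨fun _ => ∅, fun h => absurd h hi⟩
  choose g hg using this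
  rw [iIndep_iff] at h
  have hrow : ∀ t ⊆ s, P (⋂ i ∈ t, f i) = ∏ i ∈ t, ∏ k, P (g i k) := fun t ht => by
    have := h (t ×ˢ Finset.univ) (f := fun p => g p.1 p.2) fun p hp =>
      (hg p.1 (ht (Finset.mem_product.1 hp).1)).1 p.2
    rw [← Finset.prod_product (s := t) (t := Finset.univ) (f := fun p => P (g p.1 p.2)), ← this]
    congr 1
    ext ω
    simp only [Set.mem_iInter, Finset.mem_product, Finset.mem_univ, and_true, Prod.forall]
    refine forall_congr' fun i => ⟨fun hi k hi' => ?_, fun hi hi' => ?_⟩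
    · have := hi hi'
      rw [(hg i (ht hi')).2] at this
      exact Set.mem_iInter.1 this k
    · rw [(hg i (ht hi')).2]
      exact Set.mem_iInter.2 fun k => hi k hi'
  rw [hrow s subset_rfl]
  refine Finset.prod_congr rfl fun i hi => ?_
  have := hrow {i} (Finset.singleton_subset_iff.2 hi)
  simpa using this.symm

variable [IsProbabilityMeasure P]

theorem indep_sup_left_of_indep (h0 : m₀ ≤ mΩ) (h1 : m₁ ≤ mΩ)
    (h2 : m₂ ≤ mΩ) (h : Indep m₀ (m₁ ⊔ m₂) P) (h' : Indep m₁ m₂ P) :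
    Indep (m₀ ⊔ m₁) m₂ P := by
  refine IndepSets.indep (sup_le h0 h1) h2 (isPiSystem_inter m₀ m₁)
    (@MeasurableSpace.isPiSystem_measurableSet _ m₂)
    (generateFrom_inter_eq_sup m₀ m₁).symm
    (@MeasurableSpace.generateFrom_measurableSet _ m₂).symm ?_
  rw [IndepSets_iff]
  rintro _ C ⟨A, hA, B, hB, rfl⟩ hC
  rw [Indep_iff] at h h'
  have hB' := le_sup_left (a := m₁) (b := m₂) B hB
  have hC' := le_sup_right (a := m₁) (b := m₂) C hC
  rw [Set.inter_assoc, h A _ hA (hB'.inter hC'), h' B C hB hC, h A B hA hB', mul_assoc]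

theorem indep_iSup_iSup {ι : Type*} [Fintype ι] {a b : ι → MeasurableSpace Ω} (ha : ∀ i, a i ≤ mΩ)
    (hb : ∀ i, b i ≤ mΩ) (h : iIndep (fun i => a i ⊔ b i) P) (hab : ∀ i, Indep (a i) (b i) P) :
    Indep (⨆ i, a i) (⨆ i, b i) P := by
  refine IndepSets.indep (iSup_le ha) (iSup_le hb)
    (isPiSystem_piiUnionInter (fun i => {s | MeasurableSet[a i] s})
      (fun i => @MeasurableSpace.isPiSystem_measurableSet _ (a i)) Set.univ)
    (isPiSystem_piiUnionInter (fun i => {s | MeasurableSet[b i] s})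
      (fun i => @MeasurableSpace.isPiSystem_measurableSet _ (b i)) Set.univ)
    ((generateFrom_piiUnionInter_measurableSet a Set.univ).trans (by simp)).symm
    ((generateFrom_piiUnionInter_measurableSet b Set.univ).trans (by simp)).symm ?_
  rw [IndepSets_iff]
  intro A B hA hB
  obtain ⟨f, hf, rfl⟩ := exists_eq_iInter_of_mem_piiUnionInter hA
  obtain ⟨g, hg, rfl⟩ := exists_eq_iInter_of_mem_piiUnionInter hB
  rw [iIndep_iff] at h
  simp only [Indep_iff] at hab
  have hf' : ∀ i, MeasurableSet[a i ⊔ b i] (f i) := fun i => le_sup_left (a := a i) _ (hf i)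
  have hg' : ∀ i, MeasurableSet[a i ⊔ b i] (g i) := fun i => le_sup_right (a := a i) _ (hg i)
  have h1 := h Finset.univ (f := fun i => f i ∩ g i) (fun i _ => (hf' i).inter (hg' i))
  have h2 := h Finset.univ (f := f) (fun i _ => hf' i)
  have h3 := h Finset.univ (f := g) (fun i _ => hg' i)
  simp only [Finset.mem_univ, Set.iInter_true] at h1 h2 h3
  rw [← Set.iInter_inter_distrib, h1, h2, h3, ← Finset.prod_mul_distrib]
  exact Finset.prod_congr rfl fun i _ => hab i _ _ (hf i) (hg i)

end Indep

/-! ### Information structure of the noise -/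

section Coordinates

theorem measurable_conf_iff {n d : ℕ} {Ω : Type*} {m : MeasurableSpace Ω} {f : Ω → Conf n d} :
    Measurable f ↔ ∀ i k, Measurable fun ω => f ω i k := by
  refine ⟨fun h i k => ?_, fun h => ?_⟩
  · exact ((EuclideanSpace.proj k : Vec d →L[ℝ] ℝ).continuous.measurable.comp
      (PiLp.continuous_apply 2 (fun _ : Fin n => Vec d) i).measurable).comp h
  · have h1 : ∀ i, Measurable fun ω => f ω i := fun i =>
      (WithLp.measurable_toLp 2 (Fin d → ℝ)).comp (measurable_pi_lambda _ (h i))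
    exact (WithLp.measurable_toLp 2 (Fin n → Vec d)).comp (measurable_pi_lambda _ h1)

theorem measurable_vec_iff {d : ℕ} {Ω : Type*} {m : MeasurableSpace Ω} {f : Ω → Vec d} :
    Measurable f ↔ ∀ k, Measurable fun ω => f ω k := by
  refine ⟨fun h k => ?_, fun h => ?_⟩
  · exact (EuclideanSpace.proj k : Vec d →L[ℝ] ℝ).continuous.measurable.comp h
  · exact (WithLp.measurable_toLp 2 (Fin d → ℝ)).comp (measurable_pi_lambda _ h)

end Coordinates

namespace Noise

variable {n d : ℕ} {Ω : Type*} [mΩ : MeasurableSpace Ω] {P : Measure Ω} (N : Noise n d P)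

/-- The full information of agent `i`, over the whole time axis. -/
abbrev agentSigma (i : Fin n) : MeasurableSpace Ω := ⨆ t, N.agentFiltration i t

/-- The σ-algebra generated by the path of the coordinate `p` of the Brownian motion. -/
abbrev pathSigma (p : Fin n × Fin d) : MeasurableSpace Ω :=
  MeasurableSpace.comap (fun ω (s : ℝ≥0) => N.W s ω p.1 p.2) inferInstance

/-- The σ-algebra generated by the coordinate `p` of the Brownian motion up to time `t`. -/
abbrev pastSigma (t : ℝ≥0) (p : Fin n × Fin d) : MeasurableSpace Ω :=
  MeasurableSpace.comap (fun ω (s : Set.Iic t) => N.W s ω p.1 p.2) inferInstance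

/-- The σ-algebra generated by the increments after time `t` of the coordinate `p` of the Brownian
motion. -/
abbrev futureSigma (t : ℝ≥0) (p : Fin n × Fin d) : MeasurableSpace Ω :=
  MeasurableSpace.comap (fun ω (r : ℝ≥0) => N.W (t + r) ω p.1 p.2 - N.W t ω p.1 p.2) inferInstance

theorem agentFiltration_le_agentSigma (i : Fin n) (t : ℝ≥0) :
    N.agentFiltration i t ≤ N.agentSigma i := le_iSup (fun t => N.agentFiltration i t) t

theorem agentSigma_le (i : Fin n) : N.agentSigma i ≤ mΩ :=
  iSup_le fun t => (N.agentFiltration i).le t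

theorem agentFiltration_le_fullFiltration (i : Fin n) (t : ℝ≥0) :
    N.agentFiltration i t ≤ N.fullFiltration t := by
  have hproj : Measurable fun x : Conf n d => x i :=
    (PiLp.continuous_apply 2 (fun _ : Fin n => Vec d) i).measurable
  refine sup_le_sup_right (sup_le_sup ?_ (iSup₂_mono fun s _ => ?_)) _
  · exact (hproj.comp N.measurable_ξ).comap_le
  · exact (hproj.comp (comap_measurable (N.W s))).comap_le

theorem measurable_W_coord (p : Fin n × Fin d) (t : ℝ≥0) : Measurable fun ω => N.W t ω p.1 p.2 :=
  measurable_conf_iff.1 (N.measurable_W t) p.1 p.2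

theorem measurable_pathSigma (p : Fin n × Fin d) (t : ℝ≥0) :
    Measurable[N.pathSigma p] fun ω => N.W t ω p.1 p.2 :=
  (measurable_pi_apply t).comp (comap_measurable (fun ω (s : ℝ≥0) => N.W s ω p.1 p.2))

theorem pathSigma_le (p : Fin n × Fin d) : N.pathSigma p ≤ mΩ :=
  (measurable_pi_lambda _ fun t => N.measurable_W_coord p t).comap_le

theorem pastSigma_le_pathSigma (t : ℝ≥0) (p : Fin n × Fin d) : N.pastSigma t p ≤ N.pathSigma p :=
  (@measurable_pi_lambda _ _ _ (N.pathSigma p) _ _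
    fun s : Set.Iic t => N.measurable_pathSigma p s).comap_le

theorem futureSigma_le_pathSigma (t : ℝ≥0) (p : Fin n × Fin d) :
    N.futureSigma t p ≤ N.pathSigma p :=
  (@measurable_pi_lambda _ _ _ (N.pathSigma p) _ _ fun r : ℝ≥0 =>
    (N.measurable_pathSigma p (t + r)).sub (N.measurable_pathSigma p t)).comap_le

theorem iIndep_pathSigma : iIndep N.pathSigma P := N.indep_W

theorem pathSigma_le_comap_W (p : Fin n × Fin d) :
    N.pathSigma p ≤ ⨆ t, MeasurableSpace.comap (N.W t) inferInstance := by
  refine Measurable.comap_le (@measurable_pi_lambda _ _ _ (_) _ _ fun t => ?_)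
  refine Measurable.mono ?_
    (le_iSup (fun t => MeasurableSpace.comap (N.W t) inferInstance) t) le_rfl
  exact measurable_conf_iff.1 (comap_measurable (N.W t)) p.1 p.2

theorem fullFiltration_le (t : ℝ≥0) :
    N.fullFiltration t ≤ (N.init ⊔ ⨆ p, N.pastSigma t p) ⊔ nullSets P := by
  refine sup_le_sup_right (sup_le_sup_left (iSup₂_le fun s hs => ?_) _) _
  refine Measurable.comap_le (measurable_conf_iff.2 fun i k => ?_)
  refine Measurable.mono ?_ (le_iSup (N.pastSigma t) (i, k)) le_rfl
  exact (measurable_pi_apply (⟨s, hs⟩ : Set.Iic t)).comp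
    (comap_measurable (fun ω (s : Set.Iic t) => N.W s ω i k))

theorem agentSigma_le_sup (i : Fin n) (t : ℝ≥0) :
    N.agentSigma i ≤ N.agentFiltration i t ⊔ ⨆ k, N.futureSigma t (i, k) := by
  refine iSup_le fun r => sup_le (sup_le ?_ (iSup₂_le fun s _ => ?_)) ?_
  · exact (le_sup_left.trans le_sup_left).trans
      (le_sup_left (a := N.agentFiltration i t) (b := ⨆ k, N.futureSigma t (i, k)))
  · have hW : ∀ s ≤ t, Measurable[N.agentFiltration i t] fun ω => N.W s ω i := fun s hs => by
      refine Measurable.mono (comap_measurable (fun ω => N.W s ω i)) ?_ le_rfl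
      exact (le_iSup₂ (f := fun s (_ : s ≤ t) =>
        MeasurableSpace.comap (fun ω => N.W s ω i) inferInstance) s hs).trans
          (le_sup_right.trans le_sup_left)
    rcases le_total s t with hs | hs
    · exact (hW s hs).comap_le.trans le_sup_left
    · refine Measurable.comap_le (measurable_vec_iff.2 fun k => ?_)
      have h1 : Measurable[N.agentFiltration i t ⊔ ⨆ k, N.futureSigma t (i, k)]
          fun ω => N.W t ω i k :=
        (measurable_vec_iff.1 (hW t le_rfl) k).mono le_sup_left le_rfl
      have h2 : Measurable[N.agentFiltration i t ⊔ ⨆ k, N.futureSigma t (i, k)]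
          fun ω => N.W (t + (s - t)) ω i k - N.W t ω i k :=
        ((measurable_pi_apply (s - t)).comp (comap_measurable
          (fun ω (r : ℝ≥0) => N.W (t + r) ω i k - N.W t ω i k))).mono
          ((le_iSup (fun k => N.futureSigma t (i, k)) k).trans le_sup_right) le_rfl
      have h3 := h2.add h1
      rw [add_tsub_cancel_of_le hs] at h3
      convert h3 using 2 with ω
      simp
  · exact le_sup_right.trans
      (le_sup_left (a := N.agentFiltration i t) (b := ⨆ k, N.futureSigma t (i, k)))

/-- The agents' information σ-algebras are independent. -/
theorem iIndep_agentSigma : iIndep N.agentSigma P := by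
  have hξ : iIndep (fun i => MeasurableSpace.comap (fun ω => N.ξ ω i) inferInstance) P := N.indep_ξ
  have hW := iIndep_iSup_of_iIndep_prod N.pathSigma_le N.iIndep_pathSigma
  have hproj : ∀ i, Measurable fun x : Conf n d => x i := fun i =>
    (PiLp.continuous_apply 2 (fun _ : Fin n => Vec d) i).measurable
  have h := iIndep_sup (fun i => (N.measurable_ξ_apply i).comap_le)
    (fun i => iSup_le fun k => N.pathSigma_le (i, k)) hξ hW
    (indep_of_indep_of_le_left (indep_of_indep_of_le_right N.indep_init
      (iSup_le fun i => iSup_le fun k => N.pathSigma_le_comap_W (i, k)))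
      (iSup_le fun i => ((hproj i).comp N.measurable_ξ).comap_le))
  refine iIndep_mono (fun i => ?_) (iIndep_sup_nullSets h)
  refine iSup_le fun t => sup_le_sup_right (sup_le_sup_left (iSup₂_le fun s _ => ?_) _) _
  refine Measurable.comap_le (measurable_vec_iff.2 fun k => ?_)
  exact (N.measurable_pathSigma (i, k) s).mono (le_iSup (fun k => N.pathSigma (i, k)) k) le_rfl

variable [IsProbabilityMeasure P]

/-- The increments of the Brownian motion after time `t` are independent of the full information
available at time `t`. -/
theorem indep_fullFiltration_future (t : ℝ≥0) :
    Indep (N.fullFiltration t) (⨆ p, N.futureSigma t p) P := by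
  have hpast : ∀ p, N.pastSigma t p ≤ mΩ := fun p =>
    (N.pastSigma_le_pathSigma t p).trans (N.pathSigma_le p)
  have hfut : ∀ p, N.futureSigma t p ≤ mΩ := fun p =>
    (N.futureSigma_le_pathSigma t p).trans (N.pathSigma_le p)
  have h1 : Indep (⨆ p, N.pastSigma t p) (⨆ p, N.futureSigma t p) P := by
    refine indep_iSup_iSup hpast hfut (iIndep_mono (fun p =>
      sup_le (N.pastSigma_le_pathSigma t p) (N.futureSigma_le_pathSigma t p)) N.iIndep_pathSigma)
      fun p => ?_
    have := (N.brownian p.1 p.2).toIsPreBrownianReal.indepFun_shift t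
    exact Indep.symm this
  have h2 : Indep N.init ((⨆ p, N.pastSigma t p) ⊔ ⨆ p, N.futureSigma t p) P := by
    refine indep_of_indep_of_le_right N.indep_init (sup_le (iSup_le fun p => ?_)
      (iSup_le fun p => ?_))
    · exact (N.pastSigma_le_pathSigma t p).trans (N.pathSigma_le_comap_W p)
    · exact (N.futureSigma_le_pathSigma t p).trans (N.pathSigma_le_comap_W p)
  have h3 := indep_sup_left_of_indep N.init_le (iSup_le hpast) (iSup_le hfut) h2 h1
  exact indep_of_indep_of_le_left (indep_sup_nullSets h3) (N.fullFiltration_le t)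

/-- A random variable known at time `t` under full information has the same conditional expectation
given the information of agent `i` at time `t` and given the information of agent `i` over the whole
time axis: the additional information consists of increments independent of it. -/
theorem condExp_sub_condExp_agentFiltration (i : Fin n) (t : ℝ≥0) {η : Ω → ℝ}
    (hη : StronglyMeasurable[N.fullFiltration t] η) (hη2 : MemLp η 2 P) :
    P[η - P[η|N.agentFiltration i t]|N.agentSigma i] =ᵐ[P] 0 := by
  set ζ := η - P[η|N.agentFiltration i t]
  have hF : N.agentFiltration i t ≤ mΩ := (N.agentFiltration i).le t
  have hFF : N.fullFiltration t ≤ mΩ := N.fullFiltration.le t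
  have hi : Integrable η P := hη2.integrable one_le_two
  have hζi : Integrable ζ P := hi.sub integrable_condExp
  have hζm : StronglyMeasurable[N.fullFiltration t] ζ :=
    hη.sub (stronglyMeasurable_condExp.mono (N.agentFiltration_le_fullFiltration i t))
  have hfut : (⨆ p, N.futureSigma t p) ≤ mΩ := iSup_le fun p =>
    (N.futureSigma_le_pathSigma t p).trans (N.pathSigma_le p)
  have hpast0 : ∀ B, MeasurableSet[N.agentFiltration i t] B → ∫ ω in B, ζ ω ∂P = 0 := by
    intro B hB
    simp only [ζ, Pi.sub_apply]
    rw [integral_sub hi.integrableOn integrable_condExp.integrableOn,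
      setIntegral_condExp hF hi hB, sub_self]
  have hsup : N.agentFiltration i t ⊔ (⨆ k, N.futureSigma t (i, k)) ≤ mΩ :=
    sup_le hF ((iSup_le fun k => le_iSup (N.futureSigma t) (i, k)).trans hfut)
  have hinter : ∀ A, MeasurableSet[N.agentFiltration i t ⊔ ⨆ k, N.futureSigma t (i, k)] A →
      ∫ ω in A, ζ ω ∂P = 0 := by
    intro A hA
    induction A, hA using MeasurableSpace.induction_on_inter
      (generateFrom_inter_eq_sup _ _).symm (isPiSystem_inter _ _) with
    | empty => simp
    | basic A hA =>
      obtain ⟨B, hB, C, hC, rfl⟩ := hA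
      have hC' : MeasurableSet[⨆ p, N.futureSigma t p] C :=
        (iSup_le fun k => le_iSup (N.futureSigma t) (i, k)) C hC
      have hBm := N.agentFiltration_le_fullFiltration i t B hB
      have h1 := condExp_indep_eq hFF hfut (hζm.indicator hBm) (N.indep_fullFiltration_future t)
      have h2 := setIntegral_condExp hfut (hζi.indicator (hFF B hBm)) hC'
      rw [setIntegral_congr_ae (hfut C hC') (h1.mono fun ω h _ => h),
        integral_indicator (hFF B hBm),
        hpast0 B hB, integral_zero, setIntegral_indicator (hFF B hBm), Set.inter_comm] at h2
      exact h2.symm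
    | compl A hA ih =>
      have := integral_add_compl (hsup A hA) hζi
      have h0 := hpast0 Set.univ MeasurableSet.univ
      rw [setIntegral_univ] at h0
      linarith
    | iUnion f hd hf ih =>
      rw [integral_iUnion (fun j => hsup _ (hf j)) hd hζi.integrableOn]
      simp [ih]
  refine (ae_eq_condExp_of_forall_setIntegral_eq (N.agentSigma_le i) hζi
    (fun _ _ _ => (integrable_zero _ _ _).integrableOn) (fun A hA _ => ?_)
    (@stronglyMeasurable_zero _ _ (N.agentSigma i) _ _).aestronglyMeasurable).symm
  rw [hinter A (N.agentSigma_le_sup i t A hA)]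
  simp

end Noise

/-- A random variable with vanishing conditional expectation is orthogonal to the known ones. -/
theorem integral_mul_eq_zero_of_condExp_eq_zero {Ω : Type*} {m mΩ : MeasurableSpace Ω}
    {P : Measure Ω} [IsProbabilityMeasure P] (hm : m ≤ mΩ) {g v : Ω → ℝ}
    (hg : AEStronglyMeasurable[m] g P) (hg2 : MemLp g 2 P) (hv : MemLp v 2 P)
    (h : P[v|m] =ᵐ[P] 0) : ∫ ω, g ω * v ω ∂P = 0 := by
  have h1 := condExp_mul_of_aestronglyMeasurable_left hg (hg2.integrable_mul hv)
    (hv.integrable one_le_two)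
  have h2 : ∫ ω, (g * v) ω ∂P = ∫ ω, (P[g * v|m]) ω ∂P := (integral_condExp hm).symm
  have h3 : P[g * v|m] =ᵐ[P] 0 := by
    filter_upwards [h1, h] with ω e1 e2
    rw [e1, Pi.mul_apply, e2, Pi.zero_apply, mul_zero]
  rw [integral_congr_ae h3] at h2
  simpa using h2

/-! ### The time axis -/

section Time

theorem measurableEmbedding_coe_nnreal : MeasurableEmbedding ((↑) : ℝ≥0 → ℝ) :=
  MeasurableEmbedding.subtype_coe measurableSet_Ici

theorem map_timeMeasure : timeMeasure.map ((↑) : ℝ≥0 → ℝ) = volume.restrict (Set.Ici 0) := by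
  rw [timeMeasure, measurableEmbedding_coe_nnreal.map_comap]
  congr 1
  ext x
  exact ⟨fun ⟨y, hy⟩ => hy ▸ y.2, fun hx => ⟨⟨x, hx⟩, rfl⟩⟩

theorem timeMeasure_apply (s : Set ℝ≥0) : timeMeasure s = volume (((↑) : ℝ≥0 → ℝ) '' s) :=
  measurableEmbedding_coe_nnreal.comap_apply _ _

theorem image_coe_Iic (t : ℝ≥0) : ((↑) : ℝ≥0 → ℝ) '' Set.Iic t = Set.Icc 0 (t : ℝ) := by
  ext x
  constructor
  · rintro ⟨y, hy, rfl⟩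
    exact ⟨y.2, NNReal.coe_le_coe.2 hy⟩
  · rintro ⟨h0, h1⟩
    exact ⟨⟨x, h0⟩, h1, rfl⟩

theorem timeMeasure_Iic (t : ℝ≥0) : timeMeasure (Set.Iic t) = ENNReal.ofReal t := by
  rw [timeMeasure_apply, image_coe_Iic, Real.volume_Icc, sub_zero]

instance (t : ℝ≥0) : IsFiniteMeasure (timeMeasure.restrict (Set.Iic t)) :=
  ⟨by rw [Measure.restrict_apply_univ, timeMeasure_Iic]; exact ENNReal.ofReal_lt_top⟩

theorem setIntegral_timeMeasure_comp_coe {E : Type*} [NormedAddCommGroup E] [NormedSpace ℝ E]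
    (f : ℝ → E) (t : ℝ≥0) :
    ∫ s in Set.Iic t, f s ∂timeMeasure = ∫ x in Set.Icc 0 (t : ℝ), f x := by
  have h := measurableEmbedding_coe_nnreal.setIntegral_map (μ := timeMeasure) f (Set.Icc 0 (t : ℝ))
  rw [map_timeMeasure, Measure.restrict_restrict measurableSet_Icc] at h
  have h1 : Set.Icc 0 (t : ℝ) ∩ Set.Ici 0 = Set.Icc 0 (t : ℝ) :=
    Set.inter_eq_left.2 fun x hx => hx.1
  have h2 : ((↑) : ℝ≥0 → ℝ) ⁻¹' Set.Icc 0 (t : ℝ) = Set.Iic t := by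
    ext x; simp
  rw [h1, h2] at h
  exact h.symm

theorem integral_coe_timeMeasure (t : ℝ≥0) :
    ∫ s in Set.Iic t, (s : ℝ) ∂timeMeasure = (t : ℝ) ^ 2 / 2 := by
  rw [setIntegral_timeMeasure_comp_coe (fun x => x), integral_Icc_eq_integral_Ioc,
    ← intervalIntegral.integral_of_le t.coe_nonneg, integral_id]
  simp

theorem restrict_restrict_Iic {t T : ℝ≥0} (h : t ≤ T) :
    (timeMeasure.restrict (Set.Iic T)).restrict (Set.Iic t) = timeMeasure.restrict (Set.Iic t) := by
  rw [Measure.restrict_restrict measurableSet_Iic,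
    Set.inter_eq_left.2 (Set.Iic_subset_Iic.2 h)]

theorem integrable_coe_timeMeasure (T : ℝ≥0) :
    Integrable (fun s : ℝ≥0 => (s : ℝ)) (timeMeasure.restrict (Set.Iic T)) := by
  refine Integrable.mono' (integrable_const (T : ℝ)) (by fun_prop) ?_
  filter_upwards [ae_restrict_mem measurableSet_Iic] with s hs
  rw [Real.norm_of_nonneg s.coe_nonneg]
  exact_mod_cast hs

end Time

/-! ### Time integrals of processes -/

section RunningIntegral

variable {Ω : Type*} [mΩ : MeasurableSpace Ω] {P : Measure Ω}

/-- The measure `dt ⊗ P` on `[0, T] × Ω`. -/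
abbrev controlMeasure (P : Measure Ω) (T : ℝ≥0) : Measure (ℝ≥0 × Ω) :=
  (timeMeasure.restrict (Set.Iic T)).prod P

theorem ae_controlMeasure_of_ae {T : ℝ≥0} {p : Ω → Prop} (h : ∀ᵐ ω ∂P, p ω) :
    ∀ᵐ x ∂controlMeasure P T, x.1 ≤ T ∧ p x.2 := by
  have h1 : ∀ᵐ s ∂timeMeasure.restrict (Set.Iic T), s ≤ T := ae_restrict_mem measurableSet_Iic
  exact (Measure.quasiMeasurePreserving_fst.ae h1).and (Measure.quasiMeasurePreserving_snd.ae h)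

variable {E : Type*} [NormedAddCommGroup E]

section Paths

variable [IsProbabilityMeasure P] {T : ℝ≥0} {φ : ℝ≥0 → Ω → E}

theorem ae_ae_of_ae_controlMeasure {p : ℝ≥0 × Ω → Prop} (h : ∀ᵐ x ∂controlMeasure P T, p x) :
    ∀ᵐ ω ∂P, ∀ᵐ s ∂timeMeasure.restrict (Set.Iic T), p (s, ω) :=
  Measure.ae_ae_of_ae_prod
    ((Measure.measurePreserving_swap (μ := P)
      (ν := timeMeasure.restrict (Set.Iic T))).quasiMeasurePreserving.ae h)

theorem ae_memLp_path (hφ : MemLp (fun p : ℝ≥0 × Ω => φ p.1 p.2) 2 (controlMeasure P T)) :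
    ∀ᵐ ω ∂P, MemLp (fun s => φ s ω) 2 (timeMeasure.restrict (Set.Iic T)) := by
  have h1 := (integrable_sq_norm_of_memLp hφ).prod_left_ae
  have h2 := hφ.1.prod_swap.prodMk_left
  filter_upwards [h1, h2] with ω h1 h2
  exact (memLp_two_iff_integrable_sq_norm h2).2 h1

theorem ae_memLp_section (hφ : MemLp (fun p : ℝ≥0 × Ω => φ p.1 p.2) 2 (controlMeasure P T)) :
    ∀ᵐ s ∂timeMeasure.restrict (Set.Iic T), MemLp (φ s) 2 P := by
  have h1 := (integrable_sq_norm_of_memLp hφ).prod_right_ae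
  have h2 := hφ.1.prodMk_left
  filter_upwards [h1, h2] with ω h1 h2
  exact (memLp_two_iff_integrable_sq_norm h2).2 h1

theorem integral_sq_norm_eq
    (hφ : MemLp (fun p : ℝ≥0 × Ω => φ p.1 p.2) 2 (controlMeasure P T)) :
    Integrable (fun ω => ∫ s in Set.Iic T, ‖φ s ω‖ ^ 2 ∂timeMeasure) P ∧
    ∫ ω, (∫ s in Set.Iic T, ‖φ s ω‖ ^ 2 ∂timeMeasure) ∂P =
      ∫ p, ‖φ p.1 p.2‖ ^ 2 ∂controlMeasure P T :=
  ⟨(integrable_sq_norm_of_memLp hφ).integral_prod_right,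
    (integral_prod_symm _ (integrable_sq_norm_of_memLp hφ)).symm⟩

end Paths

variable [NormedSpace ℝ E]

/-- The process `∫_0^t φ_s ds`. -/
def runInt {Ω : Type*} (φ : ℝ≥0 → Ω → E) (t : ℝ≥0) (ω : Ω) : E :=
  ∫ s in Set.Iic t, φ s ω ∂timeMeasure

theorem runInt_eq_integral_indicator {Ω : Type*} {φ : ℝ≥0 → Ω → E} {T t : ℝ≥0} (ht : t ≤ T)
    (ω : Ω) :
    runInt φ t ω =
      ∫ s, (Set.Iic t).indicator (fun s => φ s ω) s ∂timeMeasure.restrict (Set.Iic T) := by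
  rw [integral_indicator measurableSet_Iic, restrict_restrict_Iic ht, runInt]

theorem sq_norm_integral_le {S : Type*} [MeasurableSpace S] {μ : Measure S} [IsFiniteMeasure μ]
    {f : S → E} (hf : MemLp f 2 μ) :
    ‖∫ s, f s ∂μ‖ ^ 2 ≤ μ.real Set.univ * ∫ s, ‖f s‖ ^ 2 ∂μ := by
  have h := integral_mul_le_sqrt (memLp_const (1 : ℝ) (μ := μ) (p := 2)) hf.norm
  have h1 := norm_integral_le_integral_norm (μ := μ) f
  simp only [one_mul, one_pow, integral_const, smul_eq_mul, mul_one] at h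
  have h2 := h1.trans ((le_abs_self _).trans h)
  calc ‖∫ s, f s ∂μ‖ ^ 2 ≤ _ := pow_le_pow_left₀ (norm_nonneg _) h2 2
    _ = _ := by
      rw [mul_pow, Real.sq_sqrt measureReal_nonneg,
        Real.sq_sqrt (integral_nonneg fun s => by positivity)]

theorem measureReal_timeMeasure_Iic (t : ℝ≥0) :
    (timeMeasure.restrict (Set.Iic t)).real Set.univ = t := by
  rw [Measure.real, Measure.restrict_apply_univ, timeMeasure_Iic,
    ENNReal.toReal_ofReal t.coe_nonneg]

theorem sq_norm_setIntegral_le {T t : ℝ≥0} (ht : t ≤ T) {f : ℝ≥0 → E}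
    (hf : MemLp f 2 (timeMeasure.restrict (Set.Iic T))) :
    ‖∫ s in Set.Iic t, f s ∂timeMeasure‖ ^ 2 ≤
      t * ∫ s in Set.Iic T, ‖f s‖ ^ 2 ∂timeMeasure := by
  have hle := Measure.restrict_mono_set timeMeasure (Set.Iic_subset_Iic.2 ht)
  have h := sq_norm_integral_le (hf.mono_measure hle)
  rw [measureReal_timeMeasure_Iic] at h
  refine h.trans (mul_le_mul_of_nonneg_left ?_ t.2)
  exact integral_mono_measure hle (Filter.Eventually.of_forall fun s => by positivity)
    (integrable_sq_norm_of_memLp hf)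

variable [IsProbabilityMeasure P] {T : ℝ≥0} {φ : ℝ≥0 → Ω → E}

theorem aestronglyMeasurable_runInt
    (hφ : AEStronglyMeasurable (fun p : ℝ≥0 × Ω => φ p.1 p.2) (controlMeasure P T)) :
    AEStronglyMeasurable (fun p : ℝ≥0 × Ω => runInt φ p.1 p.2) (controlMeasure P T) ∧
      ∀ t ≤ T, AEStronglyMeasurable (runInt φ t) P := by
  let ψ := hφ.mk
  have hψ : StronglyMeasurable ψ := hφ.stronglyMeasurable_mk
  let g : (ℝ≥0 × Ω) → E := fun p =>
    ∫ s, (Set.Iic p.1).indicator (fun s => ψ (s, p.2)) s ∂timeMeasure.restrict (Set.Iic T)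
  have hg : StronglyMeasurable g := by
    have hset : MeasurableSet {q : (ℝ≥0 × Ω) × ℝ≥0 | q.2 ≤ q.1.1} :=
      measurableSet_le (by fun_prop) (by fun_prop)
    have : StronglyMeasurable fun q : (ℝ≥0 × Ω) × ℝ≥0 =>
        {q : (ℝ≥0 × Ω) × ℝ≥0 | q.2 ≤ q.1.1}.indicator (fun q => ψ (q.2, q.1.2)) q :=
      (hψ.comp_measurable (by fun_prop)).indicator hset
    exact this.integral_prod_right' (ν := timeMeasure.restrict (Set.Iic T))
  have hae : ∀ᵐ ω ∂P, ∀ t ≤ T, runInt φ t ω = g (t, ω) := by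
    filter_upwards [ae_ae_of_ae_controlMeasure hφ.ae_eq_mk] with ω hω t ht
    rw [runInt_eq_integral_indicator ht]
    refine integral_congr_ae ?_
    filter_upwards [hω] with s hs
    simp only [Set.indicator]
    split_ifs
    · exact hs
    · rfl
  refine ⟨⟨g, hg, ?_⟩, fun t ht => ⟨fun ω => g (t, ω), hg.comp_measurable (by fun_prop), ?_⟩⟩
  · filter_upwards [ae_controlMeasure_of_ae hae] with p hp
    exact hp.2 p.1 hp.1
  · filter_upwards [hae] with ω hω
    exact hω t ht

theorem memLp_runInt_section
    (hφ : MemLp (fun p : ℝ≥0 × Ω => φ p.1 p.2) 2 (controlMeasure P T)) {t : ℝ≥0} (ht : t ≤ T) :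
    MemLp (runInt φ t) 2 P ∧
      ∫ ω, ‖runInt φ t ω‖ ^ 2 ∂P ≤ t * ∫ p, ‖φ p.1 p.2‖ ^ 2 ∂controlMeasure P T := by
  have hm := (aestronglyMeasurable_runInt hφ.1).2 t ht
  obtain ⟨hi, he⟩ := integral_sq_norm_eq hφ
  have hb : ∀ᵐ ω ∂P, ‖runInt φ t ω‖ ^ 2 ≤ t * ∫ s in Set.Iic T, ‖φ s ω‖ ^ 2 ∂timeMeasure := by
    filter_upwards [ae_memLp_path hφ] with ω hω using sq_norm_setIntegral_le ht hω
  have hint : Integrable (fun ω => ‖runInt φ t ω‖ ^ 2) P :=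
    (hi.const_mul (t : ℝ)).mono' (hm.norm.pow 2) (hb.mono fun ω h => by
      rwa [Real.norm_of_nonneg (by positivity)])
  refine ⟨(memLp_two_iff_integrable_sq_norm hm).2 hint, ?_⟩
  rw [← he, ← integral_const_mul]
  exact integral_mono_ae hint (hi.const_mul _) hb

theorem memLp_runInt
    (hφ : MemLp (fun p : ℝ≥0 × Ω => φ p.1 p.2) 2 (controlMeasure P T)) :
    MemLp (fun p : ℝ≥0 × Ω => runInt φ p.1 p.2) 2 (controlMeasure P T) ∧
      ∫ p, ‖runInt φ p.1 p.2‖ ^ 2 ∂controlMeasure P T ≤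
        (T : ℝ) ^ 2 / 2 * ∫ p, ‖φ p.1 p.2‖ ^ 2 ∂controlMeasure P T := by
  have hm := (aestronglyMeasurable_runInt hφ.1).1
  obtain ⟨hi, he⟩ := integral_sq_norm_eq hφ
  have hb : ∀ᵐ p ∂controlMeasure P T, ‖runInt φ p.1 p.2‖ ^ 2 ≤
      (p.1 : ℝ) * ∫ s in Set.Iic T, ‖φ s p.2‖ ^ 2 ∂timeMeasure := by
    filter_upwards [ae_controlMeasure_of_ae (ae_memLp_path hφ)] with p hp
    exact sq_norm_setIntegral_le hp.1 hp.2
  have hi' := (integrable_coe_timeMeasure T).mul_prod hi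
  have hint : Integrable (fun p : ℝ≥0 × Ω => ‖runInt φ p.1 p.2‖ ^ 2) (controlMeasure P T) :=
    hi'.mono' (hm.norm.pow 2) (hb.mono fun ω h => by
      rwa [Real.norm_of_nonneg (by positivity)])
  refine ⟨(memLp_two_iff_integrable_sq_norm hm).2 hint, ?_⟩
  rw [← he, ← integral_coe_timeMeasure, ← integral_prod_mul]
  exact integral_mono_ae hint hi' hb

end RunningIntegral

/-! ### Square-integrability of the state process -/

section Projections

variable {n d : ℕ}

theorem memLp_conf_iff {S : Type*} [MeasurableSpace S] {μ : Measure S} {f : S → Conf n d} :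
    MemLp f 2 μ ↔ ∀ i, MemLp (fun s => f s i) 2 μ := memLp_piLp_iff

theorem memLp_vec_iff {S : Type*} [MeasurableSpace S] {μ : Measure S} {f : S → Vec d} :
    MemLp f 2 μ ↔ ∀ k, MemLp (fun s => f s k) 2 μ := memLp_piLp_iff

theorem conf_norm_sq_eq (x : Conf n d) : ‖x‖ ^ 2 = ∑ i, ‖x i‖ ^ 2 := PiLp.norm_sq_eq_of_L2 _ x

theorem norm_sq_apply_le (x : Conf n d) (i : Fin n) : ‖x i‖ ^ 2 ≤ ‖x‖ ^ 2 := by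
  rw [conf_norm_sq_eq]
  exact Finset.single_le_sum (f := fun i => ‖x i‖ ^ 2) (fun _ _ => by positivity)
    (Finset.mem_univ i)

end Projections

namespace Noise

variable {n d : ℕ} {Ω : Type*} [mΩ : MeasurableSpace Ω] {P : Measure Ω}
  (N : Noise n d P) {T : ℝ≥0}

section

variable {N} {L : Fin n → Vec d × Vec d → ℝ} {F G : Conf n d → ℝ} {α : ℝ≥0 → Ω → Conf n d}

/-- The derivative of the cost at the control `α` in the direction `φ`. -/
def costDeriv (N : Noise n d P) (T : ℝ≥0) (L : Fin n → Vec d × Vec d → ℝ) (F G : Conf n d → ℝ)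
    (α φ : ℝ≥0 → Ω → Conf n d) : ℝ :=
  1 / (n : ℝ) * (∑ i, ∫ p, fderiv ℝ (L i) (N.state α p.1 p.2 i, α p.1 p.2 i)
      (runInt φ p.1 p.2 i, φ p.1 p.2 i) ∂controlMeasure P T) +
    ∫ p, fderiv ℝ F (N.state α p.1 p.2) (runInt φ p.1 p.2) ∂controlMeasure P T +
    ∫ ω, fderiv ℝ G (N.state α T ω) (runInt φ T ω) ∂P

/-- The squared norm of a process in `L²([0, T] × Ω)`. -/
def energy (P : Measure Ω) (T : ℝ≥0) (φ : ℝ≥0 → Ω → Conf n d) : ℝ :=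
  ∫ p, ‖φ p.1 p.2‖ ^ 2 ∂controlMeasure P T

theorem energy_eq_sum {φ : ℝ≥0 → Ω → Conf n d} (hφ : SquareIntegrable P T φ) :
    energy P T φ = ∑ i, ∫ p, ‖φ p.1 p.2 i‖ ^ 2 ∂controlMeasure P T := by
  simp only [energy, conf_norm_sq_eq]
  exact integral_finsetSum _ fun i _ => integrable_sq_norm_of_memLp (memLp_conf_iff.1 hφ i)

theorem costDeriv_smul (c : ℝ) (φ : ℝ≥0 → Ω → Conf n d) :
    N.costDeriv T L F G α (fun t ω => c • φ t ω) = c * N.costDeriv T L F G α φ := by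
  have h : ∀ t ω, runInt (fun t ω => c • φ t ω) t ω = c • runInt φ t ω := fun t ω =>
    integral_smul c _
  have hLp : ∀ (i : Fin n) (p : ℝ≥0 × Ω), ((c • runInt φ p.1 p.2) i, (c • φ p.1 p.2) i) =
      c • (runInt φ p.1 p.2 i, φ p.1 p.2 i) := fun i p => rfl
  simp only [costDeriv, h, hLp, map_smul, smul_eq_mul, integral_const_mul, ← Finset.mul_sum]
  ring

end

theorem aestronglyMeasurable_W :
    AEStronglyMeasurable (fun p : ℝ≥0 × Ω => N.W p.1 p.2) (controlMeasure P T) := by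
  have hcont : ∀ᵐ ω ∂P, Continuous fun t => N.W t ω := by
    have : ∀ᵐ ω ∂P, ∀ i k, Continuous fun t => N.W t ω i k :=
      ae_all_iff.2 fun i => ae_all_iff.2 fun k => (N.brownian i k).cont
    filter_upwards [this] with ω hω
    refine (PiLp.continuous_toLp 2 (fun _ : Fin n => Vec d)).comp (continuous_pi fun i => ?_)
    exact (PiLp.continuous_toLp 2 (fun _ : Fin d => ℝ)).comp (continuous_pi fun k => hω i k)
  obtain ⟨S, hS, hSm, hS0⟩ := exists_measurable_superset_of_null hcont
  let W' : ℝ≥0 → Ω → Conf n d := fun t => Sᶜ.indicator (N.W t)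
  have hW' : Measurable (Function.uncurry W') := by
    refine measurable_uncurry_of_continuous_of_measurable (fun ω => ?_)
      (fun t => (N.measurable_W t).indicator hSm.compl)
    by_cases hω : ω ∈ S
    · simp only [W', Set.indicator_of_notMem (Set.notMem_compl_iff.2 hω)]
      exact continuous_const
    · simp only [W', Set.indicator_of_mem (Set.mem_compl hω)]
      by_contra h
      exact hω (hS h)
  refine ⟨_, hW'.stronglyMeasurable, ?_⟩
  have hae : ∀ᵐ ω ∂P, ω ∈ Sᶜ := compl_mem_ae_iff.2 hS0
  filter_upwards [ae_controlMeasure_of_ae (T := T) hae] with p hp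
  exact (Set.indicator_of_mem hp.2 _).symm

theorem memLp_W_coord (i : Fin n) (k : Fin d) (t : ℝ≥0) :
    MemLp (fun ω => N.W t ω i k) 2 P ∧ ∫ ω, N.W t ω i k ^ 2 ∂P = t := by
  have hB := (N.brownian i k).toIsPreBrownianReal
  have hm := hB.isGaussianProcess.hasGaussianLaw_eval t |>.memLp_two
  refine ⟨hm, ?_⟩
  have h1 := hB.covariance_eval t t
  rw [covariance_self (hB.aemeasurable t), variance_of_integral_eq_zero (hB.aemeasurable t)
    (hB.integral_eval t), min_self] at h1
  exact h1

theorem state_eq (α : ℝ≥0 → Ω → Conf n d) (t : ℝ≥0) (ω : Ω) :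
    N.state α t ω = N.ξ ω + runInt α t ω + N.W t ω := rfl

theorem memLp_W_section (t : ℝ≥0) : MemLp (N.W t) 2 P :=
  memLp_conf_iff.2 fun i => memLp_vec_iff.2 fun k => (N.memLp_W_coord i k t).1

variable [IsProbabilityMeasure P]

theorem memLp_W : MemLp (fun p : ℝ≥0 × Ω => N.W p.1 p.2) 2 (controlMeasure P T) := by
  refine memLp_conf_iff.2 fun i => memLp_vec_iff.2 fun k => ?_
  have hm : AEStronglyMeasurable (fun p : ℝ≥0 × Ω => N.W p.1 p.2 i k) (controlMeasure P T) :=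
    ((EuclideanSpace.proj k : Vec d →L[ℝ] ℝ).continuous.comp
      (PiLp.continuous_apply 2 (fun _ : Fin n => Vec d) i)).comp_aestronglyMeasurable
      N.aestronglyMeasurable_W
  refine (memLp_two_iff_integrable_sq hm).2 ((integrable_prod_iff (hm.pow 2)).2 ⟨?_, ?_⟩)
  · exact Filter.Eventually.of_forall fun t => (N.memLp_W_coord i k t).1.integrable_sq
  · refine (integrable_coe_timeMeasure T).congr (Filter.Eventually.of_forall fun t => ?_)
    refine (N.memLp_W_coord i k t).2.symm.trans (integral_congr_ae ?_)
    exact Filter.Eventually.of_forall fun ω => (Real.norm_of_nonneg (sq_nonneg _)).symm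

variable {N}

theorem memLp_state {α : ℝ≥0 → Ω → Conf n d} (hα : SquareIntegrable P T α) :
    MemLp (fun p : ℝ≥0 × Ω => N.state α p.1 p.2) 2 (controlMeasure P T) :=
  ((N.memLp_ξ.comp_snd _).add (memLp_runInt hα).1).add N.memLp_W

theorem memLp_state_section {α : ℝ≥0 → Ω → Conf n d} (hα : SquareIntegrable P T α) {t : ℝ≥0}
    (ht : t ≤ T) : MemLp (N.state α t) 2 P :=
  (N.memLp_ξ.add (memLp_runInt_section hα ht).1).add (N.memLp_W_section t)

theorem memLp_state_control {α : ℝ≥0 → Ω → Conf n d} (hα : SquareIntegrable P T α) (i : Fin n) :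
    MemLp (fun p : ℝ≥0 × Ω => (N.state α p.1 p.2 i, α p.1 p.2 i)) 2 (controlMeasure P T) :=
  memLp_two_prodMk (memLp_conf_iff.1 (memLp_state hα) i) (memLp_conf_iff.1 hα i)

theorem memLp_runInt_control {φ : ℝ≥0 → Ω → Conf n d} (hφ : SquareIntegrable P T φ) (i : Fin n) :
    MemLp (fun p : ℝ≥0 × Ω => (runInt φ p.1 p.2 i, φ p.1 p.2 i)) 2 (controlMeasure P T) :=
  memLp_two_prodMk (memLp_conf_iff.1 (memLp_runInt hφ).1 i) (memLp_conf_iff.1 hφ i)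

theorem integral_sq_norm_runInt_control_le {φ : ℝ≥0 → Ω → Conf n d}
    (hφ : SquareIntegrable P T φ) (i : Fin n) :
    ∫ p, ‖(runInt φ p.1 p.2 i, φ p.1 p.2 i)‖ ^ 2 ∂controlMeasure P T ≤
      ((T : ℝ) ^ 2 / 2 + 1) * energy P T φ := by
  obtain ⟨hY, hYe⟩ := memLp_runInt hφ
  have hle : ∫ p, ‖(runInt φ p.1 p.2 i, φ p.1 p.2 i)‖ ^ 2 ∂controlMeasure P T ≤
      ∫ p, (‖runInt φ p.1 p.2‖ ^ 2 + ‖φ p.1 p.2‖ ^ 2) ∂controlMeasure P T := by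
    refine integral_mono (integrable_sq_norm_of_memLp (memLp_runInt_control hφ i))
      ((integrable_sq_norm_of_memLp hY).add (integrable_sq_norm_of_memLp hφ)) fun p => ?_
    have h1 := norm_sq_apply_le (runInt φ p.1 p.2) i
    have h2 := norm_sq_apply_le (φ p.1 p.2) i
    simp only [Prod.norm_def]
    rcases max_cases ‖runInt φ p.1 p.2 i‖ ‖φ p.1 p.2 i‖ with h | h <;> rw [h.1] <;>
      nlinarith [sq_nonneg ‖runInt φ p.1 p.2‖, sq_nonneg ‖φ p.1 p.2‖]
  rw [integral_add (integrable_sq_norm_of_memLp hY) (integrable_sq_norm_of_memLp hφ)] at hle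
  change _ ≤ _ + energy P T φ at hle
  change _ ≤ _ * energy P T φ at hYe
  linarith

/-! ### First and second order expansion of the cost -/

variable {L : Fin n → Vec d × Vec d → ℝ} {F G : Conf n d → ℝ} {α β : ℝ≥0 → Ω → Conf n d}

theorem cost_eq (hL : ∀ i, C2BoundedHess (L i)) (hF : C2BoundedHess F) (hG : C2BoundedHess G)
    (hα : SquareIntegrable P T α) :
    N.cost T L F G α =
      1 / (n : ℝ) * (∑ i, ∫ p, L i (N.state α p.1 p.2 i, α p.1 p.2 i) ∂controlMeasure P T) +
        ∫ p, F (N.state α p.1 p.2) ∂controlMeasure P T + ∫ ω, G (N.state α T ω) ∂P := by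
  have hLi : ∀ i, Integrable (fun p : ℝ≥0 × Ω => L i (N.state α p.1 p.2 i, α p.1 p.2 i))
      (controlMeasure P T) := fun i => integrable_comp (hL i) (memLp_state_control hα i)
  have hFi := integrable_comp hF (memLp_state (N := N) hα)
  have hGi := integrable_comp hG (memLp_state_section (N := N) hα le_rfl)
  have hsum : Integrable (fun p : ℝ≥0 × Ω =>
      1 / (n : ℝ) * ∑ i, L i (N.state α p.1 p.2 i, α p.1 p.2 i)) (controlMeasure P T) :=
    (integrable_finsetSum _ fun i _ => hLi i).const_mul _
  have hrun : Integrable (fun p : ℝ≥0 × Ω =>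
      1 / (n : ℝ) * (∑ i, L i (N.state α p.1 p.2 i, α p.1 p.2 i)) + F (N.state α p.1 p.2))
      (controlMeasure P T) := hsum.add hFi
  rw [cost, integral_add hrun.integral_prod_right hGi]
  rw [← integral_prod_symm _ hrun, integral_add hsum hFi, integral_const_mul,
    integral_finsetSum _ fun i _ => hLi i]

theorem runInt_sub_ae {α β : ℝ≥0 → Ω → Conf n d} (hα : SquareIntegrable P T α)
    (hβ : SquareIntegrable P T β) :
    ∀ᵐ ω ∂P, ∀ t ≤ T, runInt (fun s ω => β s ω - α s ω) t ω = runInt β t ω - runInt α t ω := by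
  filter_upwards [ae_memLp_path hα, ae_memLp_path hβ] with ω h1 h2 t ht
  have hle := Measure.restrict_mono_set timeMeasure (Set.Iic_subset_Iic.2 ht)
  exact integral_sub ((h2.integrable one_le_two).mono_measure hle)
    ((h1.integrable one_le_two).mono_measure hle)

theorem state_eq_add_ae {α β : ℝ≥0 → Ω → Conf n d} (hα : SquareIntegrable P T α)
    (hβ : SquareIntegrable P T β) :
    ∀ᵐ ω ∂P, ∀ t ≤ T,
      N.state β t ω = N.state α t ω + runInt (fun s ω => β s ω - α s ω) t ω := by
  filter_upwards [runInt_sub_ae hα hβ] with ω h t ht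
  rw [h t ht, state_eq, state_eq]
  abel

theorem cost_expansion_terms (hα : SquareIntegrable P T α) (hβ : SquareIntegrable P T β) :
    (∀ i, ∫ p, L i (N.state β p.1 p.2 i, β p.1 p.2 i) ∂controlMeasure P T =
      ∫ p, L i ((N.state α p.1 p.2 i, α p.1 p.2 i) +
        (runInt (fun s ω => β s ω - α s ω) p.1 p.2 i, β p.1 p.2 i - α p.1 p.2 i))
        ∂controlMeasure P T) ∧
    (∫ p, F (N.state β p.1 p.2) ∂controlMeasure P T =
      ∫ p, F (N.state α p.1 p.2 + runInt (fun s ω => β s ω - α s ω) p.1 p.2)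
        ∂controlMeasure P T) ∧
    (∫ ω, G (N.state β T ω) ∂P =
      ∫ ω, G (N.state α T ω + runInt (fun s ω => β s ω - α s ω) T ω) ∂P) := by
  have h := state_eq_add_ae (N := N) hα hβ
  have hp := ae_controlMeasure_of_ae (T := T) h
  refine ⟨fun i => integral_congr_ae ?_, integral_congr_ae ?_, integral_congr_ae ?_⟩
  · filter_upwards [hp] with p hp
    rw [hp.2 p.1 hp.1]
    simp
  · filter_upwards [hp] with p hp
    rw [hp.2 p.1 hp.1]
  · filter_upwards [h] with ω h
    rw [h T le_rfl]

/-- The cost is strongly convex over short horizons: the convexity of the Lagrangians in the control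
beats the concavity of `F` and `G`, since the displacement of the state is a time integral of the
displacement of the control. -/
theorem cost_lower {C_L C_F C_G : ℝ} (hCF : 0 ≤ C_F) (hCG : 0 ≤ C_G)
    (hL : ∀ i, LagrangianAssumption (L i) C_L) (hF : CostAssumption F C_F)
    (hG : CostAssumption G C_G) (hα : SquareIntegrable P T α) (hβ : SquareIntegrable P T β) :
    N.cost T L F G α + N.costDeriv T L F G α (fun t ω => β t ω - α t ω) +
      (C_L - (1 / 2 * C_F * (T : ℝ) ^ 2 + C_G * T)) / (2 * n) *
        energy P T (fun t ω => β t ω - α t ω) ≤ N.cost T L F G β := by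
  have hδ : SquareIntegrable P T (fun t ω => β t ω - α t ω) := hβ.sub hα
  obtain ⟨e1, e2, e3⟩ := cost_expansion_terms (N := N) (L := L) (F := F) (G := G) hα hβ
  rw [cost_eq (fun i => (hL i).c2) hF.c2 hG.c2 hα, cost_eq (fun i => (hL i).c2) hF.c2 hG.c2 hβ,
    e2, e3, Finset.sum_congr rfl fun i _ => e1 i, costDeriv, energy_eq_sum hδ]
  set δ : ℝ≥0 → Ω → Conf n d := fun t ω => β t ω - α t ω with hδdef
  obtain ⟨hY, hYe⟩ := memLp_runInt hδ
  obtain ⟨hYT, hYTe⟩ := memLp_runInt_section hδ le_rfl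
  change _ ≤ _ * energy P T δ at hYe hYTe
  rw [energy_eq_sum hδ] at hYe hYTe
  have hLi : ∀ i, ∫ p, L i (N.state α p.1 p.2 i, α p.1 p.2 i) ∂controlMeasure P T +
      ∫ p, fderiv ℝ (L i) (N.state α p.1 p.2 i, α p.1 p.2 i)
        (runInt δ p.1 p.2 i, δ p.1 p.2 i) ∂controlMeasure P T +
      (C_L * ∫ p, ‖δ p.1 p.2 i‖ ^ 2 ∂controlMeasure P T) / 2 ≤
      ∫ p, L i ((N.state α p.1 p.2 i, α p.1 p.2 i) +
        (runInt δ p.1 p.2 i, β p.1 p.2 i - α p.1 p.2 i)) ∂controlMeasure P T := fun i => by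
    rw [← integral_const_mul]
    exact integral_taylor_lower (hL i).c2 (memLp_state_control hα i) (memLp_runInt_control hδ i)
      (b := fun y => C_L * ‖y.2‖ ^ 2)
      ((integrable_sq_norm_of_memLp (memLp_conf_iff.1 hδ i)).const_mul C_L) (hL i).convex
  have hLs := Finset.sum_le_sum fun i (_ : i ∈ Finset.univ) => hLi i
  have hFi := integral_taylor_lower hF.c2 (memLp_state (N := N) hα) hY
    (b := fun y => -(C_F / n) * ‖y‖ ^ 2)
    ((integrable_sq_norm_of_memLp hY).const_mul _) hF.semiconvex
  have hGi := integral_taylor_lower hG.c2 (memLp_state_section (N := N) hα le_rfl) hYT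
    (b := fun y => -(C_G / n) * ‖y‖ ^ 2)
    ((integrable_sq_norm_of_memLp hYT).const_mul _) hG.semiconvex
  rw [integral_const_mul] at hFi hGi
  rw [Finset.sum_add_distrib, Finset.sum_add_distrib, ← Finset.sum_div, ← Finset.mul_sum] at hLs
  have hn : (0 : ℝ) ≤ 1 / n := by positivity
  have hLs' := mul_le_mul_of_nonneg_left hLs hn
  have hF' := mul_le_mul_of_nonneg_left hYe (show 0 ≤ C_F / n / 2 by positivity)
  have hG' := mul_le_mul_of_nonneg_left hYTe (show 0 ≤ C_G / n / 2 by positivity)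
  have hid : ∀ Q : ℝ, (C_L - (1 / 2 * C_F * (T : ℝ) ^ 2 + C_G * T)) / (2 * n) * Q =
      1 / n * (C_L * Q / 2) - C_F / n / 2 * ((T : ℝ) ^ 2 / 2 * Q) - C_G / n / 2 * (T * Q) :=
    fun Q => by ring
  rw [hid]
  linarith

/-- The cost grows at most quadratically around its first-order expansion, which makes `costDeriv`
its derivative. -/
theorem cost_upper (hL : ∀ i, C2BoundedHess (L i)) (hF : C2BoundedHess F) (hG : C2BoundedHess G)
    (hα : SquareIntegrable P T α) :
    ∃ M : ℝ, ∀ β, SquareIntegrable P T β →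
      N.cost T L F G β ≤ N.cost T L F G α + N.costDeriv T L F G α (fun t ω => β t ω - α t ω) +
        M * energy P T (fun t ω => β t ω - α t ω) := by
  choose K hK using fun i => (hL i).2
  obtain ⟨KF, hKF⟩ := hF.2
  obtain ⟨KG, hKG⟩ := hG.2
  refine ⟨1 / n * (∑ i, |K i| / 2 * ((T : ℝ) ^ 2 / 2 + 1)) + |KF| / 2 * ((T : ℝ) ^ 2 / 2) +
    |KG| / 2 * T, fun β hβ => ?_⟩
  have hδ : SquareIntegrable P T (fun t ω => β t ω - α t ω) := hβ.sub hα
  obtain ⟨e1, e2, e3⟩ := cost_expansion_terms (N := N) (L := L) (F := F) (G := G) hα hβ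
  rw [cost_eq hL hF hG hα, cost_eq hL hF hG hβ,
    e2, e3, Finset.sum_congr rfl fun i _ => e1 i, costDeriv]
  set δ : ℝ≥0 → Ω → Conf n d := fun t ω => β t ω - α t ω with hδdef
  obtain ⟨hY, hYe⟩ := memLp_runInt hδ
  obtain ⟨hYT, hYTe⟩ := memLp_runInt_section hδ le_rfl
  change _ ≤ _ * energy P T δ at hYe hYTe
  have hsq := integral_sq_norm_runInt_control_le hδ
  have hLi : ∀ i, ∫ p, L i ((N.state α p.1 p.2 i, α p.1 p.2 i) +
        (runInt δ p.1 p.2 i, β p.1 p.2 i - α p.1 p.2 i)) ∂controlMeasure P T ≤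
      ∫ p, L i (N.state α p.1 p.2 i, α p.1 p.2 i) ∂controlMeasure P T +
      ∫ p, fderiv ℝ (L i) (N.state α p.1 p.2 i, α p.1 p.2 i)
        (runInt δ p.1 p.2 i, δ p.1 p.2 i) ∂controlMeasure P T +
      |K i| / 2 * ((T : ℝ) ^ 2 / 2 + 1) * energy P T δ := fun i => by
    have h1 := integral_taylor_upper (hL i) (hK i) (memLp_state_control (N := N) hα i)
      (memLp_runInt_control hδ i)
    refine h1.trans (add_le_add_right ?_ _)
    rw [mul_assoc]
    refine mul_le_mul ?_ (hsq i) (integral_nonneg fun _ => by positivity) (by positivity)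
    linarith [le_abs_self (K i)]
  have hLs := Finset.sum_le_sum fun i (_ : i ∈ Finset.univ) => hLi i
  have hFi := integral_taylor_upper hF hKF (memLp_state (N := N) hα) hY
  have hGi := integral_taylor_upper hG hKG (memLp_state_section (N := N) hα le_rfl) hYT
  rw [Finset.sum_add_distrib, Finset.sum_add_distrib, ← Finset.sum_mul] at hLs
  have hLs' := mul_le_mul_of_nonneg_left hLs (show (0 : ℝ) ≤ 1 / n by positivity)
  have hF' : KF / 2 * ∫ p, ‖runInt δ p.1 p.2‖ ^ 2 ∂controlMeasure P T ≤
      |KF| / 2 * ((T : ℝ) ^ 2 / 2 * energy P T δ) :=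
    mul_le_mul (by linarith [le_abs_self KF]) hYe (integral_nonneg fun _ => by positivity)
      (by positivity)
  have hG' : KG / 2 * ∫ ω, ‖runInt δ T ω‖ ^ 2 ∂P ≤ |KG| / 2 * (T * energy P T δ) :=
    mul_le_mul (by linarith [le_abs_self KG]) hYTe (integral_nonneg fun _ => by positivity)
      (by positivity)
  linarith

/-- The derivative of the cost is additive on square-integrable processes. It need not be so in
general, where the time integrals may take junk values. -/
theorem costDeriv_sub (hL : ∀ i, C2BoundedHess (L i)) (hF : C2BoundedHess F)
    (hG : C2BoundedHess G) (hα : SquareIntegrable P T α) {φ ψ : ℝ≥0 → Ω → Conf n d}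
    (hφ : SquareIntegrable P T φ) (hψ : SquareIntegrable P T ψ) :
    N.costDeriv T L F G α (fun t ω => φ t ω - ψ t ω) =
      N.costDeriv T L F G α φ - N.costDeriv T L F G α ψ := by
  have h := runInt_sub_ae hψ hφ
  have hp := ae_controlMeasure_of_ae (T := T) h
  have hLi : ∀ i, ∫ p, fderiv ℝ (L i) (N.state α p.1 p.2 i, α p.1 p.2 i)
      (runInt (fun t ω => φ t ω - ψ t ω) p.1 p.2 i, (φ p.1 p.2 - ψ p.1 p.2) i)
        ∂controlMeasure P T =
      ∫ p, fderiv ℝ (L i) (N.state α p.1 p.2 i, α p.1 p.2 i)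
        (runInt φ p.1 p.2 i, φ p.1 p.2 i) ∂controlMeasure P T -
      ∫ p, fderiv ℝ (L i) (N.state α p.1 p.2 i, α p.1 p.2 i)
        (runInt ψ p.1 p.2 i, ψ p.1 p.2 i) ∂controlMeasure P T := fun i => by
    rw [← integral_sub
      (integrable_fderiv_apply (hL i) (memLp_state_control hα i) (memLp_runInt_control hφ i))
      (integrable_fderiv_apply (hL i) (memLp_state_control hα i) (memLp_runInt_control hψ i))]
    refine integral_congr_ae ?_
    filter_upwards [hp] with p hp
    rw [hp.2 p.1 hp.1, ← map_sub]
    rfl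
  have hFi : ∫ p, fderiv ℝ F (N.state α p.1 p.2) (runInt (fun t ω => φ t ω - ψ t ω) p.1 p.2)
        ∂controlMeasure P T =
      ∫ p, fderiv ℝ F (N.state α p.1 p.2) (runInt φ p.1 p.2) ∂controlMeasure P T -
      ∫ p, fderiv ℝ F (N.state α p.1 p.2) (runInt ψ p.1 p.2) ∂controlMeasure P T := by
    rw [← integral_sub (integrable_fderiv_apply hF (memLp_state hα) (memLp_runInt hφ).1)
      (integrable_fderiv_apply hF (memLp_state hα) (memLp_runInt hψ).1)]
    refine integral_congr_ae ?_
    filter_upwards [hp] with p hp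
    rw [hp.2 p.1 hp.1, map_sub]
  have hGi : ∫ ω, fderiv ℝ G (N.state α T ω) (runInt (fun t ω => φ t ω - ψ t ω) T ω) ∂P =
      ∫ ω, fderiv ℝ G (N.state α T ω) (runInt φ T ω) ∂P -
      ∫ ω, fderiv ℝ G (N.state α T ω) (runInt ψ T ω) ∂P := by
    rw [← integral_sub (integrable_fderiv_apply hG (memLp_state_section hα le_rfl)
        (memLp_runInt_section hφ le_rfl).1)
      (integrable_fderiv_apply hG (memLp_state_section hα le_rfl)
        (memLp_runInt_section hψ le_rfl).1)]
    refine integral_congr_ae ?_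
    filter_upwards [h] with ω h
    rw [h T le_rfl, map_sub]
  rw [costDeriv, costDeriv, costDeriv, hFi, hGi, Finset.sum_congr rfl fun i _ => hLi i,
    Finset.sum_sub_distrib]
  ring

/-- The derivative of the cost is continuous in `L²([0, T] × Ω)`. -/
theorem abs_costDeriv_le (hL : ∀ i, C2BoundedHess (L i)) (hF : C2BoundedHess F)
    (hG : C2BoundedHess G) (hα : SquareIntegrable P T α) :
    ∃ M : ℝ, ∀ φ, SquareIntegrable P T φ →
      |N.costDeriv T L F G α φ| ≤ M * Real.sqrt (energy P T φ) := by
  choose M hM0 hM using fun i =>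
    abs_integral_fderiv_apply_le (hL i) (memLp_state_control (N := N) hα i)
  obtain ⟨MF, hMF0, hMF⟩ := abs_integral_fderiv_apply_le hF (memLp_state (N := N) hα)
  obtain ⟨MG, hMG0, hMG⟩ :=
    abs_integral_fderiv_apply_le hG (memLp_state_section (N := N) hα le_rfl)
  refine ⟨1 / n * (∑ i, M i * Real.sqrt ((T : ℝ) ^ 2 / 2 + 1)) + MF * Real.sqrt ((T : ℝ) ^ 2 / 2)
    + MG * Real.sqrt T, fun φ hφ => ?_⟩
  obtain ⟨hY, hYe⟩ := memLp_runInt hφ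
  obtain ⟨hYT, hYTe⟩ := memLp_runInt_section hφ le_rfl
  change _ ≤ _ * energy P T φ at hYe hYTe
  have hsq := integral_sq_norm_runInt_control_le hφ
  have h1 : |∑ i, ∫ p, fderiv ℝ (L i) (N.state α p.1 p.2 i, α p.1 p.2 i)
      (runInt φ p.1 p.2 i, φ p.1 p.2 i) ∂controlMeasure P T| ≤
      ∑ i, M i * Real.sqrt ((T : ℝ) ^ 2 / 2 + 1) * Real.sqrt (energy P T φ) := by
    refine (Finset.abs_sum_le_sum_abs _ _).trans (Finset.sum_le_sum fun i _ => ?_)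
    refine (hM i _ (memLp_runInt_control hφ i)).trans ?_
    rw [mul_assoc, ← Real.sqrt_mul (by positivity)]
    exact mul_le_mul_of_nonneg_left (Real.sqrt_le_sqrt (hsq i)) (hM0 i)
  have h2 := (hMF _ hY).trans (mul_le_mul_of_nonneg_left (Real.sqrt_le_sqrt hYe) hMF0)
  have h3 := (hMG _ hYT).trans (mul_le_mul_of_nonneg_left (Real.sqrt_le_sqrt hYTe) hMG0)
  rw [Real.sqrt_mul (by positivity)] at h2 h3
  rw [← Finset.sum_mul] at h1
  rw [costDeriv]
  refine (abs_add_three _ _ _).trans ?_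
  rw [abs_mul, abs_of_nonneg (show (0 : ℝ) ≤ 1 / n by positivity)]
  have h1' := mul_le_mul_of_nonneg_left h1 (show (0 : ℝ) ≤ 1 / n by positivity)
  linarith

end Noise

/-! ### Replacing one coordinate -/

section Replace

variable {n d : ℕ}

/-- A shortcut for instance search. -/
instance : ContinuousSMul ℝ (Conf n d) := IsBoundedSMul.continuousSMul

/-- The configuration `y` with its `i`-th component replaced by `x`. -/
def replaceCoord (i : Fin n) (x : Vec d) (y : Conf n d) : Conf n d :=
  WithLp.toLp 2 (Function.update (WithLp.ofLp y) i x)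

theorem replaceCoord_same (i : Fin n) (x : Vec d) (y : Conf n d) : replaceCoord i x y i = x := by
  simp [replaceCoord]

/-- The projection of `(ℝ^d)^n` that sets the `i`-th component to zero. -/
def dropCoord (i : Fin n) : Conf n d →L[ℝ] Conf n d :=
  ((PiLp.continuousLinearEquiv 2 ℝ (fun _ : Fin n => Vec d)).symm :
      (Fin n → Vec d) →L[ℝ] Conf n d).comp
    ((ContinuousLinearMap.pi fun j => if j = i then 0 else ContinuousLinearMap.proj j).comp
      (PiLp.continuousLinearEquiv 2 ℝ (fun _ : Fin n => Vec d) : Conf n d →L[ℝ] (Fin n → Vec d)))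

theorem dropCoord_apply (i j : Fin n) (v : Conf n d) :
    dropCoord i v j = if j = i then 0 else v j := by
  by_cases h : j = i <;> simp [dropCoord, h]

theorem unitVec_apply (j j' : Fin n) (l l' : Fin d) :
    (unitVec j l : Conf n d) j' l' = if j' = j then (if l' = l then 1 else 0) else 0 := by
  by_cases h : j' = j
  · subst h
    simp [unitVec, PiLp.single_apply, EuclideanSpace.single]
  · simp [unitVec, h]

theorem dropCoord_eq_sum (i : Fin n) (v : Conf n d) :
    dropCoord i v = ∑ j ∈ Finset.univ.erase i, ∑ l, v j l • unitVec j l := by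
  ext j k
  have h1 : (∑ j' ∈ Finset.univ.erase i, ∑ l, v j' l • unitVec j' l : Conf n d) j k =
      ∑ j' ∈ Finset.univ.erase i, ∑ l, v j' l * (unitVec j' l : Conf n d) j k := by
    simp only [WithLp.ofLp_sum, Finset.sum_apply, WithLp.ofLp_smul, Pi.smul_apply, smul_eq_mul]
  rw [h1, dropCoord_apply]
  simp only [unitVec_apply]
  split_ifs with h
  · symm
    refine Finset.sum_eq_zero fun j' hj' => Finset.sum_eq_zero fun l _ => ?_
    rw [if_neg fun h' => (Finset.mem_erase.1 hj').1 (h'.symm.trans h), mul_zero]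
  · rw [Finset.sum_eq_single_of_mem j (Finset.mem_erase.2 ⟨h, Finset.mem_univ _⟩),
      Finset.sum_eq_single_of_mem k (Finset.mem_univ _)]
    · simp
    · intro l _ hl
      simp [hl.symm]
    · intro j' _ hj'
      exact Finset.sum_eq_zero fun l _ => by rw [if_neg hj'.symm, mul_zero]

theorem replaceCoord_eq (i : Fin n) (x : Vec d) (y : Conf n d) :
    replaceCoord i x y = dropCoord i y + replaceCoord i x 0 := by
  ext j k
  rw [PiLp.add_apply, PiLp.add_apply, dropCoord_apply]
  by_cases h : j = i
  · subst h
    simp [replaceCoord]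
  · simp [replaceCoord, h]

theorem continuous_replaceCoord (i : Fin n) :
    Continuous fun p : Vec d × Conf n d => replaceCoord i p.1 p.2 :=
  (PiLp.continuous_toLp 2 (fun _ : Fin n => Vec d)).comp
    (((PiLp.continuous_ofLp 2 (fun _ : Fin n => Vec d)).comp continuous_snd).update i
      continuous_fst)

theorem sum_sq_coord (v : Conf n d) : ∑ j, ∑ l, v j l ^ 2 = ‖v‖ ^ 2 := by
  rw [conf_norm_sq_eq]
  exact Finset.sum_congr rfl fun j _ => (EuclideanSpace.real_norm_sq_eq _).symm

end Replace

/-! ### Conditional variance of the partial derivatives -/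

section Variance

variable {n d : ℕ} {u : Conf n d → ℝ}

theorem continuous_hess (hu : ContDiff ℝ 2 u) (v w : Conf n d) :
    Continuous fun z => hess u z v w :=
  (((hu.fderiv_right (m := 1) (by norm_num)).continuous_fderiv (by norm_num)).clm_apply
    continuous_const).clm_apply continuous_const

theorem hess_symm (hu : ContDiff ℝ 2 u) (z v w : Conf n d) : hess u z v w = hess u z w v :=
  (hu.contDiffAt.isSymmSndFDerivAt (by simp)).eq v w

/-- The squared norm of the gradient of `∂_{x^i_k} u` with respect to the variables other than
`x^i`. -/
def crossGradSq (u : Conf n d → ℝ) (i : Fin n) (k : Fin d) (z : Conf n d) : ℝ :=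
  ∑ j ∈ Finset.univ.erase i, ∑ l, hess u z (unitVec i k) (unitVec j l) ^ 2

theorem crossGradSq_nonneg (u : Conf n d → ℝ) (i : Fin n) (k : Fin d) (z : Conf n d) :
    0 ≤ crossGradSq u i k z :=
  Finset.sum_nonneg fun _ _ => Finset.sum_nonneg fun _ _ => sq_nonneg _

theorem continuous_crossGradSq (hu : ContDiff ℝ 2 u) (i : Fin n) (k : Fin d) :
    Continuous (crossGradSq u i k) :=
  continuous_finsetSum _ fun _ _ => continuous_finsetSum _ fun _ _ => (continuous_hess hu _ _).pow 2

theorem norm_unitVec (i : Fin n) (k : Fin d) : ‖(unitVec i k : Conf n d)‖ = 1 := by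
  simp [unitVec]

theorem abs_hess_unitVec_le {K : ℝ} (hK : ∀ x, ‖fderiv ℝ (fderiv ℝ u) x‖ ≤ K) (z : Conf n d)
    (i j : Fin n) (k l : Fin d) : |hess u z (unitVec i k) (unitVec j l)| ≤ K := by
  simpa [norm_unitVec] using abs_hess_le hK z (unitVec i k) (unitVec j l)

theorem frobenius_sq (A : Matrix (Fin d) (Fin d) ℝ) : frobenius A ^ 2 = ∑ k, ∑ l, A k l ^ 2 :=
  Real.sq_sqrt (Finset.sum_nonneg fun _ _ => Finset.sum_nonneg fun _ _ => sq_nonneg _)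

/-- The supremum defining `blockSupNorm` is that of a bounded family, hence an upper bound. -/
theorem frobenius_hessBlock_le (hu : C2BoundedHess u) (i j : Fin n) (z : Conf n d) :
    frobenius (hessBlock u i j z) ≤ blockSupNorm u i j := by
  obtain ⟨K, hK⟩ := hu.2
  refine le_ciSup (f := fun x => frobenius (hessBlock u i j x))
    ⟨Real.sqrt (∑ _k : Fin d, ∑ _l : Fin d, K ^ 2), ?_⟩ z
  rintro _ ⟨x, rfl⟩
  refine Real.sqrt_le_sqrt (Finset.sum_le_sum fun k _ => Finset.sum_le_sum fun l _ => ?_)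
  exact sq_le_sq' (abs_le.1 (abs_hess_unitVec_le hK x i j k l)).1
    (abs_le.1 (abs_hess_unitVec_le hK x i j k l)).2

theorem sum_crossGradSq_le (hu : C2BoundedHess u) (i : Fin n) (z : Conf n d) :
    ∑ k, crossGradSq u i k z ≤ ∑ j ∈ Finset.univ.erase i, blockSupNorm u i j ^ 2 := by
  simp only [crossGradSq]
  rw [Finset.sum_comm]
  refine Finset.sum_le_sum fun j _ => ?_
  rw [show ∑ k, ∑ l, hess u z (unitVec i k) (unitVec j l) ^ 2 = frobenius (hessBlock u i j z) ^ 2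
    from (frobenius_sq _).symm]
  exact pow_le_pow_left₀ (Real.sqrt_nonneg _) (frobenius_hessBlock_le hu i j z) 2

theorem blockSupNorm_comm (hu : ContDiff ℝ 2 u) (i j : Fin n) :
    blockSupNorm u i j = blockSupNorm u j i := by
  unfold blockSupNorm
  congr 1
  funext x
  unfold frobenius
  congr 1
  rw [Finset.sum_comm]
  refine Finset.sum_congr rfl fun k _ => Finset.sum_congr rfl fun l _ => ?_
  simp only [hessBlock, Matrix.of_apply]
  rw [hess_symm hu]

theorem hasFDerivAt_partial_replaceCoord (hu : ContDiff ℝ 2 u) (i : Fin n) (x : Vec d)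
    (e y : Conf n d) :
    HasFDerivAt (fun y => fderiv ℝ u (replaceCoord i x y) e)
      (((fderiv ℝ (fderiv ℝ u) (replaceCoord i x y)).flip e).comp (dropCoord i)) y := by
  have h1 : HasFDerivAt (fun y => replaceCoord i x y) (dropCoord i) y := by
    rw [show (fun y => replaceCoord i x y) = fun y => dropCoord i y + replaceCoord i x 0 from
      funext (replaceCoord_eq i x)]
    exact (dropCoord i).hasFDerivAt.add_const _
  have h2 := (differentiable_fderiv_of_contDiff_two hu (replaceCoord i x y)).hasFDerivAt.comp y h1
  refine (h2.clm_apply (hasFDerivAt_const e y)).congr_fderiv ?_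
  ext v
  simp

theorem contDiff_partial_replaceCoord (hu : ContDiff ℝ 2 u) (i : Fin n) (x : Vec d)
    (e : Conf n d) : ContDiff ℝ 1 (fun y => fderiv ℝ u (replaceCoord i x y) e) := by
  have h1 : ContDiff ℝ 1 (fun y : Conf n d => replaceCoord i x y) := by
    rw [show (fun y => replaceCoord i x y) = fun y => dropCoord i y + replaceCoord i x 0 from
      funext (replaceCoord_eq i x)]
    exact (dropCoord i).contDiff.add contDiff_const
  exact ((hu.fderiv_right (m := 1) (by norm_num)).comp h1).clm_apply contDiff_const

theorem norm_fderiv_partial_replaceCoord_sq_le (hu : ContDiff ℝ 2 u) (i : Fin n) (k : Fin d)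
    (x : Vec d) (y : Conf n d) :
    ‖fderiv ℝ (fun y => fderiv ℝ u (replaceCoord i x y) (unitVec i k)) y‖ ^ 2 ≤
      crossGradSq u i k (replaceCoord i x y) := by
  rw [(hasFDerivAt_partial_replaceCoord hu i x _ y).fderiv]
  set z := replaceCoord i x y
  have hD := crossGradSq_nonneg u i k z
  rw [← Real.sq_sqrt hD]
  refine pow_le_pow_left₀ (norm_nonneg _) ?_ 2
  refine ContinuousLinearMap.opNorm_le_bound _ (Real.sqrt_nonneg _) fun v => ?_
  have e1 : (((fderiv ℝ (fderiv ℝ u) z).flip (unitVec i k)).comp (dropCoord i)) v =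
      ∑ p ∈ Finset.univ.erase i ×ˢ Finset.univ, hess u z (unitVec i k) (unitVec p.1 p.2) *
        v p.1 p.2 := by
    rw [Finset.sum_product, ContinuousLinearMap.comp_apply, dropCoord_eq_sum, map_sum]
    refine Finset.sum_congr rfl fun j _ => ?_
    rw [map_sum]
    refine Finset.sum_congr rfl fun l _ => ?_
    rw [map_smul, smul_eq_mul, mul_comm, hess_symm hu]
    rfl
  rw [e1, ← Real.sqrt_sq (norm_nonneg v), ← Real.sqrt_mul hD, Real.norm_eq_abs]
  refine Real.abs_le_sqrt ((Finset.sum_mul_sq_le_sq_mul_sq _ _ _).trans ?_)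
  rw [Finset.sum_product, Finset.sum_product]
  refine mul_le_mul_of_nonneg_left ?_ hD
  rw [← sum_sq_coord v]
  exact Finset.sum_le_sum_of_subset_of_nonneg (Finset.erase_subset _ _)
    fun _ _ _ => Finset.sum_nonneg fun _ _ => sq_nonneg _

variable {Ω : Type*} [mΩ : MeasurableSpace Ω] {P : Measure Ω} [IsProbabilityMeasure P]

theorem map_update_pi {ι : Type*} [Fintype ι] [DecidableEq ι] {β : ι → Type*}
    [∀ i, MeasurableSpace (β i)] (μ : ∀ i, Measure (β i)) [∀ i, IsProbabilityMeasure (μ i)]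
    (i : ι) :
    ((μ i).prod (Measure.pi μ)).map (fun p => Function.update p.2 i p.1) = Measure.pi μ := by
  symm
  refine Measure.pi_eq fun s hs => ?_
  have hm : Measurable fun p : β i × (∀ i, β i) => Function.update p.2 i p.1 := by
    refine measurable_pi_lambda _ fun j => ?_
    by_cases h : j = i
    · subst h
      simpa using measurable_fst
    · simp only [Function.update_of_ne h]
      exact (measurable_pi_apply j).comp measurable_snd
  have hpre : (fun p : β i × (∀ i, β i) => Function.update p.2 i p.1) ⁻¹' Set.univ.pi s =
      s i ×ˢ Set.univ.pi (Function.update s i Set.univ) := by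
    ext p
    simp only [Set.mem_preimage, Set.mem_univ_pi, Set.mem_prod]
    refine ⟨fun h => ⟨by simpa using h i, fun j => ?_⟩, fun h j => ?_⟩
    · by_cases hj : j = i
      · subst hj; simp
      · simpa [hj] using h j
    · by_cases hj : j = i
      · subst hj; simpa using h.1
      · simpa [hj] using h.2 j
  rw [Measure.map_apply hm (MeasurableSet.univ_pi hs), hpre, Measure.prod_prod, Measure.pi_pi,
    ← Finset.mul_prod_erase _ _ (Finset.mem_univ i),
    ← Finset.mul_prod_erase _ _ (Finset.mem_univ i)]
  simp only [Function.update_self, measure_univ, one_mul]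
  congr 1
  refine Finset.prod_congr rfl fun j hj => ?_
  rw [Function.update_of_ne (Finset.mem_erase.1 hj).1]

/-- If the components of `X` are independent, then the law of `X` is unchanged when one component
is replaced by an independent copy. -/
theorem map_replaceCoord {X : Ω → Conf n d} (hX : AEMeasurable X P)
    (hind : iIndepFun (fun i ω => X ω i) P) (i : Fin n) :
    ((P.map fun ω => X ω i).prod (P.map X)).map (fun p => replaceCoord i p.1 p.2) = P.map X := by
  have hof : Measurable (fun x : Conf n d => WithLp.ofLp x) := WithLp.measurable_ofLp 2 _
  have hto : Measurable (fun x : Fin n → Vec d => (WithLp.toLp 2 x : Conf n d)) :=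
    WithLp.measurable_toLp 2 _
  have hXi : ∀ i, AEMeasurable (fun ω => X ω i) P := fun i =>
    (PiLp.continuous_apply 2 (fun _ : Fin n => Vec d) i).measurable.comp_aemeasurable hX
  have : ∀ j, IsProbabilityMeasure (P.map fun ω => X ω j) := fun j =>
    Measure.isProbabilityMeasure_map (hXi j)
  have : IsProbabilityMeasure (P.map X) := Measure.isProbabilityMeasure_map hX
  have hpi := (iIndepFun_iff_map_fun_eq_pi_map hXi).1 hind
  have h1 : P.map X = (Measure.pi fun j => P.map fun ω => X ω j).map (WithLp.toLp 2) := by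
    rw [← hpi, AEMeasurable.map_map_of_aemeasurable hto.aemeasurable
      (aemeasurable_pi_lambda _ hXi)]
    rfl
  have h2 : (Measure.pi fun j => P.map fun ω => X ω j) = (P.map X).map WithLp.ofLp := by
    rw [← hpi, AEMeasurable.map_map_of_aemeasurable hof.aemeasurable hX]
    rfl
  have h3 := map_update_pi (fun j => P.map fun ω => X ω j) i
  have h4 : (P.map fun ω => X ω i).prod (Measure.pi fun j => P.map fun ω => X ω j) =
      ((P.map fun ω => X ω i).prod (P.map X)).map (Prod.map id WithLp.ofLp) := by
    rw [h2]
    conv_lhs => rw [← Measure.map_id (μ := P.map fun ω => X ω i)]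
    exact Measure.map_prod_map _ _ measurable_id hof
  have hup : Measurable fun p : Vec d × (Fin n → Vec d) => Function.update p.2 i p.1 :=
    (continuous_snd.update i continuous_fst).measurable
  rw [h4, Measure.map_map hup (measurable_id.prodMap hof)] at h3
  conv_rhs => rw [h1, ← h3]
  rw [Measure.map_map hto (hup.comp (measurable_id.prodMap hof))]
  rfl

/-- For independent components, a partial derivative with respect to `x^i` is close in mean square
to a function of the `i`-th component alone, namely its average over the other components. The
Poincaré inequality of the whole law is applied to the partial derivative with `x^i` frozen, whose
gradient only contains the off-diagonal second derivatives. No sign of the constant `C` is assumed,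
whence the absolute value. -/
theorem exists_coordinate_approx {X : Ω → Conf n d} (hX : AEMeasurable X P)
    (hind : iIndepFun (fun i ω => X ω i) P) (hu : C2BoundedHess u)
    (hgrad : ∃ K : ℝ, ∀ x, ‖fderiv ℝ u x‖ ≤ K) {C : ℝ} (hP : Poincare (P.map X) C)
    (i : Fin n) (k : Fin d) :
    ∃ f : Vec d → ℝ, Measurable f ∧ (∃ B : ℝ, ∀ x, |f x| ≤ B) ∧
      ∫ ω, (fderiv ℝ u (X ω) (unitVec i k) - f (X ω i)) ^ 2 ∂P ≤
        |C| * ∫ ω, crossGradSq u i k (X ω) ∂P := by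
  obtain ⟨B, hB⟩ := hgrad
  obtain ⟨K, hK⟩ := hu.2
  have hXi : AEMeasurable (fun ω => X ω i) P :=
    (PiLp.continuous_apply 2 (fun _ : Fin n => Vec d) i).measurable.comp_aemeasurable hX
  let m : Measure (Conf n d) := P.map X
  let mi : Measure (Vec d) := P.map fun ω => X ω i
  have : IsProbabilityMeasure m := Measure.isProbabilityMeasure_map hX
  have : IsProbabilityMeasure mi := Measure.isProbabilityMeasure_map hXi
  have hlaw : (mi.prod m).map (fun p => replaceCoord i p.1 p.2) = m := map_replaceCoord hX hind i
  set e : Conf n d := unitVec i k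
  have hrc := continuous_replaceCoord (n := n) (d := d) i
  have hDc : Continuous (fderiv ℝ u) := hu.1.continuous_fderiv (by norm_num)
  have hgc : Continuous fun z => fderiv ℝ u z e := hDc.clm_apply continuous_const
  have hgB : ∀ z, |fderiv ℝ u z e| ≤ B := fun z => by
    have := (fderiv ℝ u z).le_opNorm e
    rw [norm_unitVec, mul_one] at this
    exact this.trans (hB z)
  let g : Vec d → Conf n d → ℝ := fun x y => fderiv ℝ u (replaceCoord i x y) e
  have hgcont : Continuous (Function.uncurry g) := hgc.comp hrc
  have hgint : ∀ x, Integrable (g x) m := fun x =>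
    (integrable_const B).mono'
      (hgcont.comp (by fun_prop : Continuous fun y => (x, y))).aestronglyMeasurable
      (Filter.Eventually.of_forall fun y => hgB _)
  let f : Vec d → ℝ := fun x => ∫ y, g x y ∂m
  have hf : Measurable f :=
    (hgcont.stronglyMeasurable.integral_prod_right' (ν := m)).measurable
  have hfB : ∀ x, |f x| ≤ B := fun x => by
    have := norm_integral_le_of_norm_le_const (μ := m) (f := g x) (C := B)
      (Filter.Eventually.of_forall fun y => hgB (replaceCoord i x y))
    simpa using this
  refine ⟨f, hf, ⟨B, hfB⟩, ?_⟩
  have hHm : Measurable fun z : Conf n d => (fderiv ℝ u z e - f (z i)) ^ 2 :=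
    (hgc.measurable.sub (hf.comp
      (PiLp.continuous_apply 2 (fun _ : Fin n => Vec d) i).measurable)).pow_const 2
  have hHb : ∀ z : Conf n d, ‖(fderiv ℝ u z e - f (z i)) ^ 2‖ ≤ (B + B) ^ 2 := fun z => by
    rw [Real.norm_of_nonneg (sq_nonneg _), ← sq_abs]
    exact pow_le_pow_left₀ (abs_nonneg _) ((abs_sub _ _).trans (add_le_add (hgB z) (hfB _))) 2
  -- both sides are integrals against the law of the configuration with a resampled component
  have hresample : ∀ h : Conf n d → ℝ, Measurable h → (∃ b : ℝ, ∀ z, ‖h z‖ ≤ b) →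
      Integrable (fun p : Vec d × Conf n d => h (replaceCoord i p.1 p.2)) (mi.prod m) ∧
      ∫ ω, h (X ω) ∂P = ∫ x, (∫ y, h (replaceCoord i x y) ∂m) ∂mi := by
    rintro h hm ⟨b, hb⟩
    have hint : Integrable (fun p : Vec d × Conf n d => h (replaceCoord i p.1 p.2)) (mi.prod m) :=
      (integrable_const b).mono' (hm.comp hrc.measurable).aestronglyMeasurable
        (Filter.Eventually.of_forall fun p => hb _)
    refine ⟨hint, ?_⟩
    rw [← integral_map hX hm.aestronglyMeasurable, ← integral_prod _ hint]
    change ∫ z, h z ∂m = _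
    conv_lhs => rw [← hlaw]
    exact integral_map hrc.measurable.aemeasurable hm.aestronglyMeasurable
  obtain ⟨hi1, he1⟩ := hresample _ hHm ⟨_, hHb⟩
  obtain ⟨hi2, he2⟩ := hresample (crossGradSq u i k) (continuous_crossGradSq hu.1 i k).measurable
    ⟨∑ _j ∈ Finset.univ.erase i, ∑ _l : Fin d, K ^ 2, fun z => by
      rw [Real.norm_of_nonneg (crossGradSq_nonneg u i k z)]
      refine Finset.sum_le_sum fun j _ => Finset.sum_le_sum fun l _ => ?_
      exact sq_le_sq' (abs_le.1 (abs_hess_unitVec_le hK z i j k l)).1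
        (abs_le.1 (abs_hess_unitVec_le hK z i j k l)).2⟩
  rw [he1, he2, ← integral_const_mul]
  refine integral_mono_ae hi1.integral_prod_left (hi2.integral_prod_left.const_mul _) ?_
  filter_upwards [hi2.prod_right_ae] with x hx
  have hgsq : Integrable (fun y => g x y ^ 2) m :=
    (integrable_const (B ^ 2)).mono'
      ((hgcont.comp (by fun_prop : Continuous fun y => (x, y))).pow 2).aestronglyMeasurable
      (Filter.Eventually.of_forall fun y => by
        rw [Real.norm_of_nonneg (sq_nonneg _), ← sq_abs]
        exact pow_le_pow_left₀ (abs_nonneg _) (hgB _) 2)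
  have hvar : ∫ y, (fderiv ℝ u (replaceCoord i x y) e - f (replaceCoord i x y i)) ^ 2 ∂m =
      ∫ y, g x y ^ 2 ∂m - (∫ y, g x y ∂m) ^ 2 := by
    have h1 : ∀ y, (fderiv ℝ u (replaceCoord i x y) e - f (replaceCoord i x y i)) ^ 2 =
        g x y ^ 2 - 2 * f x * g x y + f x ^ 2 := fun y => by
      rw [replaceCoord_same]; ring
    simp only [h1]
    rw [integral_add (f := fun y => g x y ^ 2 - 2 * f x * g x y)
      (hgsq.sub ((hgint x).const_mul _)) (integrable_const _),
      integral_sub hgsq ((hgint x).const_mul _), integral_const_mul, integral_const]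
    simp only [probReal_univ, one_smul]
    change _ - 2 * f x * f x + _ = _ - f x ^ 2
    ring
  have hgrad_le : ∀ y, ‖fderiv ℝ (g x) y‖ ^ 2 ≤ crossGradSq u i k (replaceCoord i x y) :=
    norm_fderiv_partial_replaceCoord_sq_le hu.1 i k x
  have hpoin := hP (g x) (contDiff_partial_replaceCoord hu.1 i x e)
    ⟨(Real.sqrt (∑ _j ∈ Finset.univ.erase i, ∑ _l : Fin d, K ^ 2)).toNNReal, by
      refine lipschitzWith_of_nnnorm_fderiv_le
        ((contDiff_partial_replaceCoord hu.1 i x e).differentiable (by norm_num)) fun y => ?_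
      rw [← NNReal.coe_le_coe, coe_nnnorm, Real.coe_toNNReal _ (Real.sqrt_nonneg _)]
      refine Real.le_sqrt_of_sq_le ((hgrad_le y).trans ?_)
      refine Finset.sum_le_sum fun j _ => Finset.sum_le_sum fun l _ => ?_
      exact sq_le_sq' (abs_le.1 (abs_hess_unitVec_le hK _ i j k l)).1
        (abs_le.1 (abs_hess_unitVec_le hK _ i j k l)).2⟩ ⟨B, fun y => hgB _⟩
  rw [hvar]
  refine hpoin.trans ?_
  have hnn : 0 ≤ ∫ y, ‖fderiv ℝ (g x) y‖ ^ 2 ∂m := integral_nonneg fun _ => by positivity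
  refine (mul_le_mul_of_nonneg_right (le_abs_self C) hnn).trans ?_
  refine mul_le_mul_of_nonneg_left ?_ (abs_nonneg C)
  exact integral_mono_of_nonneg (Filter.Eventually.of_forall fun _ => by positivity) hx
    (Filter.Eventually.of_forall hgrad_le)

end Variance

/-! ### Measurability of the state with respect to the agents' information -/

theorem stronglyMeasurable_integral_left {Ω S E : Type*} {m : MeasurableSpace Ω}
    [MeasurableSpace S] [NormedAddCommGroup E] [NormedSpace ℝ E]
    {ν : Measure S} [SFinite ν] {g : S × Ω → E} (hg : StronglyMeasurable g) :
    StronglyMeasurable fun ω => ∫ s, g (s, ω) ∂ν :=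
  hg.integral_prod_left'

/-- The time integral of a progressive process up to time `t` is known at time `t`. -/
theorem measurable_runInt_of_isProgressive {Ω E : Type*} [mΩ : MeasurableSpace Ω]
    [NormedAddCommGroup E] [NormedSpace ℝ E] [MeasurableSpace E] [BorelSpace E]
    [SecondCountableTopology E] {f : Filtration ℝ≥0 mΩ} {φ : ℝ≥0 → Ω → E}
    (hφ : IsProgressive f φ) (t : ℝ≥0) : Measurable[f t] (runInt φ t) := by
  have hfin : IsFiniteMeasure (Measure.comap (fun x : Set.Iic t => (x : ℝ≥0)) timeMeasure) := by
    refine ⟨?_⟩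
    rw [(MeasurableEmbedding.subtype_coe measurableSet_Iic).comap_apply, Set.image_univ,
      Subtype.range_coe, timeMeasure_Iic]
    exact ENNReal.ofReal_lt_top
  have h1 := @stronglyMeasurable_integral_left Ω (Set.Iic t) E (f t) _ _ _
    (Measure.comap (fun x : Set.Iic t => (x : ℝ≥0)) timeMeasure)
    (@instSFiniteOfSigmaFinite _ _ _ (@IsFiniteMeasure.toSigmaFinite _ _ _ hfin)) _
    (@Measurable.stronglyMeasurable _ _ (_) _ _ _ _ _ _ (hφ t))
  have h2 : runInt φ t = fun ω => ∫ s : Set.Iic t, φ s ω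
      ∂(Measure.comap (fun x : Set.Iic t => (x : ℝ≥0)) timeMeasure) := by
    funext ω
    exact (integral_subtype_comap measurableSet_Iic (fun s => φ s ω)).symm
  rw [h2]
  exact h1.measurable

namespace Noise

variable {n d : ℕ} {Ω : Type*} [mΩ : MeasurableSpace Ω] {P : Measure Ω}
  {N : Noise n d P} {T : ℝ≥0}

theorem aestronglyMeasurable_control_agent {α : ℝ≥0 → Ω → Conf n d}
    (hα : N.IsDistributedControl T α) (i : Fin n) (t : ℝ≥0) :
    AEStronglyMeasurable[N.agentSigma i] (fun ω => α t ω i) P :=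
  (((hα.1 i).adapted t).mono (N.agentFiltration_le_agentSigma i t)
    le_rfl).stronglyMeasurable.aestronglyMeasurable

theorem IsDistributedControl.add_smul {α φ : ℝ≥0 → Ω → Conf n d}
    (hα : N.IsDistributedControl T α) (hφ : N.IsDistributedControl T φ) (ε : ℝ) :
    N.IsDistributedControl T (fun t ω => α t ω + ε • φ t ω) :=
  ⟨fun i t => ((hα.1 i) t).add ((hφ.1 i t).const_smul ε), hα.2.add (hφ.2.const_smul ε)⟩

theorem IsDistributedControl.isFullControl {α : ℝ≥0 → Ω → Conf n d}
    (hα : N.IsDistributedControl T α) : N.IsFullControl T α := by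
  refine ⟨fun t => measurable_conf_iff.2 fun i k => ?_, hα.2⟩
  have h1 := (hα.1 i t).mono
    (sup_le_sup_left (MeasurableSpace.comap_mono (N.agentFiltration_le_fullFiltration i t)) _)
    le_rfl
  exact measurable_vec_iff.1 h1 k

theorem integral_sq_norm_eq_sum {η : Ω → Conf n d} (hη : MemLp η 2 P) :
    ∫ ω, ‖η ω‖ ^ 2 ∂P = ∑ i, ∑ l, ∫ ω, η ω i l ^ 2 ∂P := by
  have h : ∀ i l, Integrable (fun ω => η ω i l ^ 2) P := fun i l =>
    (memLp_vec_iff.1 (memLp_conf_iff.1 hη i) l).integrable_sq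
  simp only [← sum_sq_coord]
  rw [integral_finsetSum _ fun i _ => integrable_finsetSum _ fun l _ => h i l]
  simp only [fun i => integral_finsetSum _ fun l (_ : l ∈ Finset.univ) => h i l]

variable [IsProbabilityMeasure P]

theorem runInt_apply_ae {φ : ℝ≥0 → Ω → Conf n d} (hφ : SquareIntegrable P T φ) (i : Fin n) :
    ∀ᵐ ω ∂P, ∀ t ≤ T, runInt φ t ω i = runInt (fun s ω => φ s ω i) t ω := by
  filter_upwards [ae_memLp_path hφ] with ω hω t ht
  have hle := Measure.restrict_mono_set timeMeasure (Set.Iic_subset_Iic.2 ht)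
  exact ((PiLp.proj 2 (fun _ : Fin n => Vec d) i : Conf n d →L[ℝ] Vec d).integral_comp_comm
    ((hω.integrable one_le_two).mono_measure hle)).symm

theorem runInt_apply_apply_ae {φ : ℝ≥0 → Ω → Conf n d} (hφ : SquareIntegrable P T φ)
    (i : Fin n) (l : Fin d) :
    ∀ᵐ ω ∂P, ∀ t ≤ T, runInt φ t ω i l = runInt (fun s ω => φ s ω i l) t ω := by
  filter_upwards [ae_memLp_path hφ] with ω hω t ht
  have hle := Measure.restrict_mono_set timeMeasure (Set.Iic_subset_Iic.2 ht)
  exact (((EuclideanSpace.proj l : Vec d →L[ℝ] ℝ).comp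
    (PiLp.proj 2 (fun _ : Fin n => Vec d) i : Conf n d →L[ℝ] Vec d)).integral_comp_comm
    ((hω.integrable one_le_two).mono_measure hle)).symm

/-- Under a distributed control, the state of agent `i` only depends on his own noise. -/
theorem aestronglyMeasurable_state_agent {α : ℝ≥0 → Ω → Conf n d}
    (hα : N.IsDistributedControl T α) (i : Fin n) {t : ℝ≥0} (ht : t ≤ T) :
    AEStronglyMeasurable[N.agentSigma i] (fun ω => N.state α t ω i) P := by
  have hle := N.agentFiltration_le_agentSigma i t
  have h1 : Measurable[N.agentFiltration i t] fun ω => N.ξ ω i :=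
    (comap_measurable _).mono (le_sup_left.trans le_sup_left) le_rfl
  have h2 : Measurable[N.agentFiltration i t] (runInt (fun s ω => α s ω i) t) :=
    measurable_runInt_of_isProgressive (hα.1 i) t
  have h3 : Measurable[N.agentFiltration i t] fun ω => N.W t ω i :=
    (comap_measurable _).mono ((le_iSup₂ (f := fun s (_ : s ≤ t) =>
      MeasurableSpace.comap (fun ω => N.W s ω i) inferInstance) t le_rfl).trans
        (le_sup_right.trans le_sup_left)) le_rfl
  refine ⟨_, (((h1.add h2).add h3).mono hle le_rfl).stronglyMeasurable, ?_⟩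
  filter_upwards [runInt_apply_ae hα.2 i] with ω hω
  rw [state_eq, PiLp.add_apply, PiLp.add_apply, hω t ht]
  rfl

/-- Under a distributed control, the states of the agents are independent. -/
theorem iIndepFun_state {α : ℝ≥0 → Ω → Conf n d} (hα : N.IsDistributedControl T α) {t : ℝ≥0}
    (ht : t ≤ T) : iIndepFun (fun i ω => N.state α t ω i) P := by
  have h := fun i => aestronglyMeasurable_state_agent hα i ht
  have hm : iIndepFun (fun i => (h i).mk) P :=
    iIndep_mono (fun i => (h i).stronglyMeasurable_mk.measurable.comap_le) N.iIndep_agentSigma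
  exact hm.congr fun i => (h i).ae_eq_mk.symm

/-! ### The first-order condition for the distributed problem -/

/-- A quadratic polynomial without constant term that is nonnegative has no linear term. -/
theorem eq_zero_of_forall_nonneg {a b : ℝ} (h : ∀ ε : ℝ, 0 ≤ ε * a + ε ^ 2 * b) : a = 0 := by
  have hb : 0 ≤ b := by
    have h1 := h 1
    have h2 := h (-1)
    linarith
  have := h (-a / (b + 1))
  have e : -a / (b + 1) * a + (-a / (b + 1)) ^ 2 * b = -a ^ 2 / (b + 1) ^ 2 := by
    field_simp; ring
  rw [e, neg_div, neg_nonneg] at this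
  have h2 : 0 ≤ a ^ 2 / (b + 1) ^ 2 := by positivity
  have h3 : a ^ 2 / (b + 1) ^ 2 = 0 := le_antisymm this h2
  rcases div_eq_zero_iff.1 h3 with h | h
  · exact pow_eq_zero_iff (two_ne_zero) |>.1 h
  · have : (b + 1) ^ 2 > 0 := by positivity
    exact absurd h this.ne'

variable {L : Fin n → Vec d × Vec d → ℝ} {F G : Conf n d → ℝ} {α : ℝ≥0 → Ω → Conf n d}

/-- The first-order condition: the derivative of the cost at the distributed optimum vanishes on
distributed controls. -/
theorem costDeriv_eq_zero (hL : ∀ i, C2BoundedHess (L i)) (hF : C2BoundedHess F)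
    (hG : C2BoundedHess G) (hα : N.IsDistributedOptimal T L F G α) {φ : ℝ≥0 → Ω → Conf n d}
    (hφ : N.IsDistributedControl T φ) : N.costDeriv T L F G α φ = 0 := by
  obtain ⟨M, hM⟩ := cost_upper (N := N) hL hF hG hα.1.2
  refine eq_zero_of_forall_nonneg (b := M * energy P T φ) fun ε => ?_
  have hβ := hα.1.add_smul hφ ε
  have h1 := hM _ hβ.2
  have h2 := hα.2 _ hβ
  simp only [add_sub_cancel_left] at h1
  rw [costDeriv_smul] at h1
  have h3 : energy P T (fun t ω => ε • φ t ω) = ε ^ 2 * energy P T φ := by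
    simp only [energy, norm_smul, mul_pow, Real.norm_eq_abs, sq_abs, integral_const_mul]
  rw [h3] at h1
  linarith

/-! ### Directions orthogonal to the agents' information -/

/-- The component `χ^i_s` is orthogonal to all random variables known to agent `i`. -/
def IsAgentOrthogonal (N : Noise n d P) (χ : ℝ≥0 → Ω → Conf n d) : Prop :=
  ∀ (s : ℝ≥0) (i : Fin n) (l : Fin d) (g : Ω → ℝ), AEStronglyMeasurable[N.agentSigma i] g P →
    MemLp g 2 P → ∫ ω, g ω * χ s ω i l ∂P = 0

theorem IsAgentOrthogonal.runInt {χ : ℝ≥0 → Ω → Conf n d} (h : N.IsAgentOrthogonal χ)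
    (hχ : SquareIntegrable P T χ) {t : ℝ≥0} (ht : t ≤ T) (i : Fin n) (l : Fin d) {g : Ω → ℝ}
    (hg : AEStronglyMeasurable[N.agentSigma i] g P) (hg2 : MemLp g 2 P) :
    ∫ ω, g ω * DistributedControl.runInt χ t ω i l ∂P = 0 := by
  have hle : controlMeasure P t ≤ controlMeasure P T :=
    Measure.prod_mono (Measure.restrict_mono_set timeMeasure (Set.Iic_subset_Iic.2 ht)) le_rfl
  have hχ' : MemLp (fun p : ℝ≥0 × Ω => χ p.1 p.2 i l) 2 (controlMeasure P t) :=
    (memLp_vec_iff.1 (memLp_conf_iff.1 hχ i) l).mono_measure hle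
  have hint : Integrable (fun p : ℝ≥0 × Ω => g p.2 * χ p.1 p.2 i l) (controlMeasure P t) :=
    (hg2.comp_snd _).integrable_mul hχ'
  have e1 : ∫ ω, g ω * DistributedControl.runInt χ t ω i l ∂P =
      ∫ ω, (∫ s in Set.Iic t, g ω * χ s ω i l ∂timeMeasure) ∂P := by
    refine integral_congr_ae ?_
    filter_upwards [runInt_apply_apply_ae hχ i l] with ω hω
    rw [hω t ht, DistributedControl.runInt, integral_const_mul]
  rw [e1, ← integral_prod_symm _ hint, integral_prod _ hint]
  simp only [h _ i l g hg hg2, integral_zero]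

theorem conf_eq_sum (x : Conf n d) : x = ∑ i, ∑ l, x i l • unitVec i l := by
  ext j k
  simp only [WithLp.ofLp_sum, Finset.sum_apply, WithLp.ofLp_smul, Pi.smul_apply, smul_eq_mul,
    unitVec_apply]
  simp

theorem fderiv_conf_apply (u : Conf n d → ℝ) (z v : Conf n d) :
    fderiv ℝ u z v = ∑ i, ∑ l, fderiv ℝ u z (unitVec i l) * v i l := by
  conv_lhs => rw [conf_eq_sum v]
  simp only [map_sum, map_smul, smul_eq_mul, mul_comm]

theorem vec_eq_sum (x : Vec d) : x = ∑ l, x l • EuclideanSpace.single l (1 : ℝ) := by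
  ext k
  simp [Pi.single_apply]

/-- The components of the Lagrangian part of the derivative of the cost are known to the respective
agents, so this part vanishes in orthogonal directions. -/
theorem integral_fderiv_lagrangian_eq_zero (hL : ∀ i, C2BoundedHess (L i))
    (hα : N.IsDistributedControl T α) {χ : ℝ≥0 → Ω → Conf n d} (h : N.IsAgentOrthogonal χ)
    (hχ : SquareIntegrable P T χ) (i : Fin n) :
    ∫ p, fderiv ℝ (L i) (N.state α p.1 p.2 i, α p.1 p.2 i)
      (runInt χ p.1 p.2 i, χ p.1 p.2 i) ∂controlMeasure P T = 0 := by
  rw [integral_prod _ (integrable_fderiv_apply (hL i) (memLp_state_control hα.2 i)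
    (memLp_runInt_control hχ i))]
  refine integral_eq_zero_of_ae ?_
  have hT : ∀ᵐ s ∂timeMeasure.restrict (Set.Iic T), s ≤ T := ae_restrict_mem measurableSet_Iic
  filter_upwards [hT, ae_memLp_section hα.2, ae_memLp_section hχ] with s hs hαs hχs
  have hq : MemLp (fun ω => (N.state α s ω i, α s ω i)) 2 P :=
    memLp_two_prodMk (memLp_conf_iff.1 (memLp_state_section hα.2 hs) i) (memLp_conf_iff.1 hαs i)
  have hqm : AEStronglyMeasurable[N.agentSigma i] (fun ω => (N.state α s ω i, α s ω i)) P :=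
    (aestronglyMeasurable_state_agent hα i hs).prodMk (aestronglyMeasurable_control_agent hα i s)
  have hDc : Continuous (fderiv ℝ (L i)) := (hL i).1.continuous_fderiv (by norm_num)
  have hg : ∀ e : Vec d × Vec d,
      AEStronglyMeasurable[N.agentSigma i]
        (fun ω => fderiv ℝ (L i) (N.state α s ω i, α s ω i) e) P ∧
      MemLp (fun ω => fderiv ℝ (L i) (N.state α s ω i, α s ω i) e) 2 P := fun e =>
    ⟨(hDc.clm_apply continuous_const).comp_aestronglyMeasurable hqm,
      ((ContinuousLinearMap.apply ℝ ℝ e).comp_memLp' (memLp_fderiv (hL i) hq))⟩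
  have hV := (memLp_runInt_section hχ hs).1
  have e1 : ∀ ω, fderiv ℝ (L i) (N.state α s ω i, α s ω i) (runInt χ s ω i, χ s ω i) =
      ∑ l, (fderiv ℝ (L i) (N.state α s ω i, α s ω i) (EuclideanSpace.single l 1, 0) *
          runInt χ s ω i l +
        fderiv ℝ (L i) (N.state α s ω i, α s ω i) (0, EuclideanSpace.single l 1) * χ s ω i l) :=
    fun ω => by
      have e : (runInt χ s ω i, χ s ω i) = ∑ l, (runInt χ s ω i l •
          ((EuclideanSpace.single l 1, 0) : Vec d × Vec d) +
          χ s ω i l • ((0, EuclideanSpace.single l 1) : Vec d × Vec d)) := by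
        conv_lhs => rw [vec_eq_sum (runInt χ s ω i), vec_eq_sum (χ s ω i)]
        simp [Prod.ext_iff, Prod.fst_sum, Prod.snd_sum]
      rw [e, map_sum]
      refine Finset.sum_congr rfl fun l _ => ?_
      rw [map_add, map_smul, map_smul, smul_eq_mul, smul_eq_mul, mul_comm, mul_comm (χ s ω i l)]
  have hi1 : ∀ l, Integrable (fun ω =>
      fderiv ℝ (L i) (N.state α s ω i, α s ω i) (EuclideanSpace.single l 1, 0) *
        runInt χ s ω i l) P := fun l =>
    (hg _).2.integrable_mul (memLp_vec_iff.1 (memLp_conf_iff.1 hV i) l)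
  have hi2 : ∀ l, Integrable (fun ω =>
      fderiv ℝ (L i) (N.state α s ω i, α s ω i) (0, EuclideanSpace.single l 1) *
        χ s ω i l) P := fun l =>
    (hg _).2.integrable_mul (memLp_vec_iff.1 (memLp_conf_iff.1 hχs i) l)
  simp only [e1, Pi.zero_apply]
  have hi : ∀ l, Integrable (fun ω =>
      fderiv ℝ (L i) (N.state α s ω i, α s ω i) (EuclideanSpace.single l 1, 0) *
        runInt χ s ω i l +
      fderiv ℝ (L i) (N.state α s ω i, α s ω i) (0, EuclideanSpace.single l 1) *
        χ s ω i l) P := fun l => (hi1 l).add (hi2 l)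
  rw [integral_finsetSum _ fun l _ => hi l]
  refine Finset.sum_eq_zero fun l _ => ?_
  rw [integral_add (hi1 l) (hi2 l), h.runInt hχ hs i l (hg _).1 (hg _).2,
    h s i l _ (hg _).1 (hg _).2, add_zero]

/-- The sum of the squared sup norms of the off-diagonal blocks of the Hessian of `u`. -/
def offDiagSum (u : Conf n d → ℝ) : ℝ :=
  ∑ i, ∑ j ∈ Finset.univ.erase i, blockSupNorm u i j ^ 2

/-- At a fixed time, the pairing of the gradient of an interaction cost with an orthogonal direction
only sees the conditional fluctuations of the gradient, which the Poincaré inequality controls by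
the off-diagonal blocks of the Hessian. -/
theorem abs_integral_fderiv_le_of_orthogonal {u : Conf n d → ℝ} {c C_P : ℝ}
    (hu : CostAssumption u c) (hα : N.IsDistributedControl T α) {t : ℝ≥0} (ht : t ≤ T)
    (hP : Poincare (P.map (N.state α t)) C_P) {V : Ω → Conf n d} (hV : MemLp V 2 P)
    (horth : ∀ (i : Fin n) (l : Fin d) (g : Ω → ℝ), AEStronglyMeasurable[N.agentSigma i] g P →
      MemLp g 2 P → ∫ ω, g ω * V ω i l ∂P = 0) {r : ℝ} (hr : 0 < r) :
    |∫ ω, fderiv ℝ u (N.state α t ω) (V ω) ∂P| ≤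
      r / 2 * (|C_P| * offDiagSum u) + 1 / (2 * r) * ∫ ω, ‖V ω‖ ^ 2 ∂P := by
  have hX := memLp_state_section (N := N) hα.2 ht
  have hXm : AEMeasurable (N.state α t) P := hX.1.aemeasurable
  choose f hfm hfB hfle using fun i l =>
    exists_coordinate_approx hXm (iIndepFun_state hα ht) hu.c2 hu.bddGrad hP i l
  have hD : ∀ i l, MemLp (fun ω => fderiv ℝ u (N.state α t ω) (unitVec i l)) 2 P := fun i l =>
    (ContinuousLinearMap.apply ℝ ℝ (unitVec i l)).comp_memLp' (memLp_fderiv hu.c2 hX)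
  have hfa : ∀ i l, AEStronglyMeasurable[N.agentSigma i] (fun ω => f i l (N.state α t ω i)) P :=
    fun i l => by
      have h := aestronglyMeasurable_state_agent hα i ht
      exact ⟨fun ω => f i l (h.mk _ ω),
        ((hfm i l).comp h.stronglyMeasurable_mk.measurable).stronglyMeasurable,
        h.ae_eq_mk.mono fun ω hω => by simp only [hω]⟩
  have hf2 : ∀ i l, MemLp (fun ω => f i l (N.state α t ω i)) 2 P := fun i l => by
    obtain ⟨B, hB⟩ := hfB i l
    exact MemLp.of_bound ((hfa i l).mono (N.agentSigma_le i)) B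
      (Filter.Eventually.of_forall fun ω => hB _)
  have hVc : ∀ i l, MemLp (fun ω => V ω i l) 2 P := fun i l =>
    memLp_vec_iff.1 (memLp_conf_iff.1 hV i) l
  have hterm : ∀ i l, |∫ ω, fderiv ℝ u (N.state α t ω) (unitVec i l) * V ω i l ∂P| ≤
      r / 2 * (|C_P| * ∫ ω, crossGradSq u i l (N.state α t ω) ∂P) +
        1 / (2 * r) * ∫ ω, V ω i l ^ 2 ∂P := fun i l => by
    have hR : MemLp (fun ω => fderiv ℝ u (N.state α t ω) (unitVec i l) -
        f i l (N.state α t ω i)) 2 P := (hD i l).sub (hf2 i l)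
    have hDV : Integrable (fun ω => fderiv ℝ u (N.state α t ω) (unitVec i l) * V ω i l) P :=
      (hD i l).integrable_mul (hVc i l)
    have hfV : Integrable (fun ω => f i l (N.state α t ω i) * V ω i l) P :=
      (hf2 i l).integrable_mul (hVc i l)
    have hRV : Integrable (fun ω => |(fderiv ℝ u (N.state α t ω) (unitVec i l) -
        f i l (N.state α t ω i)) * V ω i l|) P := (hR.integrable_mul (hVc i l)).abs
    have e : ∫ ω, fderiv ℝ u (N.state α t ω) (unitVec i l) * V ω i l ∂P =
        ∫ ω, (fderiv ℝ u (N.state α t ω) (unitVec i l) - f i l (N.state α t ω i)) * V ω i l ∂P := by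
      simp only [sub_mul]
      rw [integral_sub hDV hfV, horth i l _ (hfa i l) (hf2 i l), sub_zero]
    rw [e]
    refine abs_integral_le_integral_abs.trans ?_
    have hRi : Integrable (fun ω => r / 2 * (fderiv ℝ u (N.state α t ω) (unitVec i l) -
        f i l (N.state α t ω i)) ^ 2) P := hR.integrable_sq.const_mul (r / 2)
    have hVi : Integrable (fun ω => 1 / (2 * r) * V ω i l ^ 2) P :=
      (hVc i l).integrable_sq.const_mul (1 / (2 * r))
    refine (integral_mono (g := fun ω => r / 2 * (fderiv ℝ u (N.state α t ω) (unitVec i l) -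
        f i l (N.state α t ω i)) ^ 2 + 1 / (2 * r) * V ω i l ^ 2)
      hRV (hRi.add hVi) fun ω => ?_).trans ?_
    · -- Young's inequality
      set a := fderiv ℝ u (N.state α t ω) (unitVec i l) - f i l (N.state α t ω i)
      set b := V ω i l
      have h1 : 0 ≤ (r * |a| - |b|) ^ 2 / (2 * r) := by positivity
      have h2 : (r * |a| - |b|) ^ 2 / (2 * r) =
          r / 2 * |a| ^ 2 + 1 / (2 * r) * |b| ^ 2 - |a| * |b| := by
        field_simp; ring
      change |a * b| ≤ r / 2 * a ^ 2 + 1 / (2 * r) * b ^ 2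
      rw [abs_mul, ← sq_abs a, ← sq_abs b]
      linarith
    · rw [integral_add hRi hVi, integral_const_mul,
        integral_const_mul]
      exact add_le_add (mul_le_mul_of_nonneg_left (hfle i l) (by positivity)) le_rfl
  have hexp : ∀ ω, fderiv ℝ u (N.state α t ω) (V ω) =
      ∑ i, ∑ l, fderiv ℝ u (N.state α t ω) (unitVec i l) * V ω i l := fun ω =>
    fderiv_conf_apply u (N.state α t ω) (V ω)
  rw [integral_congr_ae (Filter.Eventually.of_forall hexp)]
  have hi : ∀ i l, Integrable (fun ω => fderiv ℝ u (N.state α t ω) (unitVec i l) * V ω i l) P :=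
    fun i l => (hD i l).integrable_mul (hVc i l)
  rw [integral_finsetSum _ fun i _ => integrable_finsetSum _ fun l _ => hi i l]
  simp only [fun i => integral_finsetSum _ fun l (_ : l ∈ Finset.univ) => hi i l]
  have hsum : |∑ i, ∑ l, ∫ ω, fderiv ℝ u (N.state α t ω) (unitVec i l) * V ω i l ∂P| ≤
      ∑ i, ∑ l, (r / 2 * (|C_P| * ∫ ω, crossGradSq u i l (N.state α t ω) ∂P) +
        1 / (2 * r) * ∫ ω, V ω i l ^ 2 ∂P) :=
    (Finset.abs_sum_le_sum_abs _ _).trans (Finset.sum_le_sum fun i _ =>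
      (Finset.abs_sum_le_sum_abs _ _).trans (Finset.sum_le_sum fun l _ => hterm i l))
  refine hsum.trans ?_
  simp only [Finset.sum_add_distrib, ← Finset.mul_sum]
  have hcross : ∑ i, ∑ l, ∫ ω, crossGradSq u i l (N.state α t ω) ∂P ≤ offDiagSum u := by
    refine Finset.sum_le_sum fun i _ => ?_
    obtain ⟨K, hK⟩ := hu.c2.2
    have hci : ∀ l, Integrable (fun ω => crossGradSq u i l (N.state α t ω)) P := fun l => by
      refine (integrable_const (∑ j ∈ Finset.univ.erase i, blockSupNorm u i j ^ 2)).mono'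
        ((continuous_crossGradSq hu.c2.1 i l).comp_aestronglyMeasurable hX.1)
        (Filter.Eventually.of_forall fun ω => ?_)
      rw [Real.norm_of_nonneg (crossGradSq_nonneg _ _ _ _)]
      exact (Finset.single_le_sum (f := fun l => crossGradSq u i l (N.state α t ω))
        (fun _ _ => crossGradSq_nonneg _ _ _ _) (Finset.mem_univ l)).trans
        (sum_crossGradSq_le hu.c2 i _)
    rw [← integral_finsetSum _ fun l _ => hci l]
    have := integral_mono (integrable_finsetSum _ fun l _ => hci l)
      (integrable_const (∑ j ∈ Finset.univ.erase i, blockSupNorm u i j ^ 2))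
      (fun ω => sum_crossGradSq_le hu.c2 i (N.state α t ω))
    simpa using this
  rw [← integral_sq_norm_eq_sum hV]
  gcongr

/-- Bound on the derivative of the cost in orthogonal directions, by Young's inequality with a free
parameter `r`. -/
theorem abs_costDeriv_le_of_orthogonal {C_P C_F C_G : ℝ} (hL : ∀ i, C2BoundedHess (L i))
    (hF : CostAssumption F C_F) (hG : CostAssumption G C_G) (hα : N.IsDistributedControl T α)
    (hP : ∀ t ≤ T, Poincare (P.map (N.state α t)) C_P) {χ : ℝ≥0 → Ω → Conf n d}
    (h : N.IsAgentOrthogonal χ) (hχ : SquareIntegrable P T χ) {r : ℝ} (hr : 0 < r) :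
    |N.costDeriv T L F G α χ| ≤
      r / 2 * (|C_P| * (T * offDiagSum F + offDiagSum G)) +
        1 / (2 * r) * (((T : ℝ) ^ 2 / 2 + T) * energy P T χ) := by
  obtain ⟨hY, hYe⟩ := memLp_runInt hχ
  obtain ⟨hYT, hYTe⟩ := memLp_runInt_section hχ le_rfl
  change _ ≤ _ * energy P T χ at hYe hYTe
  have hGt := abs_integral_fderiv_le_of_orthogonal hG hα le_rfl (hP T le_rfl) hYT
    (fun i l g hg hg2 => h.runInt hχ le_rfl i l hg hg2) hr
  have hFt : |∫ p, fderiv ℝ F (N.state α p.1 p.2) (runInt χ p.1 p.2) ∂controlMeasure P T| ≤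
      r / 2 * (|C_P| * offDiagSum F) * T +
        1 / (2 * r) * ∫ p, ‖runInt χ p.1 p.2‖ ^ 2 ∂controlMeasure P T := by
    have hi := integrable_fderiv_apply hF.c2 (memLp_state (N := N) hα.2) hY
    have hi2 := integrable_sq_norm_of_memLp hY
    rw [integral_prod _ hi, integral_prod _ hi2]
    refine abs_integral_le_integral_abs.trans ?_
    refine (integral_mono_ae (g := fun s => r / 2 * (|C_P| * offDiagSum F) +
        1 / (2 * r) * ∫ ω, ‖runInt χ s ω‖ ^ 2 ∂P) hi.integral_prod_left.abs
      ((integrable_const _).add (hi2.integral_prod_left.const_mul _)) ?_).trans (le_of_eq ?_)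
    · have hT : ∀ᵐ s ∂timeMeasure.restrict (Set.Iic T), s ≤ T := ae_restrict_mem measurableSet_Iic
      filter_upwards [hT] with s hs
      exact abs_integral_fderiv_le_of_orthogonal hF hα hs (hP s hs)
        (memLp_runInt_section hχ hs).1 (fun i l g hg hg2 => h.runInt hχ hs i l hg hg2) hr
    · rw [integral_add (integrable_const _) (hi2.integral_prod_left.const_mul _), integral_const,
        measureReal_timeMeasure_Iic, integral_const_mul, smul_eq_mul, mul_comm (T : ℝ)]
  rw [costDeriv, Finset.sum_eq_zero fun i _ => integral_fderiv_lagrangian_eq_zero hL hα h hχ i,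
    mul_zero, zero_add]
  refine (abs_add_le _ _).trans ((add_le_add hFt hGt).trans ?_)
  have h1 : 1 / (2 * r) * (∫ p, ‖runInt χ p.1 p.2‖ ^ 2 ∂controlMeasure P T +
      ∫ ω, ‖runInt χ T ω‖ ^ 2 ∂P) ≤
      1 / (2 * r) * (((T : ℝ) ^ 2 / 2 + T) * energy P T χ) :=
    mul_le_mul_of_nonneg_left (by linarith) (by positivity)
  linarith

end Noise

/-! ### Step processes -/

/-- The process equal to `ψ k` on the time interval `[k h, (k + 1) h)`. -/
def stepPath {Ω E : Type*} (h : ℝ≥0) (ψ : ℕ → Ω → E) (t : ℝ≥0) (ω : Ω) : E := ψ ⌊t / h⌋₊ ω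

theorem measurable_floor_div (h : ℝ≥0) : Measurable fun t : ℝ≥0 => ⌊t / h⌋₊ :=
  (measurable_id.div_const h).nat_floor

theorem measurable_uncurry_nat {S Ω E : Type*} [MeasurableSpace S] {m : MeasurableSpace Ω}
    [MeasurableSpace E] {N : S → ℕ} (hN : Measurable N) {ψ : ℕ → Ω → E}
    (hψ : ∀ k, Measurable (ψ k)) : Measurable fun p : S × Ω => ψ (N p.1) p.2 := by
  have h1 : Measurable fun q : Ω × ℕ => ψ q.2 q.1 := measurable_from_prod_countable_left hψ
  exact h1.comp (measurable_snd.prodMk (hN.comp measurable_fst))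

theorem isProgressive_stepPath {Ω E : Type*} [mΩ : MeasurableSpace Ω] [Zero E]
    [MeasurableSpace E] {f : Filtration ℝ≥0 mΩ} {h : ℝ≥0} (hh : 0 < h) {ψ : ℕ → Ω → E}
    (hψ : ∀ k : ℕ, Measurable[f (k * h)] (ψ k)) : IsProgressive f (stepPath h ψ) := by
  intro t
  classical
  -- the values after time `t` are not used on `[0, t]`
  have h1 : ∀ k : ℕ, Measurable[f t] (if k * h ≤ t then ψ k else fun _ => 0) := fun k => by
    split_ifs with hk
    · exact (hψ k).mono (f.mono hk) le_rfl
    · exact measurable_const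
  have h2 := @measurable_uncurry_nat (Set.Iic t) Ω E _ (f t) _ (fun s => ⌊(s : ℝ≥0) / h⌋₊)
    ((measurable_floor_div h).comp measurable_subtype_coe) _ h1
  have h3 : (fun p : Set.Iic t × Ω => stepPath h ψ p.1 p.2) = fun p : Set.Iic t × Ω =>
      (if ⌊(p.1 : ℝ≥0) / h⌋₊ * h ≤ t then ψ ⌊(p.1 : ℝ≥0) / h⌋₊ else fun _ => 0) p.2 := by
    funext p
    have hp : (⌊(p.1 : ℝ≥0) / h⌋₊ : ℝ≥0) * h ≤ t :=
      ((le_div_iff₀ hh).1 (Nat.floor_le zero_le)).trans p.1.2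
    rw [if_pos hp, stepPath]
  rw [h3]
  exact h2

theorem memLp_stepPath {Ω E : Type*} [mΩ : MeasurableSpace Ω] {P : Measure Ω}
    [IsProbabilityMeasure P] [NormedAddCommGroup E] {T h : ℝ≥0} {ψ : ℕ → Ω → E}
    (hψ : ∀ k, MemLp (ψ k) 2 P) :
    MemLp (fun p : ℝ≥0 × Ω => stepPath h ψ p.1 p.2) 2 (controlMeasure P T) := by
  have h1 : MemLp (fun p : ℝ≥0 × Ω => ∑ k ∈ Finset.range (⌊T / h⌋₊ + 1),
      {q : ℝ≥0 × Ω | ⌊q.1 / h⌋₊ = k}.indicator (fun q => ψ k q.2) p) 2 (controlMeasure P T) :=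
    memLp_finsetSum _ fun k _ => ((hψ k).comp_snd _).indicator
      (((measurable_floor_div h).comp measurable_fst) (measurableSet_singleton k))
  refine h1.ae_eq ?_
  filter_upwards [ae_controlMeasure_of_ae (T := T) (Filter.Eventually.of_forall (f := ae P)
    fun ω => trivial)] with p hp
  have hk : ⌊p.1 / h⌋₊ ∈ Finset.range (⌊T / h⌋₊ + 1) :=
    Finset.mem_range_succ_iff.2 (Nat.floor_mono (div_le_div_of_nonneg_right hp.1 zero_le))
  rw [Finset.sum_eq_single_of_mem _ hk]
  · rw [Set.indicator_of_mem (by exact rfl), stepPath]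
  · intro k _ hne
    exact Set.indicator_of_notMem (s := {q : ℝ≥0 × Ω | ⌊q.1 / h⌋₊ = k})
      (fun h => hne (Eq.symm h)) _

/-! ### Projection on distributed controls -/

theorem integral_sq_sub_condExp_le {Ω : Type*} {m mΩ : MeasurableSpace Ω} {P : Measure Ω}
    [IsProbabilityMeasure P] (hm : m ≤ mΩ) {η : Ω → ℝ} (hη : MemLp η 2 P) :
    ∫ ω, (η ω - P[η|m] ω) ^ 2 ∂P ≤ ∫ ω, η ω ^ 2 ∂P := by
  have hg : MemLp (P[η|m]) 2 P := hη.condExp one_le_two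
  have hv : MemLp (fun ω => η ω - P[η|m] ω) 2 P := hη.sub hg
  have hi := hη.integrable one_le_two
  have h0 : P[η - P[η|m]|m] =ᵐ[P] 0 := by
    have h1 := condExp_sub hi (integrable_condExp (m := m) (μ := P) (f := η)) m
    have h2 := condExp_condExp_of_le (μ := P) (f := η) le_rfl hm
    filter_upwards [h1, h2] with ω e1 e2
    rw [e1, Pi.sub_apply, e2, sub_self, Pi.zero_apply]
  have horth := integral_mul_eq_zero_of_condExp_eq_zero hm
    stronglyMeasurable_condExp.aestronglyMeasurable hg hv h0
  have hgv : Integrable (fun ω => 2 * (P[η|m] ω * (η ω - P[η|m] ω))) P :=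
    (hg.integrable_mul hv).const_mul 2
  have hvg : Integrable (fun ω => (η ω - P[η|m] ω) ^ 2 + 2 * (P[η|m] ω * (η ω - P[η|m] ω))) P :=
    hv.integrable_sq.add hgv
  have e : ∀ ω, η ω ^ 2 = ((η ω - P[η|m] ω) ^ 2 + 2 * (P[η|m] ω * (η ω - P[η|m] ω))) +
      P[η|m] ω ^ 2 := fun ω => by ring
  rw [integral_congr_ae (f := fun ω => η ω ^ 2) (Filter.Eventually.of_forall e),
    integral_add hvg hg.integrable_sq, integral_add hv.integrable_sq hgv, integral_const_mul,
    horth]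
  have : 0 ≤ ∫ ω, P[η|m] ω ^ 2 ∂P := integral_nonneg fun _ => sq_nonneg _
  linarith

namespace Noise

variable {n d : ℕ} {Ω : Type*} [mΩ : MeasurableSpace Ω] {P : Measure Ω} {N : Noise n d P} {T : ℝ≥0}

/-- The projection of a random vector on the vectors whose components are known to the respective
agents at time `t`. -/
def agentProj (N : Noise n d P) (t : ℝ≥0) (η : Ω → Conf n d) (ω : Ω) : Conf n d :=
  WithLp.toLp 2 fun i => WithLp.toLp 2 fun l => P[fun ω => η ω i l|N.agentFiltration i t] ω

theorem measurable_agentProj (t : ℝ≥0) (η : Ω → Conf n d) (i : Fin n) :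
    Measurable[N.agentFiltration i t] fun ω => N.agentProj t η ω i :=
  measurable_vec_iff.2 fun _ => stronglyMeasurable_condExp.measurable

theorem memLp_agentProj (t : ℝ≥0) {η : Ω → Conf n d} (hη : MemLp η 2 P) :
    MemLp (N.agentProj t η) 2 P :=
  memLp_conf_iff.2 fun i => memLp_vec_iff.2 fun k =>
    (memLp_vec_iff.1 (memLp_conf_iff.1 hη i) k).condExp one_le_two

variable [IsProbabilityMeasure P]

theorem integral_sq_norm_sub_agentProj_le (t : ℝ≥0) {η : Ω → Conf n d} (hη : MemLp η 2 P) :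
    ∫ ω, ‖η ω - N.agentProj t η ω‖ ^ 2 ∂P ≤ ∫ ω, ‖η ω‖ ^ 2 ∂P := by
  have hv : MemLp (fun ω => η ω - N.agentProj t η ω) 2 P := hη.sub (memLp_agentProj t hη)
  rw [integral_sq_norm_eq_sum hη, integral_sq_norm_eq_sum hv]
  exact Finset.sum_le_sum fun i _ => Finset.sum_le_sum fun l _ =>
    integral_sq_sub_condExp_le ((N.agentFiltration i).le t)
      (memLp_vec_iff.1 (memLp_conf_iff.1 hη i) l)

/-- A step process is the sum of a distributed control and of a process orthogonal to the agents'
information. -/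
theorem exists_distributed_of_stepPath {h : ℝ≥0} (hh : 0 < h) {ψ : ℕ → Ω → Conf n d}
    (hψm : ∀ k : ℕ, Measurable[N.fullFiltration (k * h)] (ψ k)) (hψ : ∀ k, MemLp (ψ k) 2 P) :
    ∃ φ : ℝ≥0 → Ω → Conf n d, N.IsDistributedControl T φ ∧
      N.IsAgentOrthogonal (fun t ω => stepPath h ψ t ω - φ t ω) ∧
      energy P T (fun t ω => stepPath h ψ t ω - φ t ω) ≤ energy P T (stepPath h ψ) := by
  have hφ := fun k : ℕ => memLp_agentProj (N := N) (k * h) (hψ k)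
  have hS := memLp_stepPath (P := P) (T := T) (h := h) hψ
  have hS' := memLp_stepPath (P := P) (T := T) (h := h) hφ
  refine ⟨stepPath h fun k => N.agentProj (k * h) (ψ k), ⟨fun i => ?_, hS'⟩, ?_, ?_⟩
  · exact isProgressive_stepPath hh (ψ := fun k ω => N.agentProj (k * h) (ψ k) ω i)
      fun k => measurable_agentProj _ _ i
  · intro s i l g hg hg2
    have hc := memLp_vec_iff.1 (memLp_conf_iff.1 (hψ ⌊s / h⌋₊) i) l
    exact integral_mul_eq_zero_of_condExp_eq_zero (N.agentSigma_le i) hg hg2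
      (hc.sub (hc.condExp one_le_two))
      (N.condExp_sub_condExp_agentFiltration i _
        (measurable_conf_iff.1 (hψm _) i l).stronglyMeasurable hc)
  · have hi1 : Integrable (fun p : ℝ≥0 × Ω => ‖stepPath h ψ p.1 p.2 -
        stepPath h (fun k : ℕ => N.agentProj (k * h) (ψ k)) p.1 p.2‖ ^ 2)
        (controlMeasure P T) := integrable_sq_norm_of_memLp (hS.sub hS')
    have hi2 := integrable_sq_norm_of_memLp hS
    rw [energy, energy, integral_prod _ hi1, integral_prod _ hi2]
    refine integral_mono hi1.integral_prod_left hi2.integral_prod_left fun s => ?_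
    exact integral_sq_norm_sub_agentProj_le (N := N) (⌊s / h⌋₊ * h) (hψ ⌊s / h⌋₊)

end Noise

/-! ### Approximation by step processes -/

section Approximation

variable {Ω E : Type*} [NormedAddCommGroup E]

theorem integrable_indicator_toNNReal {δ : ℝ≥0 → Ω → E} {ω : Ω} {T : ℝ≥0}
    (hδ : Integrable (fun s => δ s ω) (timeMeasure.restrict (Set.Iic T))) :
    Integrable ((Set.Icc (0 : ℝ) T).indicator fun x => δ x.toNNReal ω) volume := by
  rw [integrable_indicator_iff measurableSet_Icc]
  have h1 := measurableEmbedding_coe_nnreal.integrableOn_map_iff (μ := timeMeasure)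
    (f := fun x => δ x.toNNReal ω) (s := Set.Icc 0 (T : ℝ))
  have h2 : ((↑) : ℝ≥0 → ℝ) ⁻¹' Set.Icc 0 (T : ℝ) = Set.Iic T := by
    ext x; simp
  have h3 : (fun x : ℝ => δ x.toNNReal ω) ∘ ((↑) : ℝ≥0 → ℝ) = fun s => δ s ω := by
    funext s; simp
  have h4 : Set.Icc 0 (T : ℝ) ∩ Set.Ici 0 = Set.Icc 0 (T : ℝ) :=
    Set.inter_eq_left.2 fun x hx => hx.1
  rw [map_timeMeasure, h2, h3, IntegrableOn, IntegrableOn,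
    Measure.restrict_restrict measurableSet_Icc, h4] at h1
  exact h1.2 hδ

variable [NormedSpace ℝ E]

/-- The average of a process over the time interval `[(k - 1) h, k h]`, and zero for `k = 0`. On the
interval `[k h, (k + 1) h)`, where the step process takes the value of index `k`, this is known. -/
def pastAverage (h : ℝ≥0) (δ : ℝ≥0 → Ω → E) : ℕ → Ω → E
  | 0, _ => 0
  | k + 1, ω => (h : ℝ)⁻¹ • (runInt δ ((k + 1 : ℕ) * h) ω - runInt δ (k * h) ω)

theorem measurable_pastAverage [mΩ : MeasurableSpace Ω] [MeasurableSpace E] [BorelSpace E]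
    [SecondCountableTopology E] {f : Filtration ℝ≥0 mΩ} {δ : ℝ≥0 → Ω → E}
    (hδ : IsProgressive f δ) (h : ℝ≥0) (k : ℕ) : Measurable[f (k * h)] (pastAverage h δ k) := by
  cases k with
  | zero => exact measurable_const
  | succ k =>
    refine Measurable.const_smul (Measurable.sub (measurable_runInt_of_isProgressive hδ _) ?_) _
    refine (measurable_runInt_of_isProgressive hδ _).mono (f.mono ?_) le_rfl
    gcongr
    exact k.le_succ

theorem runInt_eq_intervalIntegral {δ : ℝ≥0 → Ω → E} {ω : Ω} {t T : ℝ≥0} (ht : t ≤ T) :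
    runInt δ t ω = ∫ x in (0 : ℝ)..t,
      (Set.Icc (0 : ℝ) T).indicator (fun x => δ x.toNNReal ω) x := by
  have h1 := setIntegral_timeMeasure_comp_coe (fun x => δ x.toNNReal ω) t
  simp only [Real.toNNReal_coe] at h1
  rw [runInt, h1, intervalIntegral.integral_of_le t.coe_nonneg, ← integral_Icc_eq_integral_Ioc]
  refine setIntegral_congr_fun measurableSet_Icc fun x hx => ?_
  exact (Set.indicator_of_mem (s := Set.Icc (0 : ℝ) T)
    ⟨hx.1, hx.2.trans (NNReal.coe_le_coe.2 ht)⟩ (fun x : ℝ => δ x.toNNReal ω)).symm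

/-- On the cell following it, the past average is an average over a ball whose triple contains the
current time. -/
theorem pastAverage_eq_average {δ : ℝ≥0 → Ω → E} {ω : Ω} {T h : ℝ≥0} (hh : 0 < h) {k : ℕ}
    (hk : (k + 1 : ℕ) * h ≤ T)
    (hδ : Integrable (fun s => δ s ω) (timeMeasure.restrict (Set.Iic T))) :
    pastAverage h δ (k + 1) ω = ⨍ x in Metric.closedBall (((k : ℝ) + 1 / 2) * h) ((h : ℝ) / 2),
      (Set.Icc (0 : ℝ) T).indicator (fun x => δ x.toNNReal ω) x := by
  have hg := integrable_indicator_toNNReal hδ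
  have hh' : (0 : ℝ) < h := hh
  have hk' : (k : ℝ≥0) * h ≤ T := le_trans (by gcongr; exact k.le_succ) hk
  rw [setAverage_eq, Real.volume_real_closedBall (by positivity), Real.closedBall_eq_Icc,
    integral_Icc_eq_integral_Ioc, ← intervalIntegral.integral_of_le (by linarith),
    pastAverage, runInt_eq_intervalIntegral hk, runInt_eq_intervalIntegral hk',
    intervalIntegral.integral_interval_sub_left hg.intervalIntegrable hg.intervalIntegrable]
  push_cast
  congr 2 <;> ring

/-- Lebesgue differentiation along a path. -/
theorem ae_tendsto_stepPath_pastAverage [CompleteSpace E] {δ : ℝ≥0 → Ω → E} {ω : Ω} {T : ℝ≥0}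
    (hδ : Integrable (fun s => δ s ω) (timeMeasure.restrict (Set.Iic T))) {h : ℕ → ℝ≥0}
    (h0 : ∀ j, 0 < h j) (hlim : Filter.Tendsto h Filter.atTop (nhds 0)) :
    ∀ᵐ t ∂timeMeasure.restrict (Set.Iic T),
      Filter.Tendsto (fun j => stepPath (h j) (pastAverage (h j) δ) t ω) Filter.atTop
        (nhds (δ t ω)) := by
  have hg := integrable_indicator_toNNReal hδ
  have hleb := IsUnifLocDoublingMeasure.ae_tendsto_average volume hg.locallyIntegrable 3
  have hne : ∀ᵐ x : ℝ, x ≠ 0 := compl_mem_ae_iff.2 (measure_singleton 0)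
  have hboth : ∀ᵐ t ∂timeMeasure, _ := ae_of_ae_map (f := ((↑) : ℝ≥0 → ℝ))
    (by fun_prop) (map_timeMeasure ▸ ae_restrict_of_ae (hleb.and hne))
  have hT : ∀ᵐ s ∂timeMeasure.restrict (Set.Iic T), s ≤ T := ae_restrict_mem measurableSet_Iic
  filter_upwards [ae_restrict_of_ae hboth, hT] with t ht htT
  obtain ⟨ht, ht0⟩ := ht
  have ht0' : 0 < t := pos_iff_ne_zero.2 fun h => ht0 (by simp [h])
  have hval : (Set.Icc (0 : ℝ) T).indicator (fun x => δ x.toNNReal ω) t = δ t ω := by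
    rw [Set.indicator_of_mem (s := Set.Icc (0 : ℝ) T)
      ⟨t.coe_nonneg, NNReal.coe_le_coe.2 htT⟩, Real.toNNReal_coe]
  have hev : ∀ᶠ j in Filter.atTop, h j < t := hlim.eventually_lt_const ht0'
  have hfl : ∀ j, h j < t → ∃ k : ℕ, ⌊t / h j⌋₊ = k + 1 ∧ (k + 1 : ℕ) * h j ≤ t ∧
      t < (k + 2 : ℕ) * h j := fun j hj => by
    have h1 : 1 ≤ ⌊t / h j⌋₊ := Nat.one_le_floor_iff _ |>.2 ((one_le_div (h0 j)).2 hj.le)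
    obtain ⟨k, hk⟩ := Nat.exists_eq_add_of_le' h1
    refine ⟨k, hk, ?_, ?_⟩
    · rw [← hk]
      exact (le_div_iff₀ (h0 j)).1 (Nat.floor_le zero_le)
    · have := Nat.lt_floor_add_one (t / h j)
      rw [hk, div_lt_iff₀ (h0 j)] at this
      exact_mod_cast this
  have hlimR : Filter.Tendsto (fun j => (h j : ℝ) / 2) Filter.atTop (nhdsWithin 0 (Set.Ioi 0)) := by
    refine tendsto_nhdsWithin_iff.2 ⟨?_, Filter.Eventually.of_forall fun j =>
      half_pos (NNReal.coe_pos.2 (h0 j))⟩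
    have := ((NNReal.continuous_coe.tendsto 0).comp hlim).div_const 2
    simpa using this
  have hmain := ht (fun j => ((⌊t / h j⌋₊ : ℝ) - 1 / 2) * h j) (fun j => (h j : ℝ) / 2) hlimR ?_
  · rw [hval] at hmain
    refine hmain.congr' ?_
    filter_upwards [hev] with j hj
    obtain ⟨k, hk, hk1, hk2⟩ := hfl j hj
    rw [stepPath, hk, pastAverage_eq_average (h0 j) (hk1.trans htT) hδ]
    congr 4
    push_cast
    ring
  · filter_upwards [hev] with j hj
    obtain ⟨k, hk, hk1, hk2⟩ := hfl j hj
    have hk1' : ((k : ℝ) + 1) * h j ≤ t := by exact_mod_cast hk1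
    have hk2' : (t : ℝ) < ((k : ℝ) + 2) * h j := by exact_mod_cast hk2
    rw [Real.closedBall_eq_Icc, hk]
    push_cast
    constructor <;> nlinarith [h0 j]

theorem norm_pastAverage_le {δ : ℝ≥0 → Ω → E} {M : ℝ} (hM : ∀ t ω, ‖δ t ω‖ ≤ M) {h T : ℝ≥0}
    (hh : 0 < h) {k : ℕ} (hk : k * h ≤ T) {ω : Ω}
    (hδ : Integrable (fun s => δ s ω) (timeMeasure.restrict (Set.Iic T))) :
    ‖pastAverage h δ k ω‖ ≤ M := by
  have hM0 : 0 ≤ M := (norm_nonneg _).trans (hM 0 ω)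
  cases k with
  | zero => simpa [pastAverage] using hM0
  | succ k =>
    have hh' : (0 : ℝ) < h := hh
    have hv : volume.real (Metric.closedBall (((k : ℝ) + 1 / 2) * h) ((h : ℝ) / 2)) = h := by
      rw [Real.volume_real_closedBall (by positivity)]
      ring
    have hb : ∀ x : ℝ, ‖(Set.Icc (0 : ℝ) T).indicator (fun x => δ x.toNNReal ω) x‖ ≤ M := fun x =>
      (norm_indicator_le_norm_self _ _).trans (hM _ _)
    have := norm_setIntegral_le_of_norm_le_const (μ := volume)
      (s := Metric.closedBall (((k : ℝ) + 1 / 2) * h) ((h : ℝ) / 2)) measure_closedBall_lt_top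
      fun x _ => hb x
    rw [pastAverage_eq_average hh hk hδ, setAverage_eq, hv, norm_smul, norm_inv,
      Real.norm_of_nonneg hh'.le, inv_mul_le_iff₀ hh', mul_comm (h : ℝ) M]
    rwa [hv] at this

/-- A crude bound, valid for paths without any integrability and for cells beyond the horizon. -/
theorem exists_norm_pastAverage_le {δ : ℝ≥0 → Ω → E} {M : ℝ} (hM : ∀ t ω, ‖δ t ω‖ ≤ M) (h : ℝ≥0)
    (k : ℕ) : ∃ B : ℝ, ∀ ω, ‖pastAverage h δ k ω‖ ≤ B := by
  have hr : ∀ t ω, ‖runInt δ t ω‖ ≤ M * t := fun t ω => by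
    have := norm_setIntegral_le_of_norm_le_const (μ := timeMeasure) (s := Set.Iic t)
      (f := fun s => δ s ω) (C := M) (by rw [timeMeasure_Iic]; exact ENNReal.ofReal_lt_top)
      (fun s _ => hM s ω)
    rwa [Measure.real, timeMeasure_Iic, ENNReal.toReal_ofReal t.coe_nonneg] at this
  cases k with
  | zero => exact ⟨0, fun ω => by simp [pastAverage]⟩
  | succ k =>
    refine ⟨(h : ℝ)⁻¹ * (M * ((k + 1 : ℕ) * h : ℝ≥0) + M * (k * h : ℝ≥0)), fun ω => ?_⟩
    rw [pastAverage, norm_smul, Real.norm_of_nonneg (by positivity)]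
    exact mul_le_mul_of_nonneg_left ((norm_sub_le _ _).trans (add_le_add (hr _ ω) (hr _ ω)))
      (by positivity)

end Approximation

namespace Noise

variable {n d : ℕ} {Ω : Type*} [mΩ : MeasurableSpace Ω] {P : Measure Ω} {N : Noise n d P} {T : ℝ≥0}

/-- Values of norm larger than `M` are replaced by zero. -/
theorem IsFullControl.truncate {δ : ℝ≥0 → Ω → Conf n d} (hδ : N.IsFullControl T δ) (M : ℝ) :
    N.IsFullControl T (fun t ω => (Metric.closedBall 0 M).indicator id (δ t ω)) := by
  have hm : Measurable ((Metric.closedBall (0 : Conf n d) M).indicator id) :=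
    measurable_id.indicator Metric.isClosed_closedBall.measurableSet
  refine ⟨fun t => hm.comp (hδ.1 t), hδ.2.mono (hm.comp_aemeasurable
    hδ.2.1.aemeasurable).aestronglyMeasurable (Filter.Eventually.of_forall fun p => ?_)⟩
  exact norm_indicator_le_norm_self id (δ p.1 p.2)

theorem tendsto_energy_truncate {δ : ℝ≥0 → Ω → Conf n d} (hδ : N.IsFullControl T δ) :
    Filter.Tendsto (fun M : ℕ => energy P T (fun t ω =>
      δ t ω - (Metric.closedBall 0 (M : ℝ)).indicator id (δ t ω))) Filter.atTop (nhds 0) := by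
  have h0 : (0 : ℝ) = ∫ _, (0 : ℝ) ∂controlMeasure P T := by simp
  rw [h0]
  refine tendsto_integral_of_dominated_convergence (fun p => ‖δ p.1 p.2‖ ^ 2)
    (fun M => ((hδ.2.1.sub (hδ.truncate M).2.1).norm.pow 2)) (integrable_sq_norm_of_memLp hδ.2)
    (fun M => Filter.Eventually.of_forall fun p => ?_) (Filter.Eventually.of_forall fun p => ?_)
  · rw [Real.norm_of_nonneg (by positivity)]
    refine pow_le_pow_left₀ (norm_nonneg _) ?_ 2
    by_cases h : δ p.1 p.2 ∈ Metric.closedBall 0 (M : ℝ)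
    · simp [Set.indicator_of_mem h]
    · simp [Set.indicator_of_notMem h]
  · obtain ⟨M, hM⟩ := exists_nat_ge ‖δ p.1 p.2‖
    refine tendsto_const_nhds.congr' ?_
    filter_upwards [Filter.eventually_ge_atTop M] with m hm
    have h : δ p.1 p.2 ∈ Metric.closedBall 0 (m : ℝ) :=
      mem_closedBall_zero_iff.2 (hM.trans (Nat.cast_le.2 hm))
    simp [Set.indicator_of_mem h]

theorem energy_add_le {φ ψ : ℝ≥0 → Ω → Conf n d} (hφ : SquareIntegrable P T φ)
    (hψ : SquareIntegrable P T ψ) :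
    energy P T (fun t ω => φ t ω + ψ t ω) ≤ 2 * energy P T φ + 2 * energy P T ψ := by
  have h1 : Integrable (fun p : ℝ≥0 × Ω => 2 * ‖φ p.1 p.2‖ ^ 2) (controlMeasure P T) :=
    (integrable_sq_norm_of_memLp hφ).const_mul 2
  have h2 : Integrable (fun p : ℝ≥0 × Ω => 2 * ‖ψ p.1 p.2‖ ^ 2) (controlMeasure P T) :=
    (integrable_sq_norm_of_memLp hψ).const_mul 2
  rw [energy, energy, energy, ← integral_const_mul, ← integral_const_mul, ← integral_add h1 h2]
  refine integral_mono (integrable_sq_norm_of_memLp (hφ.add hψ)) (h1.add h2) fun p => ?_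
  change ‖φ p.1 p.2 + ψ p.1 p.2‖ ^ 2 ≤ 2 * ‖φ p.1 p.2‖ ^ 2 + 2 * ‖ψ p.1 p.2‖ ^ 2
  have h3 := pow_le_pow_left₀ (norm_nonneg _) (norm_add_le (φ p.1 p.2) (ψ p.1 p.2)) 2
  nlinarith [sq_nonneg (‖φ p.1 p.2‖ - ‖ψ p.1 p.2‖)]

variable [IsProbabilityMeasure P]

/-- Bounded full-information controls are approximated by their past averages, in
`L²([0, T] × Ω)`. -/
theorem tendsto_energy_sub_pastAverage {δ : ℝ≥0 → Ω → Conf n d} (hδ : N.IsFullControl T δ) {M : ℝ}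
    (hM : ∀ t ω, ‖δ t ω‖ ≤ M) {h : ℕ → ℝ≥0} (h0 : ∀ j, 0 < h j)
    (hlim : Filter.Tendsto h Filter.atTop (nhds 0))
    (hSI : ∀ j, SquareIntegrable P T (stepPath (h j) (pastAverage (h j) δ))) :
    Filter.Tendsto (fun j => energy P T (fun t ω =>
      δ t ω - stepPath (h j) (pastAverage (h j) δ) t ω)) Filter.atTop (nhds 0) := by
  have hd : ∀ j, MemLp (fun p : ℝ≥0 × Ω =>
      δ p.1 p.2 - stepPath (h j) (pastAverage (h j) δ) p.1 p.2) 2 (controlMeasure P T) :=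
    fun j => hδ.2.sub (hSI j)
  have he : ∀ j, energy P T (fun t ω => δ t ω - stepPath (h j) (pastAverage (h j) δ) t ω) =
      ∫ ω, (∫ t in Set.Iic T, ‖δ t ω - stepPath (h j) (pastAverage (h j) δ) t ω‖ ^ 2
        ∂timeMeasure) ∂P := fun j => (integral_sq_norm_eq (φ := fun t ω =>
          δ t ω - stepPath (h j) (pastAverage (h j) δ) t ω) (hd j)).2.symm
  simp only [he]
  have hT : ∀ᵐ s ∂timeMeasure.restrict (Set.Iic T), s ≤ T := ae_restrict_mem measurableSet_Iic
  have hpath := ae_memLp_path hδ.2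
  have hpathd : ∀ᵐ ω ∂P, ∀ j, MemLp (fun t =>
      δ t ω - stepPath (h j) (pastAverage (h j) δ) t ω) 2 (timeMeasure.restrict (Set.Iic T)) :=
    ae_all_iff.2 fun j => ae_memLp_path (φ := fun t ω =>
      δ t ω - stepPath (h j) (pastAverage (h j) δ) t ω) (hd j)
  have hbound : ∀ᵐ ω ∂P, ∀ j, ∀ᵐ t ∂timeMeasure.restrict (Set.Iic T),
      ‖δ t ω - stepPath (h j) (pastAverage (h j) δ) t ω‖ ^ 2 ≤ (2 * M) ^ 2 := by
    filter_upwards [hpath] with ω hω j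
    filter_upwards [hT] with t ht
    have hk : ⌊t / h j⌋₊ * h j ≤ T :=
      ((le_div_iff₀ (h0 j)).1 (Nat.floor_le zero_le)).trans ht
    refine pow_le_pow_left₀ (norm_nonneg _) ((norm_sub_le _ _).trans ?_) 2
    have := norm_pastAverage_le hM (h0 j) hk (hω.integrable one_le_two)
    rw [stepPath]
    linarith [hM t ω]
  have h1 : (0 : ℝ) = ∫ _, (0 : ℝ) ∂P := by simp
  rw [h1]
  refine tendsto_integral_of_dominated_convergence (fun _ => T * (2 * M) ^ 2)
    (fun j => (integral_sq_norm_eq (φ := fun t ω =>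
      δ t ω - stepPath (h j) (pastAverage (h j) δ) t ω) (hd j)).1.1)
    (integrable_const _) (fun j => ?_) ?_
  · filter_upwards [hpathd, hbound] with ω h1 h2
    rw [Real.norm_of_nonneg (integral_nonneg fun _ => by positivity)]
    refine (integral_mono_ae (integrable_sq_norm_of_memLp (h1 j)) (integrable_const _)
      (h2 j)).trans_eq ?_
    rw [integral_const, measureReal_timeMeasure_Iic, smul_eq_mul]
  · filter_upwards [hpath, hpathd, hbound] with ω hω h1 h2
    have h3 : (0 : ℝ) = ∫ _ in Set.Iic T, (0 : ℝ) ∂timeMeasure := by simp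
    rw [h3]
    refine tendsto_integral_of_dominated_convergence (fun _ => (2 * M) ^ 2)
      (fun j => (h1 j).1.norm.pow 2) (integrable_const _) (fun j => ?_) ?_
    · filter_upwards [h2 j] with t ht
      rwa [Real.norm_of_nonneg (by positivity)]
    · filter_upwards [ae_tendsto_stepPath_pastAverage (hω.integrable one_le_two) h0 hlim]
        with t ht
      have := ((tendsto_const_nhds (x := δ t ω)).sub ht).norm.pow 2
      simpa using this

/-- Step processes are dense in the full-information controls. -/
theorem exists_stepPath_energy_lt {δ : ℝ≥0 → Ω → Conf n d} (hδ : N.IsFullControl T δ) {ε : ℝ}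
    (hε : 0 < ε) : ∃ (h : ℝ≥0) (ψ : ℕ → Ω → Conf n d), 0 < h ∧
      (∀ k : ℕ, Measurable[N.fullFiltration (k * h)] (ψ k)) ∧ (∀ k, MemLp (ψ k) 2 P) ∧
      energy P T (fun t ω => δ t ω - stepPath h ψ t ω) < ε := by
  obtain ⟨M, hM⟩ := ((tendsto_energy_truncate hδ).eventually_lt_const
    (show (0 : ℝ) < ε / 4 by positivity)).exists
  set δ' : ℝ≥0 → Ω → Conf n d := fun t ω => (Metric.closedBall 0 (M : ℝ)).indicator id (δ t ω)
    with hδ'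
  have hc : N.IsFullControl T δ' := hδ.truncate M
  have hb : ∀ t ω, ‖δ' t ω‖ ≤ M := fun t ω => by
    by_cases h : δ t ω ∈ Metric.closedBall 0 (M : ℝ)
    · simpa [hδ', Set.indicator_of_mem h] using h
    · simp [hδ', Set.indicator_of_notMem h]
  let h : ℕ → ℝ≥0 := fun j => 1 / ((j : ℝ≥0) + 1)
  have h0 : ∀ j, 0 < h j := fun j => by positivity
  have hlim : Filter.Tendsto h Filter.atTop (nhds 0) := tendsto_one_div_add_atTop_nhds_zero_nat
  have hm : ∀ (j k : ℕ), Measurable[N.fullFiltration (k * h j)] (pastAverage (h j) δ' k) :=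
    fun j k =>
    measurable_pastAverage hc.1 (h j) k
  have hL : ∀ j k, MemLp (pastAverage (h j) δ' k) 2 P := fun j k => by
    obtain ⟨B, hB⟩ := exists_norm_pastAverage_le hb (h j) k
    exact MemLp.of_bound (((hm j k).mono (N.fullFiltration.le _)
      le_rfl).stronglyMeasurable.aestronglyMeasurable) B (Filter.Eventually.of_forall hB)
  have hS : ∀ j, SquareIntegrable P T (stepPath (h j) (pastAverage (h j) δ')) := fun j =>
    memLp_stepPath (hL j)
  obtain ⟨j, hj⟩ := ((tendsto_energy_sub_pastAverage hc hb h0 hlim hS).eventually_lt_const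
    (show (0 : ℝ) < ε / 4 by positivity)).exists
  refine ⟨h j, pastAverage (h j) δ', h0 j, hm j, hL j, ?_⟩
  have h1 := energy_add_le (P := P) (T := T) (φ := fun t ω => δ t ω - δ' t ω)
    (ψ := fun t ω => δ' t ω - stepPath (h j) (pastAverage (h j) δ') t ω)
    (hδ.2.sub hc.2) (hc.2.sub (hS j))
  simp only [sub_add_sub_cancel] at h1
  linarith

end Noise

/-! ### Comparison of the two optimal controls -/

namespace Noise

variable {n d : ℕ} {Ω : Type*} [mΩ : MeasurableSpace Ω] {P : Measure Ω} {N : Noise n d P} {T : ℝ≥0}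

theorem IsFullControl.sub {α β : ℝ≥0 → Ω → Conf n d} (hα : N.IsFullControl T α)
    (hβ : N.IsFullControl T β) : N.IsFullControl T (fun t ω => α t ω - β t ω) :=
  ⟨fun t => (hα.1 t).sub (hβ.1 t), hα.2.sub hβ.2⟩

/-- By symmetry of the Hessian, the sum over off-diagonal blocks is twice that over `i < j`. -/
theorem offDiagSum_eq {u : Conf n d → ℝ} (hu : ContDiff ℝ 2 u) :
    offDiagSum u = 2 * ∑ i, ∑ j ∈ Finset.Ioi i, blockSupNorm u i j ^ 2 := by
  have h1 : ∀ i : Fin n, Finset.univ.erase i = Finset.Iio i ∪ Finset.Ioi i := fun i => by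
    ext j
    simp [lt_or_lt_iff_ne]
  have h2 : ∀ i : Fin n, Disjoint (Finset.Iio i) (Finset.Ioi i) := fun i =>
    Finset.disjoint_left.2 fun j h h' => lt_asymm (Finset.mem_Iio.1 h) (Finset.mem_Ioi.1 h')
  have h3 : ∑ i : Fin n, ∑ j ∈ Finset.Iio i, blockSupNorm u i j ^ 2 =
      ∑ i : Fin n, ∑ j ∈ Finset.Ioi i, blockSupNorm u i j ^ 2 := by
    rw [Finset.sum_comm' (t' := Finset.univ) (s' := fun j => Finset.Ioi j) (by simp)]
    simp only [blockSupNorm_comm hu]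
  rw [offDiagSum, Finset.sum_congr rfl fun i _ => by rw [h1 i, Finset.sum_union (h2 i)],
    Finset.sum_add_distrib, h3, two_mul]

variable [IsProbabilityMeasure P] {L : Fin n → Vec d × Vec d → ℝ} {F G : Conf n d → ℝ}
  {α αbar : ℝ≥0 → Ω → Conf n d} {C_P C_L C_F C_G : ℝ}

/-- Bound on the derivative of the cost at the distributed optimum, in the direction of an arbitrary
full-information control. -/
theorem abs_costDeriv_le_offDiagSum (hL : ∀ i, C2BoundedHess (L i))
    (hF : CostAssumption F C_F) (hG : CostAssumption G C_G)
    (hα : N.IsDistributedOptimal T L F G α)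
    (hP : ∀ t ≤ T, Poincare (P.map (N.state α t)) C_P) {δ : ℝ≥0 → Ω → Conf n d}
    (hδ : N.IsFullControl T δ) {r : ℝ} (hr : 0 < r) :
    |N.costDeriv T L F G α δ| ≤
      r / 2 * (|C_P| * (T * offDiagSum F + offDiagSum G)) +
        1 / r * (((T : ℝ) ^ 2 / 2 + T) * energy P T δ) := by
  obtain ⟨M, hM⟩ := abs_costDeriv_le (N := N) hL hF.c2 hG.c2 hα.1.2
  set A := |C_P| * (T * offDiagSum F + offDiagSum G)
  set B := (T : ℝ) ^ 2 / 2 + T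
  have hB : 0 ≤ B := by positivity
  have key : ∀ ε : ℝ, 0 < ε → |N.costDeriv T L F G α δ| ≤
      r / 2 * A + 1 / (2 * r) * (B * (2 * energy P T δ + 2 * ε)) + |M| * Real.sqrt ε := by
    intro ε hε
    obtain ⟨h, ψ, hh, hψm, hψ, hlt⟩ := exists_stepPath_energy_lt hδ hε
    have hS : SquareIntegrable P T (stepPath h ψ) := memLp_stepPath hψ
    obtain ⟨φ, hφ, horth, hen⟩ := exists_distributed_of_stepPath (T := T) hh hψm hψ
    have hdiff : SquareIntegrable P T (fun t ω => δ t ω - stepPath h ψ t ω) := hδ.2.sub hS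
    have h1 := abs_costDeriv_le_of_orthogonal hL hF hG hα.1 hP horth (hS.sub hφ.2) hr
    -- the derivative vanishes in the direction of distributed controls
    rw [costDeriv_sub hL hF.c2 hG.c2 hα.1.2 hS hφ.2,
      costDeriv_eq_zero hL hF.c2 hG.c2 hα hφ, sub_zero] at h1
    change _ ≤ r / 2 * A + 1 / (2 * r) * (B * _) at h1
    have h2 := hM _ hdiff
    rw [costDeriv_sub hL hF.c2 hG.c2 hα.1.2 hδ.2 hS] at h2
    have h3 : energy P T (stepPath h ψ) ≤ 2 * energy P T δ + 2 * ε := by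
      have hadd := energy_add_le (P := P) (T := T) (φ := δ)
        (ψ := fun t ω => stepPath h ψ t ω - δ t ω) hδ.2 (hS.sub hδ.2)
      have hsymm : energy P T (fun t ω => stepPath h ψ t ω - δ t ω) =
          energy P T (fun t ω => δ t ω - stepPath h ψ t ω) := by
        simp only [energy, norm_sub_rev]
      simp only [add_sub_cancel] at hadd
      have e : energy P T (fun t ω => stepPath h ψ t ω) = energy P T (stepPath h ψ) := rfl
      linarith
    have h4 : M * Real.sqrt (energy P T fun t ω => δ t ω - stepPath h ψ t ω) ≤
        |M| * Real.sqrt ε :=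
      mul_le_mul (le_abs_self M) (Real.sqrt_le_sqrt hlt.le) (Real.sqrt_nonneg _) (abs_nonneg M)
    have h5 : 1 / (2 * r) * (B * energy P T fun t ω => stepPath h ψ t ω - φ t ω) ≤
        1 / (2 * r) * (B * (2 * energy P T δ + 2 * ε)) :=
      mul_le_mul_of_nonneg_left (mul_le_mul_of_nonneg_left (hen.trans h3) hB) (by positivity)
    have h6 := abs_sub_abs_le_abs_sub (N.costDeriv T L F G α δ)
      (N.costDeriv T L F G α (stepPath h ψ))
    linarith
  have hlim : Filter.Tendsto (fun ε : ℝ => r / 2 * A +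
      1 / (2 * r) * (B * (2 * energy P T δ + 2 * ε)) + |M| * Real.sqrt ε)
      (nhdsWithin 0 (Set.Ioi 0)) (nhds (r / 2 * A +
        1 / (2 * r) * (B * (2 * energy P T δ + 2 * 0)) + |M| * Real.sqrt 0)) :=
    Filter.Tendsto.mono_left (Continuous.tendsto (by fun_prop) 0) nhdsWithin_le_nhds
  have h := ge_of_tendsto hlim (Filter.eventually_of_mem self_mem_nhdsWithin key)
  refine h.trans_eq ?_
  rw [Real.sqrt_zero]
  field_simp
  ring

/-- The distance of the two optimal controls: strong convexity against the derivative bound. -/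
theorem energy_sub_le (hsmall : 1 / 2 * C_F * (T : ℝ) ^ 2 + C_G * T < C_L) [Nontrivial (Conf n d)]
    (hT : 0 < T) (hL : ∀ i, LagrangianAssumption (L i) C_L) (hF : CostAssumption F C_F)
    (hG : CostAssumption G C_G) (hα : N.IsDistributedOptimal T L F G α)
    (hαbar : N.IsFullOptimal T L F G αbar)
    (hP : ∀ t ≤ T, Poincare (P.map (N.state α t)) C_P) :
    energy P T (fun t ω => αbar t ω - α t ω) ≤
      8 * ((T : ℝ) ^ 2 / 2 + T) / (C_L - (1 / 2 * C_F * (T : ℝ) ^ 2 + C_G * T)) ^ 2 *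
        (n : ℝ) ^ 2 * (|C_P| * (T * offDiagSum F + offDiagSum G)) := by
  have hn : (0 : ℝ) < n := by
    refine Nat.cast_pos.2 (Nat.pos_of_ne_zero fun h => ?_)
    subst h
    exact not_subsingleton (Conf 0 d) inferInstance
  -- the bounds of the gradients force `C_F` and `C_G` to be nonnegative
  have hnonneg : ∀ {u : Conf n d → ℝ} {c : ℝ}, CostAssumption u c → 0 ≤ c := fun {u c} hu => by
    obtain ⟨K, hK⟩ := hu.bddGrad
    have h := nonneg_of_bounded_grad hu.c2.1 hK hu.semiconvex
    rwa [le_div_iff₀ hn, zero_mul] at h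
  -- the value `4 n B / c` of the parameter makes the term with the energy equal to half of the one
  -- given by strong convexity
  set c := C_L - (1 / 2 * C_F * (T : ℝ) ^ 2 + C_G * T) with hc
  have hc0 : 0 < c := sub_pos.2 hsmall
  set A := |C_P| * (T * offDiagSum F + offDiagSum G)
  set B := (T : ℝ) ^ 2 / 2 + T with hB
  have hT' : (0 : ℝ) < T := hT
  have hB0 : 0 < B := by positivity
  have h1 := cost_lower (N := N) (hnonneg hF) (hnonneg hG) hL hF hG hα.1.2 hαbar.1.2
  have h2 := hαbar.2 α hα.1.isFullControl
  have h3 := abs_costDeriv_le_offDiagSum (fun i => (hL i).c2) hF hG hα hP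
    (hαbar.1.sub hα.1.isFullControl) (r := 4 * n * B / c) (by positivity)
  have h4 := neg_abs_le (N.costDeriv T L F G α (fun t ω => αbar t ω - α t ω))
  set Q := energy P T (fun t ω => αbar t ω - α t ω)
  change _ ≤ 4 * n * B / c / 2 * A + 1 / (4 * n * B / c) * (B * Q) at h3
  change _ + c / (2 * n) * Q ≤ _ at h1
  have h5 : c / (2 * n) * Q ≤ 4 * n * B / c / 2 * A + 1 / (4 * n * B / c) * (B * Q) := by linarith
  have e1 : 1 / (4 * n * B / c) * (B * Q) = c / (4 * n) * Q := by field_simp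
  have e2 : c / (2 * n) * Q = c / (4 * n) * Q + c / (4 * n) * Q := by field_simp; ring
  have h6 : c / (4 * n) * Q ≤ 4 * n * B / c / 2 * A := by linarith
  have h7 := mul_le_mul_of_nonneg_left h6 (show 0 ≤ 4 * n / c by positivity)
  calc Q = 4 * n / c * (c / (4 * n) * Q) := by field_simp
    _ ≤ _ := h7
    _ = _ := by field_simp; ring

theorem integral_sq_norm_sub_eq {α αbar : ℝ≥0 → Ω → Conf n d}
    (hα : SquareIntegrable P T α) (hαbar : SquareIntegrable P T αbar) :
    ∫ ω, (∫ t in Set.Iic T, ‖α t ω - αbar t ω‖ ^ 2 ∂timeMeasure) ∂P =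
      energy P T (fun t ω => αbar t ω - α t ω) := by
  have h := (integral_sq_norm_eq (φ := fun t ω => α t ω - αbar t ω) (hα.sub hαbar)).2
  rw [h, energy]
  simp only [norm_sub_rev]

/-- The comparison of the two optimal controls, with an explicit constant. -/
theorem integral_sq_norm_sub_le [Nontrivial (Conf n d)]
    (hsmall : 1 / 2 * C_F * (T : ℝ) ^ 2 + C_G * T < C_L) (hT : 0 < T)
    (hL : ∀ i, LagrangianAssumption (L i) C_L) (hF : CostAssumption F C_F)
    (hG : CostAssumption G C_G) (hα : N.IsDistributedOptimal T L F G α)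
    (hαbar : N.IsFullOptimal T L F G αbar)
    (hP : ∀ t ≤ T, Poincare (P.map (N.state α t)) C_P) :
    ∫ ω, (∫ t in Set.Iic T, ‖α t ω - αbar t ω‖ ^ 2 ∂timeMeasure) ∂P ≤
      8 * ((T : ℝ) ^ 2 / 2 + T) / (C_L - (1 / 2 * C_F * (T : ℝ) ^ 2 + C_G * T)) ^ 2 *
        (|C_P| * (2 * (T + 1))) * (n : ℝ) ^ 2 * ∑ i : Fin n, ∑ j ∈ Finset.Ioi i,
          (blockSupNorm F i j ^ 2 + blockSupNorm G i j ^ 2) := by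
  rw [integral_sq_norm_sub_eq hα.1.2 hαbar.1.2]
  refine (energy_sub_le hsmall hT hL hF hG hα hαbar hP).trans ?_
  rw [offDiagSum_eq hF.c2.1, offDiagSum_eq hG.c2.1]
  simp only [Finset.sum_add_distrib]
  have hSF : 0 ≤ ∑ i : Fin n, ∑ j ∈ Finset.Ioi i, blockSupNorm F i j ^ 2 :=
    Finset.sum_nonneg fun i _ => Finset.sum_nonneg fun j _ => sq_nonneg _
  have hSG : 0 ≤ ∑ i : Fin n, ∑ j ∈ Finset.Ioi i, blockSupNorm G i j ^ 2 :=
    Finset.sum_nonneg fun i _ => Finset.sum_nonneg fun j _ => sq_nonneg _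
  generalize ∑ i : Fin n, ∑ j ∈ Finset.Ioi i, blockSupNorm F i j ^ 2 = SF at *
  generalize ∑ i : Fin n, ∑ j ∈ Finset.Ioi i, blockSupNorm G i j ^ 2 = SG at *
  have hK : 0 ≤ 8 * ((T : ℝ) ^ 2 / 2 + T) / (C_L - (1 / 2 * C_F * (T : ℝ) ^ 2 + C_G * T)) ^ 2 := by
    positivity
  generalize 8 * ((T : ℝ) ^ 2 / 2 + T) / (C_L - (1 / 2 * C_F * (T : ℝ) ^ 2 + C_G * T)) ^ 2 = K at *
  have h1 : T * (2 * SF) + 2 * SG ≤ 2 * (T + 1) * (SF + SG) := by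
    have := mul_nonneg T.coe_nonneg hSG
    linarith
  have h2 : K * (n : ℝ) ^ 2 * (|C_P| * (T * (2 * SF) + 2 * SG)) ≤
      K * (n : ℝ) ^ 2 * (|C_P| * (2 * (T + 1) * (SF + SG))) :=
    mul_le_mul_of_nonneg_left (mul_le_mul_of_nonneg_left h1 (abs_nonneg C_P)) (by positivity)
  linarith

end Noise

end DistributedControl

end

theorem theorem7p2 (C_P C_L C_F C_G : ℝ) (T : ℝ≥0) (hT : 0 < T) (hC_L : 0 < C_L)
    (hsmall : 1 / 2 * C_F * (T : ℝ) ^ 2 + C_G * T < C_L) :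
    ∃ C : ℝ, 0 < C ∧
      ∀ (n d : ℕ) (Ω : Type*) [MeasurableSpace Ω] (P : Measure Ω) [IsProbabilityMeasure P]
        (N : DistributedControl.Noise n d P)
        (L : Fin n → DistributedControl.Vec d × DistributedControl.Vec d → ℝ)
        (F G : DistributedControl.Conf n d → ℝ)
        (α αbar : ℝ≥0 → Ω → DistributedControl.Conf n d),
        (∀ i, DistributedControl.LagrangianAssumption (L i) C_L) →
        DistributedControl.CostAssumption F C_F →
        DistributedControl.CostAssumption G C_G →
        N.IsDistributedOptimal T L F G α →
        N.IsFullOptimal T L F G αbar →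
        (∀ t ≤ T, DistributedControl.Poincare (P.map (N.state α t)) C_P) →
        ∫ ω, (∫ t in Set.Iic T, ‖α t ω - αbar t ω‖ ^ 2 ∂DistributedControl.timeMeasure) ∂P ≤
          C * (n : ℝ) ^ 2 * ∑ i : Fin n, ∑ j ∈ Finset.Ioi i,
            (DistributedControl.blockSupNorm F i j ^ 2 +
              DistributedControl.blockSupNorm G i j ^ 2) := by
  refine ⟨8 * ((T : ℝ) ^ 2 / 2 + T) / (C_L - (1 / 2 * C_F * (T : ℝ) ^ 2 + C_G * T)) ^ 2 *
    (|C_P| * (2 * (T + 1))) + 1, by positivity, ?_⟩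
  intro n d Ω _ P _ N L F G α αbar hL hF hG hα hαbar hP
  have hS : 0 ≤ ∑ i : Fin n, ∑ j ∈ Finset.Ioi i,
      (DistributedControl.blockSupNorm F i j ^ 2 + DistributedControl.blockSupNorm G i j ^ 2) :=
    Finset.sum_nonneg fun i _ => Finset.sum_nonneg fun j _ => by positivity
  rcases subsingleton_or_nontrivial (DistributedControl.Conf n d) with hs | hs
  · -- there are no players or no coordinates, and the left-hand side vanishes
    have h0 : ∀ t ω, ‖α t ω - αbar t ω‖ ^ 2 = 0 := fun t ω => by
      rw [Subsingleton.elim (α t ω) (αbar t ω), sub_self, norm_zero, zero_pow two_ne_zero]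
    simp only [h0, integral_zero]
    positivity
  · refine (DistributedControl.Noise.integral_sq_norm_sub_le hsmall hT hL hF hG hα hαbar
      hP).trans ?_
    refine mul_le_mul_of_nonneg_right (mul_le_mul_of_nonneg_right ?_ (by positivity)) hS
    exact le_add_of_nonneg_right zero_le_one
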